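/- **Team Formula Game.** An instance consists of finite sets of Boolean variables $X, X', Y_0, Y_1$ with initial values, variables $h_0,h_1\in X$, and Boolean formulas $F(X,X',Y_0,Y_1)$, $F'(X,X')$, $G(X)$ such that $F$ implies $\lnot F'$. Team White $\{W_0,W_1\}$ plays against team Black $\{B\}$; the following round is repeated until a team has won: (1) $B$ sets $X$ to any values; if $F$ and $G$ are true, Black wins; if $F$ is false, White wins; (2) $B$ sets $X'$ to any values; if $F'$ is false, White wins; (3) $W_0$ sets $Y_0$ to any values; (4) $W_1$ sets $Y_1$ to any values. $B$ has perfect information; $W_i$ sees only $Y_i$ and $h_i$. **Communication.** A policy $P$ is a DFA over a unary alphabet with state set $\Pi$ and no accepting states, together with functions $P_{\mathrm{mid}},P_{\mathrm{end}}:\Pi\to\mathbb N\times\mathbb N$; it starts in its initial state and makes one transition per round. In a round with policy state $p$, $W_0$ and $W_1$ simultaneously send each other messages between steps (2) and (3), and again after step (4). The two components of $P_{\mathrm{mid}}(p)$, respectively of $P_{\mathrm{end}}(p)$, are the numbers of bits sent from $W_0$ to $W_1$ and from $W_1$ to $W_0$. White has a forced win if there are deterministic strategies of $W_0$ and $W_1$,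 in which each message and each move of $W_i$ depends only on the instance, the policy, the values of $h_i$ seen so far and the messages received so far, such that White wins (after finitely many rounds) against every behaviour of $B$. The problem TFGC under $P$ asks, given an instance of the Team Formula Game, whether White has a forced win when communicating under $P$. **Theorem.** Under policies $P$ with $P_{\mathrm{mid}}(p)=(1,0)$ and $P_{\mathrm{end}}(p)=(0,0)$ for all $p\in\Pi$, that is, with a 1-bit mid-round exchange from $W_0$ to $W_1$ in every round and no other communication, TFGC is decidable in 3-EXPSPACE: it is decided by a Turing machine using space $2^{2^{2^{\mathrm{poly}(n)}}}$ on inputs of length $n$. The machine and the space bound can be chosen independently of $P$. -/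

import Mathlib

/-! ### Space-bounded computation -/

namespace SpaceComplexity

/-- The stack machine `tm` decides the language `L` within space `s`: on every word `w` it halts with
output `true` if `w ∈ L` and with output `false` if `w ∉ L`, and in every configuration
that the computation on `w` visits, the stacks together hold at most `s |w|` symbols.
A tape of a Turing machine is a pair of stacks, so this is the usual space measure
of multi-tape Turing machines (the cells of the input are counted as well).
The labels and the internal states of a `FinTM2` are finite in number. -/
structure DecidesInSpace {α : Type} (tm : Turing.FinTM2) (inp : tm.Γ tm.k₀ ≃ α)
    (out : tm.Γ tm.k₁ ≃ Bool) (L : Language α) (s : ℕ → ℕ) : Prop where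
  accepts : ∀ w ∈ L,
    Nonempty (Turing.TM2Outputs tm (w.map inp.symm) (some [out.symm true]))
  rejects : ∀ w, w ∉ L →
    Nonempty (Turing.TM2Outputs tm (w.map inp.symm) (some [out.symm false]))
  space : ∀ (w : List α) (c : tm.Cfg),
    StateTransition.Reaches tm.step (Turing.initList tm (w.map inp.symm)) c →
      (letI := tm.kFin; ∑ k : tm.K, (Turing.TM2.Cfg.stk c k).length) ≤ s w.length

/-- The languages decided by a Turing machine, with finite alphabets, within space `s`. -/
def DSPACE {α : Type} (s : ℕ → ℕ) : Set (Language α) :=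
  {L | ∃ (tm : Turing.FinTM2) (inp : tm.Γ tm.k₀ ≃ α) (out : tm.Γ tm.k₁ ≃ Bool),
    (∀ k, Finite (tm.Γ k)) ∧ DecidesInSpace tm inp out L s}

/-- `expTower k n` is the `k`-fold iterated exponential `2 ^ 2 ^ ⋯ ^ 2 ^ n`. -/
def expTower : ℕ → ℕ → ℕ
  | 0, n => n
  | k + 1, n => 2 ^ expTower k n

/-- The class `k`-EXPSPACE: space bounded by a `k`-fold exponential of a polynomial in the
length of the input. -/
def kEXPSPACE {α : Type} (k : ℕ) : Set (Language α) :=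
  {L | ∃ p : Polynomial ℕ, L ∈ DSPACE (fun n => expTower k (p.eval n))}

end SpaceComplexity

namespace TeamFormula

/-! ### Boolean formulas and instances of the Team Formula Game -/

/-- Boolean formulas over the set `V` of variables. -/
inductive BFormula (V : Type) : Type
  | const : Bool → BFormula V
  | var : V → BFormula V
  | neg : BFormula V → BFormula V
  | conj : BFormula V → BFormula V → BFormula V
  | disj : BFormula V → BFormula V → BFormula V

/-- The truth value of a formula under an assignment. -/
def BFormula.eval {V : Type} (v : V → Bool) : BFormula V → Bool
  | .const b => b
  | .var a => v a
  | .neg f => !(f.eval v)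
  | .conj f g => f.eval v && g.eval v
  | .disj f g => f.eval v || g.eval v

/-- Instances of the Team Formula Game. The sets of variables are
`X = Fin nX`, `X' = Fin nX'` and `Y_i = Fin (nY i)` for `i = 0, 1`. -/
structure TFG where
  nX : ℕ
  nX' : ℕ
  nY : Fin 2 → ℕ
  /-- initial values of the variables -/
  initX : Fin nX → Bool
  initX' : Fin nX' → Bool
  initY : ∀ i, Fin (nY i) → Bool
  /-- the variables `h_0, h_1 ∈ X` -/
  h : Fin 2 → Fin nX
  /-- the formula `F(X, X', Y_0, Y_1)` -/
  F : BFormula ((Fin nX ⊕ Fin nX') ⊕ (Σ i : Fin 2, Fin (nY i)))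
  /-- the formula `F'(X, X')` -/
  F' : BFormula (Fin nX ⊕ Fin nX')
  /-- the formula `G(X)` -/
  G : BFormula (Fin nX)
  /-- `F` implies `¬ F'` -/
  F_imp_not_F' : ∀ (x : Fin nX → Bool) (x' : Fin nX' → Bool) (y : ∀ i, Fin (nY i) → Bool),
    F.eval (Sum.elim (Sum.elim x x') (fun v => y v.1 v.2)) = true →
      F'.eval (Sum.elim x x') = false

/-- The truth value of `F(X, X', Y_0, Y_1)`. -/
def TFG.evalF (I : TFG) (x : Fin I.nX → Bool) (x' : Fin I.nX' → Bool)
    (y : ∀ i, Fin (I.nY i) → Bool) : Bool :=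
  I.F.eval (Sum.elim (Sum.elim x x') (fun v => y v.1 v.2))

/-- The truth value of `F'(X, X')`. -/
def TFG.evalF' (I : TFG) (x : Fin I.nX → Bool) (x' : Fin I.nX' → Bool) : Bool :=
  I.F'.eval (Sum.elim x x')

/-- The truth value of `G(X)`. -/
def TFG.evalG (I : TFG) (x : Fin I.nX → Bool) : Bool :=
  I.G.eval x

/-! ### Communication policies -/

/-- A policy: a finite automaton over a unary alphabet, without accepting states, together with
the numbers of bits exchanged mid-round and at the end of a round played in a given state.
The first component is the number of bits sent by player `0` to player `1`, the second one the
number of bits sent by player `1` to player `0`. -/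
structure Policy where
  State : Type
  finite_state : Finite State
  dfa : DFA Unit State
  accept_eq : dfa.accept = ∅
  mid : State → ℕ × ℕ
  fin : State → ℕ × ℕ

/-- The state of the policy in round `t` (rounds are numbered from `0`). -/
def Policy.stateAt (P : Policy) (t : ℕ) : P.State :=
  P.dfa.eval (List.replicate t ())

/-- The number of bits that player `i` sends to the other player mid-round in round `t`. -/
def Policy.midBits (P : Policy) (t : ℕ) (i : Fin 2) : ℕ :=
  if i = 0 then (P.mid (P.stateAt t)).1 else (P.mid (P.stateAt t)).2

/-- The number of bits that player `i` sends to the other player at the end of round `t`. -/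
def Policy.finBits (P : Policy) (t : ℕ) (i : Fin 2) : ℕ :=
  if i = 0 then (P.fin (P.stateAt t)).1 else (P.fin (P.stateAt t)).2

/-- One bit mid-round in every round from player `0` to player `1`, and no other communication. -/
def Policy.IsMidOneWay (P : Policy) : Prop :=
  ∀ p : P.State, P.mid p = (1, 0) ∧ P.fin p = (0, 0)

/-! ### The Team Formula Game with Communication -/

/-- What a player `W_i` learns in one round: the value of `h_i` and the messages received from the
teammate mid-round and at the end of the round. (The values of `Y_i` and the messages sent are
chosen by `W_i`, hence determined by the strategy and what has been learned.) -/
structure RoundObs where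
  h : Bool
  midRecv : List Bool
  finRecv : List Bool

/-- A strategy of player `W_i`. The list `past` holds the observations of `W_i` in the completed
rounds, most recent first, so its length is the number of the current round. -/
structure Strategy (I : TFG) (P : Policy) (i : Fin 2) where
  /-- the message sent mid-round -/
  midMsg : (past : List RoundObs) → (h : Bool) → (Fin (P.midBits past.length i) → Bool)
  /-- the values given to `Y_i` -/
  move : (past : List RoundObs) → (h : Bool) → (midRecv : List Bool) → (Fin (I.nY i) → Bool)
  /-- the message sent at the end of the round -/
  finMsg : (past : List RoundObs) → (h : Bool) → (midRecv : List Bool) →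
    (Fin (P.finBits past.length i) → Bool)

/-- The situation at the start of a round: the values of the variables and what each of
`W_0, W_1` has observed so far. -/
structure Config (I : TFG) where
  x : Fin I.nX → Bool
  x' : Fin I.nX' → Bool
  y : ∀ i, Fin (I.nY i) → Bool
  obs : Fin 2 → List RoundObs

/-- The situation at the start of the game. -/
def Config.init (I : TFG) : Config I where
  x := I.initX
  x' := I.initX'
  y := I.initY
  obs _ := []

/-- One round in which `B` sets `X` to `x` (step 1) and `X'` to `x'` (step 2), the players `W_0`
and `W_1` simultaneously exchange their mid-round messages, set `Y_0` and `Y_1` (steps 3 and 4),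
and simultaneously exchange their end-of-round messages. -/
def Config.next {I : TFG} {P : Policy} (S : ∀ i, Strategy I P i) (c : Config I)
    (x : Fin I.nX → Bool) (x' : Fin I.nX' → Bool) : Config I :=
  let h : Fin 2 → Bool := fun i => x (I.h i)
  let midSent : Fin 2 → List Bool := fun i => List.ofFn ((S i).midMsg (c.obs i) (h i))
  let finSent : Fin 2 → List Bool := fun i =>
    List.ofFn ((S i).finMsg (c.obs i) (h i) (midSent (1 - i)))
  { x := x
    x' := x'
    y := fun i => (S i).move (c.obs i) (h i) (midSent (1 - i))
    obs := fun i => ⟨h i, midSent (1 - i), finSent (1 - i)⟩ :: c.obs i }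

/-- Black wins in step 1 of the round that starts in `c` if `B` sets `X` to `x`. -/
def Config.BlackWins {I : TFG} (c : Config I) (x : Fin I.nX → Bool) : Prop :=
  I.evalF x c.x' c.y = true ∧ I.evalG x = true

/-- White wins in the round that starts in `c` if `B` sets `X` to `x` and `X'` to `x'`:
either `F` is false in step 1, or Black does not win in step 1 and `F'` is false in step 2. -/
def Config.WhiteWins {I : TFG} (c : Config I) (x : Fin I.nX → Bool) (x' : Fin I.nX' → Bool) :
    Prop :=
  I.evalF x c.x' c.y = false ∨ (¬ c.BlackWins x ∧ I.evalF' x x' = false)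

/-- The situation at the start of round `t` if `B` sets `X` and `X'` to `b s` in round `s`.
(The moves after the end of the game do not matter.) -/
def play {I : TFG} {P : Policy} (S : ∀ i, Strategy I P i)
    (b : ℕ → (Fin I.nX → Bool) × (Fin I.nX' → Bool)) : ℕ → Config I
  | 0 => Config.init I
  | t + 1 => (play S b t).next S (b t).1 (b t).2

/-- White has a forced win: there are strategies of `W_0` and `W_1` such that, whatever `B`
does, White wins in some round, Black not having won before. As the strategies of White are
deterministic functions and `B` has perfect information, the behaviours of `B` are exactly the
sequences of values of `X` and `X'`. A play that goes on forever is not won by White. -/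
def WhiteForcedWin (I : TFG) (P : Policy) : Prop :=
  ∃ S : ∀ i, Strategy I P i, ∀ b : ℕ → (Fin I.nX → Bool) × (Fin I.nX' → Bool),
    ∃ t, (play S b t).WhiteWins (b t).1 (b t).2 ∧
      ∀ s < t, ¬ (play S b s).BlackWins (b s).1

/-! ### Instances as words -/

/-- The alphabet in which instances are written. -/
inductive Sym : Type
  | bit : Bool → Sym
  | sep | tick | neg | conj | disj | varX | varX' | varY0 | varY1

/-- An index, in unary. -/
def encodeIndex (j : ℕ) : List Sym :=
  List.replicate j Sym.tick ++ [Sym.sep]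

/-- A list of bits, as initial values of a set of variables. -/
def encodeBits {n : ℕ} (v : Fin n → Bool) : List Sym :=
  (List.ofFn v).map Sym.bit ++ [Sym.sep]

/-- A formula in prefix notation, given the words for the variables. -/
def BFormula.encode {V : Type} (e : V → List Sym) : BFormula V → List Sym
  | .const b => [Sym.bit b]
  | .var a => e a
  | .neg f => Sym.neg :: f.encode e
  | .conj f g => Sym.conj :: (f.encode e ++ g.encode e)
  | .disj f g => Sym.disj :: (f.encode e ++ g.encode e)

/-- The words for the variables in `X`. -/
def encodeX {n : ℕ} (j : Fin n) : List Sym :=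
  Sym.varX :: encodeIndex j

/-- The words for the variables in `X ∪ X'`. -/
def encodeXX' {n n' : ℕ} : Fin n ⊕ Fin n' → List Sym
  | .inl j => encodeX j
  | .inr j => Sym.varX' :: encodeIndex j

/-- The words for the variables in `X ∪ X' ∪ Y_0 ∪ Y_1`. -/
def encodeXX'Y {n n' : ℕ} {m : Fin 2 → ℕ} :
    (Fin n ⊕ Fin n') ⊕ (Σ i : Fin 2, Fin (m i)) → List Sym
  | .inl v => encodeXX' v
  | .inr ⟨i, j⟩ => (if i = 0 then Sym.varY0 else Sym.varY1) :: encodeIndex j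

/-- An instance as a word: the variables with their initial values, the indices of `h_0` and
`h_1`, and the three formulas. -/
def TFG.encode (I : TFG) : List Sym :=
  encodeBits I.initX ++ encodeBits I.initX' ++ encodeBits (I.initY 0) ++ encodeBits (I.initY 1) ++
    encodeIndex (I.h 0) ++ encodeIndex (I.h 1) ++
    I.F.encode encodeXX'Y ++ I.F'.encode encodeXX' ++ I.G.encode encodeX

/-- The decision problem TFGC under the policy `P`: the words that encode an instance of the Team
Formula Game in which White has a forced win when communicating under `P`. -/
def TFGC (P : Policy) : Language Sym :=
  {w | ∃ I : TFG, I.encode = w ∧ WhiteForcedWin I P}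

end TeamFormula

/-! The bit that `W_0` sends in each round may as well be the value of `h_0`. `W_0` receives
nothing, so any message it could send is a function of the values of `h_0` seen so far, and telling
these values is at least as good. Then `W_1` knows everything that `W_0` knows, and the game becomes
one with hierarchical information: `W_0` plays a function of the history of `h_0`, and `W_1` a
function of the history of both bits. This is `whiteForcedWin_iff`; its right-hand side does not
mention the policy, so one language serves all policies.

The hierarchical game is solved by two nested powerset constructions. Between rounds only the values
of `X'`, `Y_0` and `Y_1` matter, which gives at most `2 ^ n` states on inputs of length `n`. The
uncertainty of `W_1` is a set `K` of states. The uncertainty of `W_0` is a family `F` of such sets,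
one for each thing that `W_1` may know. A family is good if a single strategy of `W_0` admits, for
each member `K`, a strategy of `W_1` that wins from all states in `K`. A winning play tree is
finitely branching and well-founded, hence of bounded height, and so the good families are obtained
by iterating `Reducible`. Thus White wins if and only if every set `T` closed under `Reducible`
contains a family with a member that contains the initial state
(`HierarchicalGame.exists_wins_iff`).

States, sets and families are coded as numbers by their binary digits. Families have codes below `B
= 2 ^ 2 ^ 2 ^ n`, and `T` is a word of `B` bits. The condition "for all `T`" is a universally
quantified word followed by a first-order sentence over the numbers below `B`, with addition, the
bit predicate and access to the input word. Being the encoding of an instance and the values of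
formulas are first-order too: the relation between a factor of the input and its truth value is
coded by two numbers below `2 ^ 2 ^ n`, so the least relation that obeys the evaluation rules can be
described by quantifying over numbers (`val_iff`).

Such a sentence is decided by brute force (`mem_kEXPSPACE_of_formula`): all words of length `B` are
tried, and the first-order part is evaluated with a fixed number of unary counters of size `O(B)`.
The constant factor is absorbed by a larger argument of the iterated exponential. The procedure is
written in a small language of structured stack programs with a space-aware semantics `Exec`, which
is compiled to Turing machines once and for all (`mem_DSPACE_of_exec`). -/

set_option linter.unusedSimpArgs false
set_option linter.unusedSectionVars false

/-! ### Structured programs over stacks -/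

namespace StackProgram

open TeamFormula SpaceComplexity Relation Function

/-- Structured programs over stacks of symbols, indexed by `κ`. -/
inductive Prog (κ : Type) : Type
  | skip : Prog κ
  | push (k : κ) (a : Sym) : Prog κ
  | pop (k : κ) : Prog κ
  | move (j k : κ) : Prog κ
  | setTop (k : κ) (a : Sym) : Prog κ
  | seq (p q : Prog κ) : Prog κ
  | ite (k : κ) (c : Option Sym → Bool) (p q : Prog κ) : Prog κ
  | loop (k : κ) (c : Option Sym → Bool) (p : Prog κ) : Prog κ

/-- The contents of the stacks. -/
abbrev Store (κ : Type) : Type := κ → List Sym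

/-- The number of symbols on all stacks. -/
def Store.size {κ : Type} [Fintype κ] (s : Store κ) : ℕ := ∑ k, (s k).length

variable {κ : Type} [DecidableEq κ]

/-- Move the top symbol of stack `j`, if there is one, to stack `k`. -/
def Store.move (s : Store κ) (j k : κ) : Store κ :=
  match s j with
  | [] => s
  | a :: l => update (update s j l) k (a :: update s j l k)

/-- Replace the top symbol of stack `k`, if there is one, by `a`. -/
def Store.setTop (s : Store κ) (k : κ) (a : Sym) : Store κ :=
  match s k with
  | [] => s
  | _ :: l => update s k (a :: l)

variable [Fintype κ]

/-- Big-step semantics: started with the stacks `s`, the program ends with the stacks `s'`, and no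
`push` makes the total number of symbols exceed `M`. -/
def Exec (M : ℕ) : Prog κ → Store κ → Store κ → Prop
  | .skip, s, s' => s' = s
  | .push k a, s, s' => s.size + 1 ≤ M ∧ s' = update s k (a :: s k)
  | .pop k, s, s' => s' = update s k (s k).tail
  | .move j k, s, s' => s' = s.move j k
  | .setTop k a, s, s' => s' = s.setTop k a
  | .seq p q, s, s' => ∃ t, Exec M p s t ∧ Exec M q t s'
  | .ite k c p q, s, s' =>
      (c (s k).head? = true ∧ Exec M p s s') ∨ (c (s k).head? = false ∧ Exec M q s s')
  | .loop k c p, s, s' =>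
      ReflTransGen (fun a b => c (a k).head? = true ∧ Exec M p a b) s s' ∧
        c (s' k).head? = false

theorem Store.size_update (s : Store κ) (k : κ) (l : List Sym) :
    Store.size (update s k l) + (s k).length = s.size + l.length := by
  unfold Store.size
  rw [← Finset.add_sum_erase _ _ (Finset.mem_univ k),
    ← Finset.add_sum_erase Finset.univ (fun k => (s k).length) (Finset.mem_univ k)]
  have : ∑ x ∈ Finset.univ.erase k, (update s k l x).length =
      ∑ x ∈ Finset.univ.erase k, (s x).length :=
    Finset.sum_congr rfl fun x hx => by rw [update_of_ne (Finset.ne_of_mem_erase hx)]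
  rw [this, update_self]
  ring

theorem Store.size_move (s : Store κ) (j k : κ) : (s.move j k).size = s.size := by
  unfold Store.move
  split
  · rfl
  · next a l h =>
    have h1 := Store.size_update s j l
    have h2 := Store.size_update (update s j l) k (a :: update s j l k)
    rw [h] at h1
    simp only [List.length_cons] at h1 h2
    omega

theorem Store.size_setTop (s : Store κ) (k : κ) (a : Sym) : (s.setTop k a).size = s.size := by
  unfold Store.setTop
  split
  · rfl
  · next b l h =>
    have h1 := Store.size_update s k (a :: l)
    rw [h] at h1
    simp only [List.length_cons] at h1
    omega

/-! ### Programs as Turing machines -/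

/-- The continuations that occur when `p` is run before `c`. -/
def labels : Prog κ → List (Prog κ) → Set (List (Prog κ))
  | .seq p q, c => insert (.seq p q :: c) (labels p (q :: c) ∪ labels q c)
  | .ite k d p q, c => insert (.ite k d p q :: c) (labels p c ∪ labels q c)
  | .loop k d p, c => insert (.loop k d p :: c) (labels p (.loop k d p :: c))
  | .skip, c => {.skip :: c}
  | .push k a, c => {.push k a :: c}
  | .pop k, c => {.pop k :: c}
  | .move j k, c => {.move j k :: c}
  | .setTop k a, c => {.setTop k a :: c}

-- The body of a loop is run before the same loop again, so unrolling creates no new continuations.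
-- This is why continuations can serve as the labels of a finite machine.
omit [DecidableEq κ] [Fintype κ] in
theorem labels_finite (p : Prog κ) (c : List (Prog κ)) : (labels p c).Finite := by
  induction p generalizing c with
  | seq p q hp hq => exact ((hp _).union (hq _)).insert _
  | ite k d p q hp hq => exact ((hp _).union (hq _)).insert _
  | loop k d p hp => exact (hp _).insert _
  | _ => exact Set.finite_singleton _

omit [DecidableEq κ] [Fintype κ] in
theorem cons_mem_labels (p : Prog κ) (c : List (Prog κ)) : p :: c ∈ labels p c := by
  cases p <;> simp [labels]

/-- The labels of the machine for `p`. -/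
def Label (p : Prog κ) : Type := {l : List (Prog κ) // l ∈ insert [] (labels p [])}

instance finite_label (p : Prog κ) : Finite (Label p) :=
  ((labels_finite p []).insert _).to_subtype

instance finite_sym : Finite Sym := by
  refine Finite.of_injective (β := Option Bool × Fin 9)
    (fun a => match a with
      | .bit b => (some b, 0) | .sep => (none, 0) | .tick => (none, 1) | .neg => (none, 2)
      | .conj => (none, 3) | .disj => (none, 4) | .varX => (none, 5) | .varX' => (none, 6)
      | .varY0 => (none, 7) | .varY1 => (none, 8)) ?_
  intro a b
  cases a <;> cases b <;> simp

open Classical in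
/-- The label for the continuation `l`. -/
noncomputable def target (p : Prog κ) (l : List (Prog κ)) : Label p :=
  -- The default `[]` is never reached in a run that starts with `[p]`.
  if h : l ∈ insert [] (labels p []) then ⟨l, h⟩ else ⟨[], Set.mem_insert _ _⟩

/-- The alphabets of the stacks of the machine: one more stack for the output. -/
abbrev Alph (κ : Type) : Option κ → Type
  | none => Bool
  | some _ => Sym

/-- The truth value of a symbol. -/
def symBool : Option Sym → Bool
  | some (.bit b) => b
  | _ => false

open Turing.TM2.Stmt in
/-- The statement of the machine for a continuation. -/
noncomputable def stmt (p : Prog κ) (res : κ) :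
    List (Prog κ) → Turing.TM2.Stmt (Alph κ) (Label p) (Option Sym)
  | [] => pop (some res) (fun _ a => a) (push none (fun v => symBool v)
      (load (fun _ => none) halt))
  | .skip :: c => goto fun _ => target p c
  | .push k a :: c => push (some k) (fun _ => a) (goto fun _ => target p c)
  | .pop k :: c => pop (some k) (fun v _ => v) (goto fun _ => target p c)
  -- The internal state holds a symbol only within one step and is reset to `none` before the jump.
  -- Hence `cfg` is determined by the continuation and the stacks.
  | .move j k :: c => pop (some j) (fun _ a => a) (branch (fun v => v.isSome)
      (push (some k) (fun v => v.getD .tick) (load (fun _ => none) (goto fun _ => target p c)))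
      (load (fun _ => none) (goto fun _ => target p c)))
  | .setTop k a :: c => pop (some k) (fun _ a => a) (branch (fun v => v.isSome)
      (push (some k) (fun _ => a) (load (fun _ => none) (goto fun _ => target p c)))
      (load (fun _ => none) (goto fun _ => target p c)))
  | .seq q r :: c => goto fun _ => target p (q :: r :: c)
  | .ite k d q r :: c => peek (some k) (fun _ a => a) (branch (fun v => d v)
      (load (fun _ => none) (goto fun _ => target p (q :: c)))
      (load (fun _ => none) (goto fun _ => target p (r :: c))))
  | .loop k d q :: c => peek (some k) (fun _ a => a) (branch (fun v => d v)
      (load (fun _ => none) (goto fun _ => target p (q :: .loop k d q :: c)))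
      (load (fun _ => none) (goto fun _ => target p c)))

/-- The stacks of the machine. -/
def allStacks (s : Store κ) (o : List Bool) : ∀ k, List (Alph κ k)
  | none => o
  | some k => s k

/-- The machine for `p`, with input stack `inp`. The truth value of the top of the stack `res`
is the output. -/
noncomputable def machine (p : Prog κ) (inp res : κ) : Turing.FinTM2 where
  K := Option κ
  k₀ := some inp
  k₁ := none
  Γ := Alph κ
  Λ := Label p
  main := target p [p]
  ΛFin := Fintype.ofFinite _
  σ := Option Sym
  initialState := none
  σFin := Fintype.ofFinite _
  Γk₀Fin := (Fintype.ofFinite Sym : Fintype Sym)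
  m l := stmt p res l.1

/-- The configuration of the machine before the continuation `c` is run. -/
noncomputable def cfg (p : Prog κ) (c : List (Prog κ)) (s : Store κ) :
    Turing.TM2.Cfg (Alph κ) (Label p) (Option Sym) :=
  ⟨some (target p c), none, allStacks s []⟩

omit [DecidableEq κ] [Fintype κ] in
@[simp] theorem allStacks_some (s : Store κ) (o : List Bool) (k : κ) :
    allStacks s o (some k) = s k := rfl

omit [DecidableEq κ] [Fintype κ] in
@[simp] theorem allStacks_none (s : Store κ) (o : List Bool) :
    allStacks s o none = o := rfl

omit [Fintype κ] in
@[simp] theorem update_stacks (s : Store κ) (o : List Bool) (k : κ) (l : List Sym) :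
    update (allStacks s o) (some k) l = allStacks (update s k l) o := by
  funext x
  cases x with
  | none => rfl
  | some x =>
    by_cases h : x = k
    · subst h; simp [allStacks]
    · simp [allStacks, h]

omit [Fintype κ] in
@[simp] theorem update_stacks_none (s : Store κ) (o o' : List Bool) :
    update (allStacks s o) none o' = allStacks s o' := by
  funext x
  cases x with
  | none => simp [allStacks]
  | some x => simp [allStacks]

omit [DecidableEq κ] [Fintype κ] in
theorem target_val {p : Prog κ} {l : List (Prog κ)} (h : l ∈ insert [] (labels p [])) :
    (target p l).1 = l := by
  simp [target, h]

/-- One step of the machine that respects the space bound. -/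
def BoundedStep (M : ℕ) (p : Prog κ) (res : κ)
    (a b : Turing.TM2.Cfg (Alph κ) (Label p) (Option Sym)) : Prop :=
  Turing.TM2.step (fun l : Label p => stmt p res l.1) a = some b ∧
    ∑ k, (b.stk k).length ≤ M

omit [DecidableEq κ] in
theorem sum_stacks (s : Store κ) (o : List Bool) :
    ∑ k, (allStacks s o k).length = o.length + s.size :=
  Fintype.sum_option _

omit [Fintype κ] in
theorem step_cfg {p : Prog κ} {res : κ} {c : List (Prog κ)} (s : Store κ)
    (h : c ∈ insert [] (labels p [])) :
    Turing.TM2.step (fun l : Label p => stmt p res l.1) (cfg p c s) =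
      some (Turing.TM2.stepAux (stmt p res c) none (allStacks s [])) := by
  simp only [cfg, Turing.TM2.step, target_val h]

theorem BoundedStep.of_eq {M : ℕ} {p : Prog κ} {res : κ} {c d : List (Prog κ)} {s s' : Store κ}
    (h : c ∈ insert [] (labels p []))
    (he : Turing.TM2.stepAux (stmt p res c) none (allStacks s []) = cfg p d s')
    (hs : s'.size ≤ M) : ReflTransGen (BoundedStep M p res) (cfg p c s) (cfg p d s') := by
  refine .single ⟨by rw [step_cfg s h, he], ?_⟩
  rw [cfg, sum_stacks]
  simpa using hs

/-- Every node of the program costs one machine step, after which the label is again a continuation;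
the inclusion `hq` ensures that all continuations met are labels. Only `push` makes the store
larger, so the test in `Exec` at each `push` bounds every configuration of the run. -/
theorem exec_reaches {M : ℕ} {p : Prog κ} {res : κ} (q : Prog κ) (c : List (Prog κ))
    (s s' : Store κ) (hq : labels q c ⊆ insert [] (labels p []))
    (hs : s.size ≤ M) (h : Exec M q s s') :
    ReflTransGen (BoundedStep M p res) (cfg p (q :: c) s) (cfg p c s') ∧ s'.size ≤ M := by
  induction q generalizing c s s' with
  | skip =>
    have hm := hq (cons_mem_labels _ _)
    cases h
    exact ⟨BoundedStep.of_eq hm (by simp [stmt, cfg, Turing.TM2.stepAux]) hs, hs⟩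
  | push k a =>
    have hm := hq (cons_mem_labels _ _)
    obtain ⟨h, rfl⟩ := h
    have hs' : Store.size (update s k (a :: s k)) ≤ M := by
      have := Store.size_update s k (a :: s k)
      simp only [List.length_cons] at this
      omega
    refine ⟨BoundedStep.of_eq hm ?_ hs', hs'⟩
    simp [stmt, cfg, Turing.TM2.stepAux]
  | pop k =>
    have hm := hq (cons_mem_labels _ _)
    cases h
    have hs' : Store.size (update s k (s k).tail) ≤ M := by
      have := Store.size_update s k (s k).tail
      simp only [List.length_tail] at this
      omega
    refine ⟨BoundedStep.of_eq hm ?_ hs', hs'⟩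
    simp [stmt, cfg, Turing.TM2.stepAux]
  | move j k =>
    have hm := hq (cons_mem_labels _ _)
    cases h
    have hs' : (s.move j k).size ≤ M := by rwa [Store.size_move]
    refine ⟨BoundedStep.of_eq hm ?_ hs', hs'⟩
    have e : allStacks s [] (some j) = s j := rfl
    simp only [stmt, cfg, Turing.TM2.stepAux, Store.move, e]
    cases hj : s j with
    | nil =>
      have : update s j [] = s := by rw [← hj, update_eq_self]
      simp [this]
    | cons a l => simp
  | setTop k a =>
    have hm := hq (cons_mem_labels _ _)
    cases h
    have hs' : (s.setTop k a).size ≤ M := by rwa [Store.size_setTop]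
    refine ⟨BoundedStep.of_eq hm ?_ hs', hs'⟩
    have e : allStacks s [] (some k) = s k := rfl
    simp only [stmt, cfg, Turing.TM2.stepAux, Store.setTop, e]
    cases hj : s k with
    | nil =>
      have : update s k [] = s := by rw [← hj, update_eq_self]
      simp [this]
    | cons b l => 
      simp
  | seq q r ihq ihr =>
    have hm := hq (cons_mem_labels _ _)
    obtain ⟨t, h1, h2⟩ := h
    have hq1 : labels q (r :: c) ⊆ insert [] (labels p []) :=
      fun x hx => hq (.inr (.inl hx))
    have hq2 : labels r c ⊆ insert [] (labels p []) := fun x hx => hq (.inr (.inr hx))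
    obtain ⟨h1, hs1⟩ := ihq _ _ _ hq1 hs h1
    obtain ⟨h2, hs2⟩ := ihr _ _ _ hq2 hs1 h2
    exact ⟨(BoundedStep.of_eq hm (by simp [stmt, cfg, Turing.TM2.stepAux]) hs).trans
      (h1.trans h2), hs2⟩
  | ite k d q r ihq ihr =>
    have hm := hq (cons_mem_labels _ _)
    have hq1 : labels q c ⊆ insert [] (labels p []) :=
      fun x hx => hq (.inr (.inl hx))
    have hq2 : labels r c ⊆ insert [] (labels p []) := fun x hx => hq (.inr (.inr hx))
    have e : allStacks s [] (some k) = s k := rfl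
    rcases h with ⟨hd, h⟩ | ⟨hd, h⟩
    · obtain ⟨h1, hs1⟩ := ihq _ _ _ hq1 hs h
      exact ⟨(BoundedStep.of_eq hm (by
        simp only [stmt, cfg, Turing.TM2.stepAux, e, hd, cond_true]) hs).trans h1, hs1⟩
    · obtain ⟨h1, hs1⟩ := ihr _ _ _ hq2 hs h
      exact ⟨(BoundedStep.of_eq hm (by
        simp only [stmt, cfg, Turing.TM2.stepAux, e, hd, cond_false]) hs).trans h1, hs1⟩
  | loop k d q ihq =>
    have hm := hq (cons_mem_labels _ _)
    have hq1 : labels q (.loop k d q :: c) ⊆ insert [] (labels p []) :=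
      fun x hx => hq (.inr hx)
    obtain ⟨h, hd⟩ := h
    have key : ReflTransGen (BoundedStep M p res) (cfg p (.loop k d q :: c) s)
        (cfg p (.loop k d q :: c) s') ∧ s'.size ≤ M := by
      clear hd
      induction h with
      | refl => exact ⟨.refl, hs⟩
      | @tail a b _ hab ih =>
        have e : allStacks a [] (some k) = a k := rfl
        obtain ⟨h1, hs1⟩ := ihq _ _ _ hq1 ih.2 hab.2
        refine ⟨ih.1.trans ((BoundedStep.of_eq hm ?_ ih.2).trans h1), hs1⟩
        simp only [stmt, cfg, Turing.TM2.stepAux, e, hab.1, cond_true]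
    have e : allStacks s' [] (some k) = s' k := rfl
    refine ⟨key.1.trans (BoundedStep.of_eq hm ?_ key.2), key.2⟩
    simp only [stmt, cfg, Turing.TM2.stepAux, e, hd, cond_false]

theorem evalsTo_of_reaches {σ : Type} {f : σ → Option σ} {a b : σ}
    (h : StateTransition.Reaches f a b) : Nonempty (StateTransition.EvalsTo f a (some b)) := by
  induction h with
  | refl => exact ⟨.refl _ _⟩
  | tail _ hbc ih =>
    obtain ⟨h1⟩ := ih
    exact ⟨h1.trans _ _ _ _ ⟨1, by simpa [flip] using hbc⟩⟩

/-- The machine is deterministic, so every configuration reachable from `a` lies on the bounded run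
that halts in `b`. -/
theorem length_le_of_reaches {M : ℕ} {p : Prog κ} {res : κ}
    {a b c : Turing.TM2.Cfg (Alph κ) (Label p) (Option Sym)}
    (hab : ReflTransGen (BoundedStep M p res) a b)
    (hb : Turing.TM2.step (fun l : Label p => stmt p res l.1) b = none)
    (ha : ∑ k, (a.stk k).length ≤ M)
    (hac : StateTransition.Reaches (Turing.TM2.step (fun l : Label p => stmt p res l.1)) a c) :
    ∑ k, (c.stk k).length ≤ M := by
  induction hab using ReflTransGen.head_induction_on with
  | refl =>
    rcases ReflTransGen.cases_head hac with rfl | ⟨d, hd, _⟩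
    · exact ha
    · rw [hb] at hd; cases hd
  | head h1 _ ih =>
    rcases ReflTransGen.cases_head hac with rfl | ⟨d, hd, hdc⟩
    · exact ha
    · rw [h1.1] at hd
      cases hd
      exact ih h1.2 hdc

/-- The input itself counts as used space, whence the hypothesis `hsp`. The program must empty all
stacks except `res`, because the final configuration of a machine has nothing but its output. -/
theorem mem_DSPACE_of_exec (p : Prog κ) (inp res : κ) (L : Language Sym) (sp : ℕ → ℕ)
    (hsp : ∀ n, n ≤ sp n)
    (h : ∀ w : List Sym, ∃ b : Bool, (b = true ↔ w ∈ L) ∧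
      Exec (sp w.length) p (update (fun _ => []) inp w) (update (fun _ => []) res [.bit b])) :
    L ∈ DSPACE sp := by
  have hinit : ∀ w : List Sym, Turing.initList (machine p inp res) w =
      cfg p [p] (update (fun _ => []) inp w) := by
    intro w
    simp only [Turing.initList, cfg, machine]
    congr 1
    funext k
    cases k with
    | none => rfl
    | some k =>
      by_cases hk : k = inp
      · subst hk; simp [allStacks]; rfl
      · simp [allStacks, hk]
  have hhalt : ∀ o : List Bool, Turing.haltList (machine p inp res) o =
      (⟨none, none, allStacks (fun _ => []) o⟩ :
        Turing.TM2.Cfg (Alph κ) (Label p) (Option Sym)) := by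
    intro w
    simp only [Turing.haltList, machine]
    congr 1
    funext k
    cases k with
    | none => rfl
    | some k => rfl
  have key : ∀ w : List Sym, ∃ b : Bool, (b = true ↔ w ∈ L) ∧
      ReflTransGen (BoundedStep (sp w.length) p res) (cfg p [p] (update (fun _ => []) inp w))
        ⟨none, none, allStacks (fun _ => []) [b]⟩ := by
    intro w
    obtain ⟨b, hb, hw⟩ := h w
    refine ⟨b, hb, ?_⟩
    have hs : Store.size (update (fun _ => []) inp w : Store κ) ≤ sp w.length := by
      have := Store.size_update (fun _ => [] : Store κ) inp w
      have h0 : Store.size (fun _ => [] : Store κ) = 0 := by simp [Store.size]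
      have := hsp w.length
      simp_all
    obtain ⟨h1, h2⟩ := exec_reaches (p := p) (res := res) p [] _ _ (Set.subset_insert _ _) hs hw
    refine h1.tail ⟨?_, ?_⟩
    · rw [step_cfg _ (Set.mem_insert _ _)]
      have e : allStacks (update (fun _ => []) res [Sym.bit b]) [] (some res) = [Sym.bit b] := by
        simp [allStacks]
      simp only [stmt, Turing.TM2.stepAux, e, List.tail_cons, update_stacks, update_idem,
        List.head?_cons]
      congr 2
      have : update (fun _ => []) res [] = (fun _ => [] : Store κ) := by
        simp
      rw [this]
      exact update_stacks_none _ _ _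
    · have e := Store.size_update (fun _ => [] : Store κ) res [Sym.bit b]
      have h0 : Store.size (fun _ => [] : Store κ) = 0 := by simp [Store.size]
      rw [sum_stacks]
      simp only [List.length_cons, List.length_nil] at e ⊢
      omega
  have hmap : ∀ w : List Sym, w.map (Equiv.refl Sym).symm = w := by simp
  have hacc : ∀ (w : List Sym) (b : Bool), ReflTransGen (BoundedStep (sp w.length) p res)
      (cfg p [p] (update (fun _ => []) inp w)) ⟨none, none, allStacks (fun _ => []) [b]⟩ →
      Nonempty (Turing.TM2Outputs (machine p inp res) (w.map (Equiv.refl Sym).symm)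
        (some [(Equiv.refl Bool).symm b])) := by
    intro w b hr
    have hr' : StateTransition.Reaches (Turing.TM2.step (fun l : Label p => stmt p res l.1))
        (cfg p [p] (update (fun _ => []) inp w)) ⟨none, none, allStacks (fun _ => []) [b]⟩ :=
      hr.lift id fun _ _ h => h.1
    exact evalsTo_of_reaches ((congrArg₂ (StateTransition.Reaches (machine p inp res).step)
      ((congrArg _ (hmap w)).trans (hinit w)) (hhalt [b])).mpr hr')
  refine ⟨machine p inp res, Equiv.refl Sym, Equiv.refl Bool, ?_, ?_, ?_, ?_⟩
  · intro k
    cases k with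
    | none => exact inferInstanceAs (Finite Bool)
    | some k => exact finite_sym
  · intro w hw
    obtain ⟨b, hb, hr⟩ := key w
    rw [hb.2 hw] at hr
    exact hacc w true hr
  · intro w hw
    obtain ⟨b, hb, hr⟩ := key w
    have : b = false := by
      rw [Bool.eq_false_iff]
      exact fun h => hw (hb.1 h)
    rw [this] at hr
    exact hacc w false hr
  · intro w c hc
    obtain ⟨b, hb, hr⟩ := key w
    refine length_le_of_reaches hr rfl ?_ ((congrArg₂ (StateTransition.Reaches
      (machine p inp res).step) ((congrArg _ (hmap w)).trans (hinit w)) (Eq.refl c)).mp hc)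
    rw [cfg, sum_stacks]
    have e := Store.size_update (fun _ => [] : Store κ) inp w
    have h0 : Store.size (fun _ => [] : Store κ) = 0 := by simp [Store.size]
    have := hsp w.length
    simp_all

end StackProgram

/-! ### First-order formulas over an initial segment of the natural numbers -/

namespace StackProgram

open TeamFormula SpaceComplexity Relation Function

/-- The structures in which formulas are evaluated: the numbers below `B` and two words. -/
structure Model where
  B : ℕ
  pos : 0 < B
  word : Bool → List Sym

/-- The stream that starts with `x`. -/
def consEnv (x : ℕ) (env : ℕ → ℕ) : ℕ → ℕ
  | 0 => x
  | n + 1 => env n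

/-- First-order formulas with de Bruijn indices. -/
inductive Fm : Type
  | add (i j k : ℕ) : Fm
  | bit (i j : ℕ) : Fm
  | look (a : Bool) (c : Option Sym → Bool) (i : ℕ) : Fm
  | neg (φ : Fm) : Fm
  | conj (φ ψ : Fm) : Fm
  | ex (φ : Fm) : Fm

/-- Truth of a formula; quantifiers range over the numbers below `M.B`. -/
def Fm.Sat (M : Model) : Fm → (ℕ → ℕ) → Prop
  | .add i j k, env => env i + env j = env k
  | .bit i j, env => (env i).testBit (env j) = true
  | .look a c i, env => c (M.word a)[env i]? = true
  | .neg φ, env => ¬ φ.Sat M env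
  | .conj φ ψ, env => φ.Sat M env ∧ ψ.Sat M env
  | .ex φ, env => ∃ x < M.B, φ.Sat M (consEnv x env)

/-- The quantifier depth. -/
def Fm.depth : Fm → ℕ
  | .neg φ => φ.depth
  | .conj φ ψ => max φ.depth ψ.depth
  | .ex φ => φ.depth + 1
  | _ => 0

/-! ### Evaluating formulas by programs -/

/-- The stacks used for formulas of quantifier depth at most `m + 1`: the two words, each with
a stack for the part already read; the truth value of a formula; a flag; three accumulators, two of
them with a supply of symbols; an auxiliary stack; and, for each variable, its value in unary
and a supply of symbols. -/
inductive Reg (m : ℕ) : Type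
  | word (a : Bool) | read (a : Bool)
  | res | go | a1 | b1 | a2 | b2 | a3 | aux
  | x (i : Fin (m + 1)) | y (i : Fin (m + 1))
  deriving DecidableEq, Fintype

section Generic

variable {κ : Type} [DecidableEq κ] [Fintype κ] {M : ℕ}

/-- A number in unary. -/
def tick (n : ℕ) : List Sym := List.replicate n .tick

@[simp] theorem tick_zero : tick 0 = [] := rfl

theorem tick_succ (n : ℕ) : tick (n + 1) = .tick :: tick n := rfl

@[simp] theorem head?_tick_succ (n : ℕ) : (tick (n + 1)).head? = some .tick := rfl

@[simp] theorem reverse_tick (n : ℕ) : (tick n).reverse = tick n := List.reverse_replicate ..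

@[simp] theorem tick_append (m n : ℕ) : tick m ++ tick n = tick (m + n) :=
  List.replicate_append_replicate

@[simp] theorem length_tick (n : ℕ) : (tick n).length = n := List.length_replicate

@[simp] theorem isSome_head?_tick (n : ℕ) : (tick n).head?.isSome = decide (n ≠ 0) := by
  cases n <;> simp

theorem Exec.seq {p q : Prog κ} {s t s' : Store κ} (h1 : Exec M p s t) (h2 : Exec M q t s') :
    Exec M (.seq p q) s s' := ⟨t, h1, h2⟩

theorem Exec.loop_nil {k : κ} {c : Option Sym → Bool} {p : Prog κ} {s : Store κ}
    (h : c (s k).head? = false) : Exec M (.loop k c p) s s := ⟨.refl, h⟩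

theorem Exec.loop_cons {k : κ} {c : Option Sym → Bool} {p : Prog κ} {s t s' : Store κ}
    (h : c (s k).head? = true) (hp : Exec M p s t) (ht : Exec M (.loop k c p) t s') :
    Exec M (.loop k c p) s s' := ⟨.head ⟨h, hp⟩ ht.1, ht.2⟩

theorem Exec.ite_true {k : κ} {c : Option Sym → Bool} {p q : Prog κ} {s s' : Store κ}
    (h : c (s k).head? = true) (hp : Exec M p s s') : Exec M (.ite k c p q) s s' := .inl ⟨h, hp⟩

theorem Exec.ite_false {k : κ} {c : Option Sym → Bool} {p q : Prog κ} {s s' : Store κ}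
    (h : c (s k).head? = false) (hq : Exec M q s s') : Exec M (.ite k c p q) s s' := .inr ⟨h, hq⟩

theorem Exec.of_eq {p : Prog κ} {s s' t : Store κ} (h : Exec M p s t) (e : s' = t) :
    Exec M p s s' := e ▸ h

theorem Exec.move_cons {j k : κ} {s : Store κ} {a : Sym} {l : List Sym} (hjk : j ≠ k)
    (h : s j = a :: l) : Exec M (.move j k) s (update (update s j l) k (a :: s k)) := by
  change _ = _
  simp [Store.move, h, update_of_ne hjk.symm]

theorem Exec.move_tick {j k : κ} {s : Store κ} {n r : ℕ} (hjk : j ≠ k)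
    (h : s j = tick (n + 1)) (hk : s k = tick r) :
    Exec M (.move j k) s (update (update s j (tick n)) k (tick (r + 1))) := by
  have := Exec.move_cons (M := M) hjk (h.trans (tick_succ n))
  rwa [hk] at this

theorem Exec.setTop_one {k : κ} {s : Store κ} {r : Sym} (a : Sym) (h : s k = [r]) :
    Exec M (.setTop k a) s (update s k [a]) := by
  change _ = _
  simp [Store.setTop, h]

/-- Move everything from stack `j` to stack `k`. -/
def drain (j k : κ) : Prog κ := .loop j Option.isSome (.move j k)

theorem exec_drain {j k : κ} (hjk : j ≠ k) (s : Store κ) :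
    Exec M (drain j k) s (update (update s j []) k ((s j).reverse ++ s k)) := by
  generalize hl : s j = l
  induction l generalizing s with
  | nil =>
    refine (Exec.loop_nil (by simp [hl])).of_eq ?_
    funext x
    simp only [update_apply]
    split_ifs <;> simp_all
  | cons a l ih =>
    refine Exec.loop_cons (by simp [hl]) (.move_cons hjk hl) ((ih _ ?_).of_eq ?_)
    · simp [update_of_ne hjk]
    · funext x
      simp only [update_apply]
      split_ifs <;> simp_all

theorem exec_drain_tick {j k : κ} (hjk : j ≠ k) {s : Store κ} {n r : ℕ} (hj : s j = tick n)
    (hk : s k = tick r) :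
    Exec M (drain j k) s (update (update s j []) k (tick (r + n))) := by
  have := exec_drain (M := M) hjk s
  rwa [hj, hk, reverse_tick, tick_append, Nat.add_comm] at this

/-- Add the number on stack `j` to the one on stack `k`, with symbols taken from stack `l`. -/
def copy (aux j k l : κ) : Prog κ :=
  .seq (.loop j Option.isSome (.seq (.move j aux) (.move l k))) (drain aux j)

/-- A copy without a `push`: the `n` symbols of `j` travel to `aux` and back, and each of them makes
one symbol pass from the supply `l` to `k`. The total size never changes. -/
theorem exec_copy {aux j k l : κ} (h1 : aux ≠ j) (h2 : aux ≠ k) (h3 : aux ≠ l) (h4 : j ≠ k)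
    (h5 : j ≠ l) (h6 : k ≠ l) {s : Store κ} {n q r : ℕ} (ha : s aux = []) (hj : s j = tick n)
    (hk : s k = tick q) (hl : s l = tick (r + n)) :
    Exec M (copy aux j k l) s (update (update s k (tick (q + n))) l (tick r)) := by
  have key : ∀ (n q u : ℕ) (s : Store κ), s aux = tick u → s j = tick n → s k = tick q →
      s l = tick (r + n) →
      Exec M (.loop j Option.isSome (.seq (.move j aux) (.move l k))) s
        (update (update (update (update s j []) aux (tick (u + n))) k (tick (q + n))) l
          (tick r)) := by
    intro n
    induction n with
    | zero =>
      intro q u s ha hj hk hl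
      refine (Exec.loop_nil (by simp [hj])).of_eq ?_
      funext x
      simp only [update_apply]
      split_ifs <;> simp_all
    | succ n ih =>
      intro q u s ha hj hk hl
      refine Exec.loop_cons (by simp [hj]) (Exec.seq (.move_tick h1.symm hj ha)
        (.move_tick (n := r + n) (r := q) h6.symm ?_ ?_))
        ((ih (q + 1) (u + 1) _ ?_ ?_ ?_ ?_).of_eq ?_)
      · simp [update_apply, h1, h1.symm, h2, h2.symm, h3, h3.symm, h4, h4.symm, h5, h5.symm, hl,
          Nat.add_assoc]
      · simp [update_apply, h2.symm, h4.symm, hk]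
      · simp [update_apply, h2, h3]
      · simp [update_apply, h4, h5, h1.symm]
      · simp [update_apply]
      · simp [update_apply, h6.symm]
      · funext x
        simp only [update_apply]
        split_ifs <;> simp_all [Nat.add_assoc, Nat.add_comm 1 n]
  refine Exec.seq (key n q 0 s ha hj hk hl) ((exec_drain_tick h1 (n := 0 + n) (r := 0) ?_ ?_).of_eq
    ?_)
  · simp [update_apply, h2, h3]
  · simp [update_apply, h4, h5, h1.symm]
  · funext x
    simp only [update_apply]
    split_ifs <;> simp_all

end Generic

end StackProgram

/-! ### Programs for atomic formulas -/

namespace StackProgram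

open TeamFormula SpaceComplexity Relation Function

section Atoms

variable {m M : ℕ}

/-- Is the symbol the truth value `true`? -/
def isTrue : Option Sym → Bool := symBool

/-- Compare the accumulators `a1` and `a2`, and empty them. -/
def eqProg (m : ℕ) : Prog (Reg m) :=
  .seq (.setTop .res (.bit true)) (.seq
    (.loop .a1 Option.isSome (.seq (.move .a1 .b1)
      (.ite .a2 Option.isSome (.move .a2 .b2) (.setTop .res (.bit false)))))
    (.seq (.ite .a2 Option.isSome (.setTop .res (.bit false)) .skip) (drain .a2 .b2)))

/-- Both accumulators are run down in parallel. They differ if `a2` is exhausted too early or if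
something of it is left at the end; all symbols return to the supplies `b1` and `b2`. -/
theorem exec_eqProg {s : Store (Reg m)} {a b c d : ℕ} {r : Sym} (ha : s .a1 = tick a)
    (hc : s .b1 = tick c) (hb : s .a2 = tick b) (hd : s .b2 = tick d) (hr : s .res = [r]) :
    Exec M (eqProg m) s (update (update (update (update (update s .a1 []) .b1 (tick (c + a)))
      .a2 []) .b2 (tick (d + b))) .res [.bit (decide (a = b))]) := by
  have key : ∀ (a b c d : ℕ) (r : Sym) (s : Store (Reg m)), s .a1 = tick a → s .b1 = tick c →
      s .a2 = tick b → s .b2 = tick d → s .res = [r] →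
      Exec M (.loop .a1 Option.isSome (.seq (.move .a1 .b1)
        (.ite .a2 Option.isSome (.move .a2 .b2) (.setTop .res (.bit false))))) s
        (update (update (update (update (update s .a1 []) .b1 (tick (c + a))) .a2 (tick (b - a)))
          .b2 (tick (d + min a b))) .res [if a ≤ b then r else .bit false]) := by
    intro a
    induction a with
    | zero =>
      intro b c d r s ha hc hb hd hr
      refine (Exec.loop_nil (by simp [ha])).of_eq ?_
      funext x
      simp only [update_apply]
      split_ifs <;> simp_all
    | succ a ih =>
      intro b c d r s ha hc hb hd hr
      cases b with
      | zero =>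
        refine Exec.loop_cons (by simp [ha]) (Exec.seq (.move_tick (by simp) ha hc)
          (.ite_false (by simp [hb]) (.setTop_one (r := r) _ (by simp [hr]))))
          ((ih 0 (c + 1) d (.bit false) _ ?_ ?_ ?_ ?_ ?_).of_eq ?_)
        any_goals simp [hb, hd]
        funext x
        simp only [update_apply]
        split_ifs <;> simp_all [Nat.add_assoc, Nat.add_comm 1 a]
      | succ b =>
        refine Exec.loop_cons (by simp [ha]) (Exec.seq (.move_tick (by simp) ha hc)
          (.ite_true (by simp [hb]) (.move_tick (n := b) (r := d) (by simp) (by simp [hb])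
            (by simp [hd]))))
          ((ih b (c + 1) (d + 1) r _ ?_ ?_ ?_ ?_ ?_).of_eq ?_)
        any_goals simp [hr]
        funext x
        simp only [update_apply]
        split_ifs <;> simp_all [Nat.add_assoc, Nat.add_comm 1 a, Nat.add_comm 1]
  refine Exec.seq (.setTop_one _ hr) (Exec.seq (key a b c d (.bit true) _ ?_ ?_ ?_ ?_ ?_) ?_)
  any_goals simp [ha, hb, hc, hd]
  by_cases h : b ≤ a
  · refine Exec.seq (.ite_false (by simp [h]) rfl)
      ((exec_drain_tick (n := b - a) (r := d + min a b) ?_ ?_ ?_).of_eq ?_)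
    any_goals simp
    funext x
    have e : (a ≤ b) ↔ a = b := by omega
    have e2 : d + b = d + min a b + (b - a) := by omega
    simp only [update_apply, e2]
    split_ifs <;> simp_all
  · refine Exec.seq (.ite_true (by simp; omega) (.setTop_one _ (by simp; rfl)))
      ((exec_drain_tick (n := b - a) (r := d + min a b) ?_ ?_ ?_).of_eq ?_)
    any_goals simp
    funext x
    have e : a ≠ b := by omega
    have e2 : d + b = d + min a b + (b - a) := by omega
    simp only [update_apply, e2]
    split_ifs <;> simp_all

/-- Halve the accumulator `a1`. -/
def halve (m : ℕ) : Prog (Reg m) :=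
  .seq (.loop .a1 Option.isSome (.seq (.move .a1 .b1) (.move .a1 .a3))) (drain .a3 .a1)

theorem Exec.move_nil {κ : Type} [DecidableEq κ] [Fintype κ] {j k : κ} {s : Store κ}
    (h : s j = []) : Exec M (.move j k) s s := by
  change _ = _
  simp [Store.move, h]

/-- Symbols leave `a1` in pairs, one for the supply and one to be kept. An unpaired last symbol goes
to the supply, since a move from an empty stack has no effect; so the half is rounded down. -/
theorem exec_halve {s : Store (Reg m)} {a c : ℕ} (ha : s .a1 = tick a)
    (hc : s .b1 = tick c) (h3 : s .a3 = []) :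
    Exec M (halve m) s (update (update s .a1 (tick (a / 2))) .b1 (tick (c + (a - a / 2)))) := by
  have key : ∀ (u a b c : ℕ) (s : Store (Reg m)), u = a / 2 → s .a1 = tick a → s .b1 = tick c →
      s .a3 = tick b →
      Exec M (.loop .a1 Option.isSome (.seq (.move .a1 .b1) (.move .a1 .a3))) s
        (update (update (update s .a1 []) .b1 (tick (c + (a - a / 2)))) .a3 (tick (b + u))) := by
    intro u
    induction u with
    | zero =>
      intro a b c s hu ha hc hb
      have : a = 0 ∨ a = 1 := by omega
      rcases this with rfl | rfl
      · refine (Exec.loop_nil (by simp [ha])).of_eq ?_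
        funext x
        simp only [update_apply]
        split_ifs <;> simp_all
      · refine Exec.loop_cons (by simp [ha]) (Exec.seq (.move_tick (n := 0) (by simp) ha hc)
          (.move_nil (by simp))) ((Exec.loop_nil (by simp)).of_eq ?_)
        funext x
        simp only [update_apply]
        split_ifs <;> simp_all
    | succ u ih =>
      intro a b c s hu ha hc hb
      obtain ⟨a, rfl⟩ : ∃ a', a = a' + 1 + 1 := ⟨a - 2, by omega⟩
      refine Exec.loop_cons (by simp [ha]) (Exec.seq (.move_tick (by simp) ha hc)
        (.move_tick (n := a) (r := b) (by simp) (by simp) (by simp [hb])))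
        ((ih a (b + 1) (c + 1) _ (by omega) ?_ ?_ ?_).of_eq ?_)
      any_goals simp
      funext x
      have e : c + (a + 1 + 1 - (a + 1 + 1) / 2) = c + 1 + (a - a / 2) := by omega
      have e2 : b + (u + 1) = b + 1 + u := by omega
      simp only [update_apply, e, e2]
      split_ifs <;> simp_all
  refine Exec.seq (key (a / 2) a 0 c s rfl ha hc h3)
    ((exec_drain_tick (n := 0 + a / 2) (r := 0) ?_ ?_ ?_).of_eq ?_)
  any_goals simp
  funext x
  simp only [update_apply]
  split_ifs <;> simp_all

/-- Test the bit of `a1` given by `a2`, and empty the accumulators. -/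
def bitProg (m : ℕ) : Prog (Reg m) :=
  .seq (.loop .a2 Option.isSome (.seq (.move .a2 .b2) (halve m))) (.seq
    (.setTop .res (.bit false))
    (.loop .a1 Option.isSome (.seq (.move .a1 .b1)
      (.ite .res isTrue (.setTop .res (.bit false)) (.setTop .res (.bit true))))))

/-- The bit in question is the parity of `a / 2 ^ b`: `a1` is halved `b` times, and then `res` is
flipped once for every remaining symbol. -/
theorem exec_bitProg {s : Store (Reg m)} {a b c d : ℕ} {r : Sym} (ha : s .a1 = tick a)
    (hc : s .b1 = tick c) (hb : s .a2 = tick b) (hd : s .b2 = tick d) (h3 : s .a3 = [])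
    (hr : s .res = [r]) :
    Exec M (bitProg m) s (update (update (update (update (update s .a1 []) .b1 (tick (c + a)))
      .a2 []) .b2 (tick (d + b))) .res [.bit (a.testBit b)]) := by
  have key1 : ∀ (b a c d : ℕ) (s : Store (Reg m)), s .a1 = tick a → s .b1 = tick c →
      s .a2 = tick b → s .b2 = tick d → s .a3 = [] →
      Exec M (.loop .a2 Option.isSome (.seq (.move .a2 .b2) (halve m))) s
        (update (update (update (update s .a1 (tick (a / 2 ^ b))) .b1 (tick (c + (a - a / 2 ^ b))))
          .a2 []) .b2 (tick (d + b))) := by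
    intro b
    induction b with
    | zero =>
      intro a c d s ha hc hb hd h3
      refine (Exec.loop_nil (by simp [hb])).of_eq ?_
      funext x
      simp only [update_apply]
      split_ifs <;> simp_all
    | succ b ih =>
      intro a c d s ha hc hb hd h3
      refine Exec.loop_cons (by simp [hb]) (Exec.seq (.move_tick (by simp) hb hd)
        (exec_halve (a := a) (c := c) (by simp [ha]) (by simp [hc]) (by simp [h3])))
        ((ih (a / 2) (c + (a - a / 2)) (d + 1) _ ?_ ?_ ?_ ?_ ?_).of_eq ?_)
      any_goals simp [h3]
      funext x
      have e : a / 2 ^ (b + 1) = a / 2 / 2 ^ b := by rw [Nat.div_div_eq_div_mul, pow_succ']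
      have e1 : a / 2 / 2 ^ b ≤ a / 2 := Nat.div_le_self _ _
      have e2 : c + (a - a / 2 / 2 ^ b) = c + (a - a / 2) + (a / 2 - a / 2 / 2 ^ b) := by omega
      have e3 : d + (b + 1) = d + 1 + b := by omega
      simp only [update_apply, e, e2, e3]
      split_ifs <;> simp_all
  have key2 : ∀ (a c : ℕ) (v : Bool) (s : Store (Reg m)), s .a1 = tick a → s .b1 = tick c →
      s .res = [.bit v] →
      Exec M (.loop .a1 Option.isSome (.seq (.move .a1 .b1)
        (.ite .res isTrue (.setTop .res (.bit false)) (.setTop .res (.bit true))))) s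
        (update (update (update s .a1 []) .b1 (tick (c + a))) .res
          [.bit (v ^^ decide (a % 2 = 1))]) := by
    intro a
    induction a with
    | zero =>
      intro c v s ha hc hr
      refine (Exec.loop_nil (by simp [ha])).of_eq ?_
      funext x
      simp only [update_apply]
      split_ifs <;> simp_all
    | succ a ih =>
      intro c v s ha hc hr
      have e : decide ((a + 1) % 2 = 1) = !decide (a % 2 = 1) := by
        rcases Nat.mod_two_eq_zero_or_one a with h | h <;> simp [Nat.add_mod, h]
      cases v with
      | true =>
        refine Exec.loop_cons (by simp [ha]) (Exec.seq (.move_tick (by simp) ha hc)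
          (.ite_true (by simp [hr, isTrue, symBool]) (.setTop_one _ (by simp; exact hr))))
          ((ih (c + 1) false _ ?_ ?_ ?_).of_eq ?_)
        any_goals simp
        funext x
        simp only [update_apply, e]
        split_ifs <;> simp_all [Nat.add_assoc, Nat.add_comm 1 a]
      | false =>
        refine Exec.loop_cons (by simp [ha]) (Exec.seq (.move_tick (by simp) ha hc)
          (.ite_false (by simp [hr, isTrue, symBool]) (.setTop_one _ (by simp; exact hr))))
          ((ih (c + 1) true _ ?_ ?_ ?_).of_eq ?_)
        any_goals simp
        funext x
        simp only [update_apply, e]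
        split_ifs <;> simp_all [Nat.add_assoc, Nat.add_comm 1 a]
  refine Exec.seq (key1 b a c d s ha hc hb hd h3) (Exec.seq (.setTop_one (r := r) _ (by simp [hr]))
    ((key2 (a / 2 ^ b) (c + (a - a / 2 ^ b)) false _ ?_ ?_ ?_).of_eq ?_))
  any_goals simp
  funext x
  have e1 : a / 2 ^ b ≤ a := Nat.div_le_self _ _
  have e : c + a = c + (a - a / 2 ^ b) + a / 2 ^ b := by omega
  simp only [update_apply, Nat.testBit_eq_decide_div_mod_eq, e]
  split_ifs <;> simp_all

/-- Test the symbol of a word at the position given by `a2`, and empty the accumulator. -/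
def lookProg (m : ℕ) (a : Bool) (c : Option Sym → Bool) : Prog (Reg m) :=
  .seq (.loop .a2 Option.isSome (.seq (.move .a2 .b2) (.move (.word a) (.read a)))) (.seq
    (.ite (.word a) c (.setTop .res (.bit true)) (.setTop .res (.bit false)))
    (drain (.read a) (.word a)))

/-- Beyond the end of the word the moves have no effect and the top is `none`, in agreement with
`l[b]?`. Afterwards the part already read is put back. -/
theorem exec_lookProg {s : Store (Reg m)} {b d : ℕ} {r : Sym} (a : Bool) (c : Option Sym → Bool)
    {l : List Sym} (hw : s (.word a) = l) (hw' : s (.read a) = []) (hb : s .a2 = tick b)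
    (hd : s .b2 = tick d) (hr : s .res = [r]) :
    Exec M (lookProg m a c) s (update (update (update s .a2 []) .b2 (tick (d + b))) .res
      [.bit (c l[b]?)]) := by
  have key : ∀ (b d : ℕ) (l u : List Sym) (s : Store (Reg m)), s (.word a) = l →
      s (.read a) = u → s .a2 = tick b → s .b2 = tick d →
      Exec M (.loop .a2 Option.isSome (.seq (.move .a2 .b2) (.move (.word a) (.read a)))) s
        (update (update (update (update s (.word a) (l.drop b)) (.read a) ((l.take b).reverse ++ u))
          .a2 []) .b2 (tick (d + b))) := by
    intro b
    induction b with
    | zero =>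
      intro d l u s hl hu hb hd
      refine (Exec.loop_nil (by simp [hb])).of_eq ?_
      funext x
      simp only [update_apply]
      split_ifs <;> simp_all
    | succ b ih =>
      intro d l u s hl hu hb hd
      cases l with
      | nil =>
        refine Exec.loop_cons (by simp [hb]) (Exec.seq (.move_tick (by simp) hb hd)
          (.move_nil (by simp [hl]))) ((ih (d + 1) [] u _ ?_ ?_ ?_ ?_).of_eq ?_)
        any_goals simp [hl, hu]
        funext x
        simp only [update_apply]
        split_ifs <;> simp_all [Nat.add_assoc, Nat.add_comm 1 b]
      | cons v l =>
        refine Exec.loop_cons (by simp [hb]) (Exec.seq (.move_tick (by simp) hb hd)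
          (.move_cons (a := v) (l := l) (by simp) (by simp [hl])))
          ((ih (d + 1) l (v :: u) _ ?_ ?_ ?_ ?_).of_eq ?_)
        any_goals simp [hl, hu]
        funext x
        simp only [update_apply]
        split_ifs <;> simp_all [Nat.add_assoc, Nat.add_comm 1 b]
  refine Exec.seq (key b d l [] s hw hw' hb hd) ?_
  have e : c (l.drop b).head? = c l[b]? := by rw [List.head?_drop]
  cases hv : c l[b]? with
  | true =>
    refine Exec.seq (.ite_true (by simp [hv]) (.setTop_one (r := r) _ (by simp [hr])))
      ((exec_drain (by simp) _).of_eq ?_)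
    funext x
    simp only [update_apply]
    split_ifs <;> simp_all
  | false =>
    refine Exec.seq (.ite_false (by simp [hv]) (.setTop_one (r := r) _ (by simp [hr])))
      ((exec_drain (by simp) _).of_eq ?_)
    funext x
    simp only [update_apply]
    split_ifs <;> simp_all

end Atoms

end StackProgram

/-! ### Evaluation of first-order formulas by programs -/

namespace StackProgram

open TeamFormula SpaceComplexity Relation Function

section Evaluation

variable {m M : ℕ}

/-- The stack for the value of the variable bound at depth `l`. -/
def xReg (m l : ℕ) : Reg m := .x (Fin.ofNat (m + 1) l)

/-- The supply for the variable bound at depth `l`. -/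
def yReg (m l : ℕ) : Reg m := .y (Fin.ofNat (m + 1) l)

theorem xReg_inj {l l' : ℕ} (h : l ≤ m) (h' : l' ≤ m) : xReg m l = xReg m l' ↔ l = l' := by
  simp [xReg, Fin.ext_iff, Nat.mod_eq_of_lt (Nat.lt_succ_of_le h),
    Nat.mod_eq_of_lt (Nat.lt_succ_of_le h')]

theorem yReg_inj {l l' : ℕ} (h : l ≤ m) (h' : l' ≤ m) : yReg m l = yReg m l' ↔ l = l' := by
  simp [yReg, Fin.ext_iff, Nat.mod_eq_of_lt (Nat.lt_succ_of_le h),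
    Nat.mod_eq_of_lt (Nat.lt_succ_of_le h')]

/-- Add the variable with index `i` to the number on stack `k`. -/
def copyVar (m d i : ℕ) (k l : Reg m) : Prog (Reg m) :=
  -- Index `i` at depth `d` refers to the variable bound at depth `d - 1 - i`. Free variables have
  -- the value 0, so nothing is added for them.
  if i < d then copy .aux (xReg m (d - 1 - i)) k l else .skip

/-- The program that evaluates a formula at quantifier depth `d`. -/
def evalProg (m : ℕ) : ℕ → Fm → Prog (Reg m)
  | d, .add i j k => .seq (copyVar m d i .a1 .b1) (.seq (copyVar m d j .a1 .b1)
      (.seq (copyVar m d k .a2 .b2) (eqProg m)))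
  | d, .bit i j => .seq (copyVar m d i .a1 .b1) (.seq (copyVar m d j .a2 .b2) (bitProg m))
  | d, .look a c i => .seq (copyVar m d i .a2 .b2) (lookProg m a c)
  | d, .neg φ => .seq (evalProg m d φ)
      (.ite .res isTrue (.setTop .res (.bit false)) (.setTop .res (.bit true)))
  | d, .conj φ ψ => .seq (evalProg m d φ) (.ite .res isTrue (evalProg m d ψ) .skip)
  | d, .ex φ => .seq (.setTop .res (.bit false)) (.seq
      (.loop (yReg m d) Option.isSome (.seq (evalProg m (d + 1) φ)
        -- A witness exhausts the supply at once, which ends the loop while `res` is still true.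
        (.ite .res isTrue (drain (yReg m d) (xReg m d)) (.move (yReg m d) (xReg m d)))))
      (drain (xReg m d) (yReg m d)))

/-- The stacks are prepared for the evaluation of formulas at quantifier depth `d`. -/
structure Ready (A : Model) (d : ℕ) (env : ℕ → ℕ) (s : Store (Reg m)) : Prop where
  word : ∀ a, s (.word a) = A.word a
  read : ∀ a, s (.read a) = []
  res : ∃ b, s .res = [.bit b]
  a1 : s .a1 = []
  -- Twice the size of the domain, because `a1` has to hold the sum of two values.
  b1 : s .b1 = tick (2 * A.B)
  a2 : s .a2 = []
  b2 : s .b2 = tick (2 * A.B)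
  a3 : s .a3 = []
  aux : s .aux = []
  env_le : ∀ i, env i ≤ A.B
  var : ∀ i < d, s (xReg m (d - 1 - i)) = tick (env i)
  env_zero : ∀ i, d ≤ i → env i = 0
  free : ∀ l, d ≤ l → l ≤ m → s (xReg m l) = [] ∧ s (yReg m l) = tick A.B

theorem Ready.update_res {A : Model} {d : ℕ} {env : ℕ → ℕ} {s : Store (Reg m)}
    (h : Ready A d env s) (b : Bool) : Ready A d env (update s .res [.bit b]) where
  word a := by simp [h.word]
  read a := by simp [h.read]
  res := ⟨b, by simp⟩
  a1 := by simp [h.a1]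
  b1 := by simp [h.b1]
  a2 := by simp [h.a2]
  b2 := by simp [h.b2]
  a3 := by simp [h.a3]
  aux := by simp [h.aux]
  env_le := h.env_le
  var i hi := by simpa [xReg] using h.var i hi
  env_zero := h.env_zero
  free l h1 h2 := by simpa [xReg, yReg] using h.free l h1 h2

theorem exec_copyVar {d : ℕ} {s : Store (Reg m)} {i n q r : ℕ} {k l : Reg m}
    (hk : ∀ j, Reg.x j ≠ k) (hl : ∀ j, Reg.x j ≠ l) (hak : Reg.aux ≠ k) (hal : Reg.aux ≠ l)
    (hkl : k ≠ l) (haux : s .aux = []) (hx : i < d → s (xReg m (d - 1 - i)) = tick n)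
    (h0 : d ≤ i → n = 0) (hsk : s k = tick q) (hsl : s l = tick (r + n)) :
    Exec M (copyVar m d i k l) s (update (update s k (tick (q + n))) l (tick r)) := by
  unfold copyVar
  split_ifs with hi
  · exact exec_copy (by simp [xReg]) hak hal (hk _) (hl _) hkl haux (hx hi) hsk hsl
  · have := h0 (not_lt.1 hi)
    subst this
    change _ = _
    funext x
    simp only [update_apply]
    split_ifs <;> simp_all

/-- The stacks in the course of the evaluation of a quantifier. -/
def quantStore (m d : ℕ) (s : Store (Reg m)) (v n : ℕ) (b : Bool) : Store (Reg m) :=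
  update (update (update s (xReg m d) (tick v)) (yReg m d) (tick n)) .res [.bit b]

theorem Ready.quantStore {A : Model} {d : ℕ} {env : ℕ → ℕ} {s : Store (Reg m)}
    (h : Ready A d env s) (hd : d ≤ m) {v : ℕ} (hv : v ≤ A.B) (n : ℕ) (b : Bool) :
    Ready A (d + 1) (consEnv v env) (quantStore m d s v n b) where
  word a := by simp [StackProgram.quantStore, xReg, yReg, h.word]
  read a := by simp [StackProgram.quantStore, xReg, yReg, h.read]
  res := ⟨b, by simp [StackProgram.quantStore]⟩
  a1 := by simp [StackProgram.quantStore, xReg, yReg, h.a1]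
  b1 := by simp [StackProgram.quantStore, xReg, yReg, h.b1]
  a2 := by simp [StackProgram.quantStore, xReg, yReg, h.a2]
  b2 := by simp [StackProgram.quantStore, xReg, yReg, h.b2]
  a3 := by simp [StackProgram.quantStore, xReg, yReg, h.a3]
  aux := by simp [StackProgram.quantStore, xReg, yReg, h.aux]
  env_le i := by cases i with
    | zero => exact hv
    | succ i => exact h.env_le i
  var i hi := by
    have hy : ∀ l, xReg m l ≠ yReg m d := by simp [xReg, yReg]
    have hr : ∀ l, xReg m l ≠ .res := by simp [xReg]
    simp only [StackProgram.quantStore, update_apply, hy, hr, if_false]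
    simp only [xReg_inj (show d + 1 - 1 - i ≤ m by omega) hd]
    cases i with
    | zero => simp [consEnv]
    | succ i =>
      have e : d + 1 - 1 - (i + 1) = d - 1 - i := by omega
      rw [if_neg (by omega), e, h.var i (by omega)]
      rfl
  env_zero i hi := by
    obtain ⟨j, rfl⟩ : ∃ j, i = j + 1 := ⟨i - 1, by omega⟩
    exact h.env_zero j (by omega)
  free l h1 h2 := by
    have hy : ∀ l, xReg m l ≠ yReg m d := by simp [xReg, yReg]
    have hx : ∀ l, yReg m l ≠ xReg m d := by simp [xReg, yReg]
    have hr : ∀ l, xReg m l ≠ .res := by simp [xReg]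
    have hr' : ∀ l, yReg m l ≠ .res := by simp [yReg]
    have := h.free l (by omega) h2
    simp only [StackProgram.quantStore, update_apply, hx, hy, hr, hr', if_false]
    have e : l ≠ d := by omega
    simp only [xReg_inj h2 hd, yReg_inj h2 hd, e, if_false]
    exact this

/-- No program for a formula contains a `push`: all counters draw on their supplies and give
everything back, so the only lasting change is the truth value in `res`, and the bound `M` is
arbitrary. The hypothesis on the depth provides separate stacks for all variables bound at the same
time. -/
theorem exec_evalProg (A : Model) (φ : Fm) (d : ℕ) (hd : d + φ.depth ≤ m + 1) (env : ℕ → ℕ)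
    (s : Store (Reg m)) (h : Ready A d env s) (v : Bool) (hv : v = true ↔ φ.Sat A env) :
    Exec M (evalProg m d φ) s (update s .res [.bit v]) := by
  induction φ generalizing d env s v with
  | add i j k =>
    obtain rfl : v = decide (env i + env j = env k) := by
      rw [Bool.eq_iff_iff, hv, decide_eq_true_iff, Fm.Sat]
    obtain ⟨b, hb⟩ := h.res
    have h1 := h.env_le i
    have h2 := h.env_le j
    have h3 := h.env_le k
    obtain ⟨r, hr⟩ : ∃ r, 2 * A.B = r + env j + env i := ⟨2 * A.B - env i - env j, by omega⟩
    obtain ⟨u, hu⟩ : ∃ u, 2 * A.B = u + env k := ⟨2 * A.B - env k, by omega⟩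
    refine Exec.seq (exec_copyVar (n := env i) (q := 0) (r := r + env j) (by simp) (by simp)
      (by simp) (by simp) (by simp) h.aux (h.var i) (h.env_zero i) h.a1 (by rw [h.b1, hr])) ?_
    refine Exec.seq (exec_copyVar (n := env j) (q := 0 + env i) (r := r) (by simp) (by simp)
      (by simp) (by simp) (by simp) (by simp [h.aux]) ?_ (h.env_zero j) (by simp) (by simp)) ?_
    · intro hj
      simpa [xReg] using h.var j hj
    refine Exec.seq (exec_copyVar (n := env k) (q := 0) (r := u) (by simp) (by simp)
      (by simp) (by simp) (by simp) (by simp [h.aux]) ?_ (h.env_zero k) (by simp [h.a2])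
      (by simp [h.b2, hu])) ?_
    · intro hk
      simpa [xReg] using h.var k hk
    refine (exec_eqProg (a := 0 + env i + env j) (c := r) (b := 0 + env k) (d := u) (r := .bit b)
      ?_ ?_ ?_ ?_ ?_).of_eq ?_
    any_goals simp [hb]
    have e1 := h.a1
    have e2 := h.a2
    have e3 := h.b1
    have e4 := h.b2
    have e5 : r + (env i + env j) = 2 * A.B := by omega
    funext x
    simp only [update_apply, e5, ← hu]
    split_ifs <;> simp_all [Fm.Sat]
  | bit i j =>
    obtain rfl : v = (env i).testBit (env j) := by
      rw [Bool.eq_iff_iff, hv, Fm.Sat]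
    obtain ⟨b, hb⟩ := h.res
    have h1 := h.env_le i
    have h2 := h.env_le j
    obtain ⟨r, hr⟩ : ∃ r, 2 * A.B = r + env i := ⟨2 * A.B - env i, by omega⟩
    obtain ⟨u, hu⟩ : ∃ u, 2 * A.B = u + env j := ⟨2 * A.B - env j, by omega⟩
    refine Exec.seq (exec_copyVar (n := env i) (q := 0) (r := r) (by simp) (by simp)
      (by simp) (by simp) (by simp) h.aux (h.var i) (h.env_zero i) h.a1 (by rw [h.b1, hr])) ?_
    refine Exec.seq (exec_copyVar (n := env j) (q := 0) (r := u) (by simp) (by simp)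
      (by simp) (by simp) (by simp) (by simp [h.aux]) ?_ (h.env_zero j) (by simp [h.a2])
      (by simp [h.b2, hu])) ?_
    · intro hj
      simpa [xReg] using h.var j hj
    refine (exec_bitProg (a := 0 + env i) (c := r) (b := 0 + env j) (d := u) (r := .bit b)
      ?_ ?_ ?_ ?_ ?_ ?_).of_eq ?_
    any_goals simp [hb, h.a3]
    have e1 := h.a1
    have e2 := h.a2
    have e3 := h.b1
    have e4 := h.b2
    funext x
    simp only [update_apply, ← hu, ← hr]
    split_ifs <;> simp_all [Fm.Sat]
  | look a c i =>
    obtain rfl : v = c (A.word a)[env i]? := by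
      rw [Bool.eq_iff_iff, hv, Fm.Sat]
    obtain ⟨b, hb⟩ := h.res
    have h1 := h.env_le i
    obtain ⟨r, hr⟩ : ∃ r, 2 * A.B = r + env i := ⟨2 * A.B - env i, by omega⟩
    refine Exec.seq (exec_copyVar (n := env i) (q := 0) (r := r) (by simp) (by simp)
      (by simp) (by simp) (by simp) h.aux (h.var i) (h.env_zero i) h.a2 (by rw [h.b2, hr])) ?_
    refine (exec_lookProg (b := 0 + env i) (d := r) (r := .bit b) a c (l := A.word a)
      ?_ ?_ ?_ ?_ ?_).of_eq ?_
    any_goals simp [hb, h.word, h.read]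
    have e2 := h.a2
    have e4 := h.b2
    funext x
    simp only [update_apply, ← hr]
    split_ifs <;> simp_all [Fm.Sat]
  | neg φ ih =>
    by_cases hφ : φ.Sat A env
    · obtain rfl : v = false := by simpa [Fm.Sat, hφ] using hv
      refine Exec.seq (ih d hd env s h true (by simp [hφ])) (Exec.ite_true
        (by simp [isTrue, symBool]) ((Exec.setTop_one _ (update_self _ _ _)).of_eq ?_))
      simp
    · obtain rfl : v = true := by simpa [Fm.Sat, hφ] using hv
      refine Exec.seq (ih d hd env s h false (by simp [hφ])) (Exec.ite_false
        (by simp [isTrue, symBool]) ((Exec.setTop_one _ (update_self _ _ _)).of_eq ?_))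
      simp
  | conj φ ψ ihφ ihψ =>
    simp only [Fm.depth] at hd
    by_cases hφ : φ.Sat A env
    · refine Exec.seq (ihφ d (by omega) env s h true (by simp [hφ])) (Exec.ite_true
        (by simp [isTrue, symBool]) ((ihψ d (by omega) env _ (h.update_res _) v
          (by simpa [Fm.Sat, hφ] using hv)).of_eq ?_))
      simp
    · obtain rfl : v = false := by simpa [Fm.Sat, hφ] using hv
      exact Exec.seq (ihφ d (by omega) env s h false (by simp [hφ])) (Exec.ite_false
        (by simp [isTrue, symBool]) rfl)
  | ex φ ih =>
    simp only [Fm.depth] at hd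
    have hdm : d ≤ m := by omega
    obtain ⟨b, hb⟩ := h.res
    obtain ⟨hx, hy⟩ := h.free d le_rfl hdm
    have hxy : xReg m d ≠ yReg m d := by simp [xReg, yReg]
    have hxr : xReg m d ≠ .res := by simp [xReg]
    have hyr : yReg m d ≠ .res := by simp [yReg]
    have hrx := hxr.symm
    have hry := hyr.symm
    have hyx := hxy.symm
    -- The loop with `v` values already rejected and `n` still to be tried; `r` is the answer for
    -- the values from `v` on.
    have key : ∀ (n v : ℕ) (r : Bool), v + n = A.B →
        (r = true ↔ ∃ x, v ≤ x ∧ x < A.B ∧ φ.Sat A (consEnv x env)) →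
        Exec M (.loop (yReg m d) Option.isSome (.seq (evalProg m (d + 1) φ)
        (.ite .res isTrue (drain (yReg m d) (xReg m d)) (.move (yReg m d) (xReg m d)))))
        (quantStore m d s v n false)
        (quantStore m d s A.B 0 r) := by
      intro n
      induction n with
      | zero =>
        intro v r hv hr
        have e : ¬ ∃ x, v ≤ x ∧ x < A.B ∧ φ.Sat A (consEnv x env) := by
          rintro ⟨x, h1, h2, _⟩
          omega
        obtain rfl : r = false := by simpa [e] using hr
        rw [show A.B = v by omega]
        exact Exec.loop_nil (by simp [quantStore, hyr])
      | succ n ihn =>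
        intro v r hv hr
        have hev := ih (d + 1) (by omega) _ _ (h.quantStore hdm (v := v) (by omega) (n + 1) false)
        by_cases hφ : φ.Sat A (consEnv v env)
        · have e : ∃ x, v ≤ x ∧ x < A.B ∧ φ.Sat A (consEnv x env) := ⟨v, le_rfl, by omega, hφ⟩
          obtain rfl : r = true := hr.2 e
          refine Exec.loop_cons (by simp [quantStore, hyr]) (Exec.seq (hev true (by simp [hφ]))
            (.ite_true (by simp [isTrue, symBool])
              (exec_drain_tick (n := n + 1) (r := v) hyx ?_ ?_)))
            ((Exec.loop_nil (by simp [quantStore, hyr, hyx])).of_eq ?_)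
          · simp [quantStore, hyr]
          · simp [quantStore, hxr, hxy]
          · clear ih ihn hev hr e hφ
            funext x
            simp only [quantStore, update_apply, hv]
            split_ifs <;> simp_all
        · have e : (∃ x, v ≤ x ∧ x < A.B ∧ φ.Sat A (consEnv x env)) ↔
              ∃ x, v + 1 ≤ x ∧ x < A.B ∧ φ.Sat A (consEnv x env) := by
            constructor
            · rintro ⟨x, h1, h2, h3⟩
              refine ⟨x, ?_, h2, h3⟩
              rcases eq_or_lt_of_le h1 with rfl | h1
              · exact absurd h3 hφ
              · exact h1
            · rintro ⟨x, h1, h2, h3⟩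
              exact ⟨x, by omega, h2, h3⟩
          refine Exec.loop_cons (by simp [quantStore, hyr]) (Exec.seq (hev false (by simp [hφ]))
            (.ite_false (by simp [isTrue, symBool])
              (Exec.move_tick (n := n) (r := v) hyx ?_ ?_)))
            (Eq.subst (motive := fun t => Exec M _ t _) ?_ (ihn (v + 1) r (by omega)
              (hr.trans e)))
          · simp [quantStore, hyr]
          · simp [quantStore, hxr, hxy]
          · clear ih ihn hev hr e hφ
            funext x
            simp only [quantStore, update_apply]
            split_ifs <;> simp_all
    refine Exec.seq (.setTop_one _ hb) (Exec.seq (Eq.subst (motive := fun t => Exec M _ t _) ?_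
      (key A.B 0 v (by omega) (by simpa [Fm.Sat] using hv))) 
        ((exec_drain_tick hxy (n := A.B) (r := 0) ?_ ?_).of_eq ?_))
    all_goals clear ih key
    · funext x
      simp only [quantStore, update_apply]
      split_ifs <;> simp_all
    · simp [quantStore, hxr, hxy]
    · simp [quantStore, hyr]
    · funext x
      simp only [quantStore, update_apply, Fm.Sat, Nat.zero_le, true_and]
      split_ifs <;> simp_all

end Evaluation

end StackProgram

/-! ### Computing the size of the domain and filling the supplies -/

namespace StackProgram

open TeamFormula SpaceComplexity Relation Function

section Generic

variable {κ : Type} [DecidableEq κ] [Fintype κ] {M : ℕ}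

theorem Store.size_update_of_eq {s : Store κ} {k : κ} {a : ℕ} (l : List Sym)
    (h : (s k).length = a) : Store.size (update s k l) + a = s.size + l.length := by
  rw [← h, Store.size_update]

/-- Push some symbols. -/
def pushList : List (κ × Sym) → Prog κ
  | [] => .skip
  | (k, a) :: l => .seq (.push k a) (pushList l)

/-- The stacks after some symbols have been pushed. -/
def pushStore : List (κ × Sym) → Store κ → Store κ
  | [], s => s
  | (k, a) :: l, s => pushStore l (update s k (a :: s k))

theorem exec_push {k : κ} {a : Sym} {s : Store κ} (h : s.size + 1 ≤ M) :
    Exec M (.push k a) s (update s k (a :: s k)) := ⟨h, rfl⟩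

theorem exec_push_tick {k : κ} {s : Store κ} {n : ℕ} (hk : s k = tick n) (h : s.size + 1 ≤ M) :
    Exec M (.push k .tick) s (update s k (tick (n + 1))) := by
  have := exec_push (k := k) (a := .tick) h
  rwa [hk] at this

theorem exec_pop_tick {k : κ} {s : Store κ} {n : ℕ} (hk : s k = tick (n + 1)) :
    Exec M (.pop k) s (update s k (tick n)) := by
  change _ = _
  rw [hk]
  rfl

theorem size_push (s : Store κ) (k : κ) (a : Sym) :
    Store.size (update s k (a :: s k)) = s.size + 1 := by
  have := Store.size_update s k (a :: s k)
  simp only [List.length_cons] at this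
  omega

theorem size_pop_tick {s : Store κ} {k : κ} {n : ℕ} (hk : s k = tick (n + 1)) :
    Store.size (update s k (tick n)) + 1 = s.size := by
  have := Store.size_update s k (tick n)
  simp only [hk, length_tick] at this
  omega

theorem exec_pushList (l : List (κ × Sym)) (s : Store κ) (h : s.size + l.length ≤ M) :
    Exec M (pushList l) s (pushStore l s) := by
  induction l generalizing s with
  | nil => rfl
  | cons p l ih =>
    simp only [List.length_cons] at h
    refine Exec.seq (exec_push (by omega)) (ih _ ?_)
    rw [size_push]
    omega

theorem size_pushStore (l : List (κ × Sym)) (s : Store κ) :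
    (pushStore l s).size = s.size + l.length := by
  induction l generalizing s with
  | nil => rfl
  | cons p l ih =>
    rw [pushStore, ih, size_push, List.length_cons]
    omega

/-- Empty some stacks. -/
def clearList : List κ → Prog κ
  | [] => .skip
  | k :: l => .seq (.loop k Option.isSome (.pop k)) (clearList l)

theorem exec_clearList (l : List κ) (s : Store κ) :
    Exec M (clearList l) s (fun k => if k ∈ l then [] else s k) := by
  induction l generalizing s with
  | nil => change _ = _; simp
  | cons k l ih =>
    have key : ∀ (u : List Sym) (s : Store κ), s k = u →
        Exec M (.loop k Option.isSome (.pop k)) s (update s k []) := by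
      intro u
      induction u with
      | nil =>
        intro s hs
        exact (Exec.loop_nil (by simp [hs])).of_eq (by simp [← hs])
      | cons a u ihu =>
        intro s hs
        refine Exec.loop_cons (by simp [hs]) (t := update s k u) ?_ ((ihu _ (by simp)).of_eq
          (by simp))
        change _ = _
        rw [hs]
        rfl
    refine Exec.seq (key _ s rfl) ((ih _).of_eq ?_)
    funext x
    by_cases hx : x = k
    · subst hx
      simp
    · simp [hx]

end Generic

section Preparation

variable {m M : ℕ}

/-- Write the length of the input to `a1`. -/
def countProg (m : ℕ) : Prog (Reg m) :=
  .seq (.loop (.word false) Option.isSome (.seq (.move (.word false) (.read false))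
    (.push .a1 .tick))) (drain (.read false) (.word false))

theorem exec_countProg {s : Store (Reg m)} {w : List Sym} (hw : s (.word false) = w)
    (hr : s (.read false) = []) (ha : s .a1 = []) (hM : s.size + w.length ≤ M) :
    Exec M (countProg m) s (update s .a1 (tick w.length)) := by
  have key : ∀ (w u : List Sym) (n : ℕ) (s : Store (Reg m)), s (.word false) = w →
      s (.read false) = u → s .a1 = tick n → s.size + w.length ≤ M →
      Exec M (.loop (.word false) Option.isSome (.seq (.move (.word false) (.read false))
        (.push .a1 .tick))) s (update (update (update s .a1 (tick (n + w.length)))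
          (.word false) []) (.read false) (w.reverse ++ u)) := by
    intro w
    induction w with
    | nil =>
      intro u n s hw hr ha hM
      refine (Exec.loop_nil (by simp [hw])).of_eq ?_
      funext x
      simp only [update_apply]
      split_ifs <;> simp_all
    | cons a w ih =>
      intro u n s hw hr ha hM
      have hsz := Store.size_move s (.word false) (.read false)
      have e : s.move (.word false) (.read false) =
          update (update s (.word false) w) (.read false) (a :: u) := by
        simp [Store.move, hw, hr]
      rw [e] at hsz
      simp only [List.length_cons] at hM
      refine Exec.loop_cons (by simp [hw]) (Exec.seq (.move_cons (by simp) hw)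
        (exec_push_tick (n := n) (by simp [ha]) ?_)) ((ih (a :: u) (n + 1) _ ?_ ?_ ?_ ?_).of_eq ?_)
      · rw [hr, hsz]
        omega
      · simp
      · simp [hr]
      · simp
      · have h1 := Store.size_update_of_eq (s := update (update s (.word false) w)
          (.read false) (a :: u)) (k := .a1) (a := n) (tick (n + 1)) (by simp [ha])
        rw [hr]
        simp only [length_tick] at h1
        omega
      · funext x
        simp only [update_apply]
        split_ifs <;> simp_all [Nat.add_assoc, Nat.add_comm 1]
  refine Exec.seq (key w [] 0 s hw hr (by simp [ha]) hM) ((exec_drain (by simp) _).of_eq ?_)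
  funext x
  simp only [update_apply]
  split_ifs <;> simp_all

/-- Replace the number `n` in `a1` by `2 ^ n`. -/
def expProg (m : ℕ) : Prog (Reg m) :=
  .seq (.push .a2 .tick) (.seq
    (.loop .a1 Option.isSome (.seq (.pop .a1) (.seq
      (.loop .a2 Option.isSome (.seq (.pop .a2) (.seq (.push .a3 .tick) (.push .a3 .tick))))
      (drain .a3 .a2))))
    (drain .a2 .a1))

/-- One symbol in `a2` is doubled once for each of the `n` symbols in `a1`. -/
theorem exec_expProg {s : Store (Reg m)} {n : ℕ} (h1 : s .a1 = tick n) (h2 : s .a2 = [])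
    (h3 : s .a3 = []) (hM : s.size + 2 ^ n ≤ M) :
    Exec M (expProg m) s (update s .a1 (tick (2 ^ n))) := by
  -- Each turn removes one symbol and pushes two, so doubling `b` costs `b` symbols of extra space.
  have double : ∀ (b c : ℕ) (s : Store (Reg m)), s .a2 = tick b → s .a3 = tick c →
      s.size + b ≤ M →
      Exec M (.loop .a2 Option.isSome (.seq (.pop .a2) (.seq (.push .a3 .tick)
        (.push .a3 .tick)))) s (update (update s .a2 []) .a3 (tick (c + 2 * b))) := by
    intro b
    induction b with
    | zero =>
      intro c s h2 h3 hM
      refine (Exec.loop_nil (by simp [h2])).of_eq ?_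
      funext x
      simp only [update_apply]
      split_ifs <;> simp_all
    | succ b ih =>
      intro c s h2 h3 hM
      have e1 := size_pop_tick h2
      have e2 := Store.size_update_of_eq (s := update s .a2 (tick b)) (k := .a3) (a := c)
        (tick (c + 1)) (by simp [h3])
      have e3 := Store.size_update_of_eq (s := update (update s .a2 (tick b)) .a3 (tick (c + 1)))
        (k := .a3) (a := c + 1) (tick (c + 1 + 1)) (by simp)
      simp only [length_tick] at e2 e3
      refine Exec.loop_cons (by simp [h2]) (Exec.seq (exec_pop_tick h2) (Exec.seq
        (exec_push_tick (n := c) (by simp [h3]) (by omega))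
        (exec_push_tick (n := c + 1) (by simp) (by omega))))
        ((ih (c + 1 + 1) _ ?_ ?_ (by omega)).of_eq ?_)
      · simp
      · simp
      · have e : c + 2 * (b + 1) = c + 1 + 1 + 2 * b := by ring
        rw [e]
        funext x
        simp only [update_apply]
        split_ifs <;> simp_all
  -- The `b` symbols in `a2` are already counted in `s.size` and give way to `b * 2 ^ n` symbols;
  -- this explains the summand `b` on the right.
  have key : ∀ (n b : ℕ) (s : Store (Reg m)), s .a1 = tick n → s .a2 = tick b → s .a3 = [] →
      s.size + b * 2 ^ n ≤ M + b →
      Exec M (.loop .a1 Option.isSome (.seq (.pop .a1) (.seq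
        (.loop .a2 Option.isSome (.seq (.pop .a2) (.seq (.push .a3 .tick) (.push .a3 .tick))))
        (drain .a3 .a2)))) s (update (update s .a1 []) .a2 (tick (b * 2 ^ n))) := by
    intro n
    induction n with
    | zero =>
      intro b s h1 h2 h3 hM
      refine (Exec.loop_nil (by simp [h1])).of_eq ?_
      funext x
      simp only [update_apply]
      split_ifs <;> simp_all
    | succ n ih =>
      intro b s h1 h2 h3 hM
      have e1 := size_pop_tick h1
      have hb : b ≤ b * 2 ^ n := Nat.le_mul_of_pos_right _ (by positivity)
      have hp : b * 2 ^ (n + 1) = b * 2 ^ n + b * 2 ^ n := by ring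
      have hp' : 2 * b * 2 ^ n = b * 2 ^ n + b * 2 ^ n := by ring
      have e2 := Store.size_update_of_eq (s := update s .a1 (tick n)) (k := .a2) (a := b)
        (tick (2 * b)) (by simp [h2])
      simp only [length_tick] at e2
      have e3 : update (update (update (update (update s .a1 (tick n)) .a2 [])
            .a3 (tick (0 + 2 * b))) .a3 []) .a2 (tick (0 + 2 * b)) =
          update (update s .a1 (tick n)) .a2 (tick (2 * b)) := by
        funext x
        simp only [update_apply]
        split_ifs <;> simp_all
      refine Exec.loop_cons (t := update (update s .a1 (tick n)) .a2 (tick (2 * b)))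
        (by simp [h1]) (Exec.seq (exec_pop_tick h1) (Exec.seq
        (double b 0 _ (by simp [h2]) (by simp [h3]) (by omega))
        ((exec_drain_tick (n := 0 + 2 * b) (r := 0) (by simp) (by simp) (by simp)).of_eq ?_)))
        ((ih (2 * b) _ ?_ ?_ ?_ (by omega)).of_eq ?_)
      · simpa using e3.symm
      · simp
      · simp
      · simp [h3]
      · rw [hp, ← hp']
        funext x
        simp only [update_apply]
        split_ifs <;> simp_all
  have hpos : 0 < 2 ^ n := by positivity
  have e1 := Store.size_update_of_eq (s := s) (k := .a2) (a := 0) (tick (0 + 1)) (by simp [h2])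
  simp only [length_tick] at e1
  refine Exec.seq (exec_push_tick (n := 0) (by simp [h2]) (by omega)) (Exec.seq
    (key n 1 _ (by simp [h1]) (by simp) (by simp [h3]) (by omega))
    ((exec_drain_tick (n := 1 * 2 ^ n) (r := 0) (by simp) (by simp) (by simp)).of_eq ?_))
  funext x
  simp only [update_apply]
  split_ifs <;> simp_all

/-- The symbols pushed in one step of the preparation. -/
def supplies (m : ℕ) : List (Reg m × Sym) :=
  [(.b1, .tick), (.b1, .tick), (.b2, .tick), (.b2, .tick), (.word true, .bit false)] ++
    (List.finRange (m + 1)).map fun i => (.y i, .tick)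

/-- Fill the supplies, with the number in `a1`. -/
def fillProg (m : ℕ) : Prog (Reg m) :=
  .loop .a1 Option.isSome (.seq (.pop .a1) (pushList (supplies m)))

/-- The stacks in the course of the preparation. -/
def fillStore (w : List Sym) (n v : ℕ) : Store (Reg m)
  | .word false => w
  | .word true => List.replicate v (.bit false)
  | .a1 => tick n
  | .b1 => tick (2 * v)
  | .b2 => tick (2 * v)
  | .y _ => tick v
  | _ => []

theorem pushStore_y (l : List (Fin (m + 1))) (hl : l.Nodup) (s : Store (Reg m)) (k : Reg m) :
    pushStore (l.map fun i => (Reg.y i, Sym.tick)) s k =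
      if ∃ i ∈ l, k = .y i then .tick :: s k else s k := by
  induction l generalizing s with
  | nil => simp [pushStore]
  | cons i l ih =>
    rw [List.nodup_cons] at hl
    rw [List.map_cons, pushStore, ih hl.2]
    by_cases hk : k = .y i
    · subst hk
      simp [hl.1]
    · simp [hk]

/-- One pass over `a1` builds all the supplies and also the word of `n` bits `false` with which the
enumeration starts. -/
theorem exec_fillProg (w : List Sym) (n : ℕ)
    (hM : w.length + n * (m + 6) ≤ M) :
    Exec M (fillProg m) (fillStore w n 0) (fillStore w 0 n) := by
  -- The summand `n` on the right accounts for the symbols of `a1` that are removed along the way.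
  have key : ∀ n v : ℕ, (fillStore w n v : Store (Reg m)).size + n * (m + 6) ≤ M + n →
      Exec M (fillProg m) (fillStore w n v) (fillStore w 0 (v + n)) := by
    intro n
    induction n with
    | zero =>
      intro v hM
      exact Exec.loop_nil (by simp [fillStore])
    | succ n ih =>
      intro v hM
      have hl : (supplies m).length = m + 6 := by
        simp [supplies]
      have e1 := size_pop_tick (s := (fillStore w (n + 1) v : Store (Reg m))) (k := .a1) (n := n)
        rfl
      have e2 := size_pushStore (supplies m) (update (fillStore w (n + 1) v) .a1 (tick n))
      have e : pushStore (supplies m) (update (fillStore w (n + 1) v) .a1 (tick n)) =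
          fillStore w n (v + 1) := by
        funext k
        simp only [supplies, List.cons_append, List.nil_append, pushStore]
        rw [pushStore_y _ (List.nodup_finRange _)]
        rcases k with (_ | _) | _ | _ | _ | _ | _ | _ | _ | _ | _ | _ | _ <;>
          simp [fillStore, tick, Nat.mul_add, List.replicate_succ]
      rw [e, hl] at e2
      rw [Nat.add_mul] at hM
      have hn : n ≤ n * (m + 6) := Nat.le_mul_of_pos_right _ (by omega)
      rw [show v + (n + 1) = v + 1 + n by ring]
      refine Exec.loop_cons (by simp [fillStore]) (Exec.seq (exec_pop_tick rfl)
        ((exec_pushList _ _ (by rw [hl]; omega)).of_eq e.symm)) (ih (v + 1) (by omega))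
  have := key n 0
  rw [Nat.zero_add] at this
  refine this ?_
  have h0 : (fillStore w n 0 : Store (Reg m)) =
      update (update (fun _ => []) (.word false) w) .a1 (tick n) := by
    funext k
    rcases k with (_ | _) | _ | _ | _ | _ | _ | _ | _ | _ | _ | _ | _ <;>
      simp [fillStore]
  have h1 := Store.size_update_of_eq (s := (fun _ => [] : Store (Reg m))) (k := .word false)
    (a := 0) w rfl
  have h2 := Store.size_update_of_eq (s := update (fun _ => [] : Store (Reg m)) (.word false) w)
    (k := .a1) (a := 0) (tick n) (by simp)
  have h3 : Store.size (fun _ => [] : Store (Reg m)) = 0 := by simp [Store.size]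
  rw [length_tick] at h2
  rw [h0]
  omega

end Preparation

end StackProgram

/-! ### Enumeration of all values of the second word -/

namespace StackProgram

open TeamFormula SpaceComplexity Relation Function

section Enumeration

variable {m M : ℕ}

/-- The number with a given binary representation, least significant bit first. -/
def binVal : List Bool → ℕ
  | [] => 0
  | b :: l => b.toNat + 2 * binVal l

theorem binVal_lt (l : List Bool) : binVal l < 2 ^ l.length := by
  induction l with
  | nil => simp [binVal]
  | cons b l ih =>
    have := Bool.toNat_lt b
    rw [binVal, List.length_cons, pow_succ]
    omega

theorem binVal_inj {l l' : List Bool} (h : l.length = l'.length) (hv : binVal l = binVal l') :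
    l = l' := by
  induction l generalizing l' with
  | nil => cases l' with
    | nil => rfl
    | cons b l' => simp at h
  | cons b l ih => cases l' with
    | nil => simp at h
    | cons b' l' =>
      simp only [binVal] at hv
      simp only [List.length_cons, Nat.add_right_cancel_iff] at h
      have h1 := Bool.toNat_lt b
      have h2 := Bool.toNat_lt b'
      have h3 : b = b' := by
        cases b <;> cases b' <;> simp at hv ⊢ <;> omega
      subst h3
      rw [ih h (by omega)]

theorem binVal_replicate_false (n : ℕ) : binVal (List.replicate n false) = 0 := by
  induction n with
  | zero => rfl
  | succ n ih => simp [List.replicate_succ, binVal, ih]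

/-- The next word in the binary order, if there is one. -/
def binSucc : List Bool → Option (List Bool)
  | [] => none
  | false :: l => some (true :: l)
  | true :: l => (binSucc l).map (false :: ·)

theorem binSucc_eq_none {l : List Bool} (h : binSucc l = none) :
    binVal l + 1 = 2 ^ l.length := by
  induction l with
  | nil => rfl
  | cons b l ih =>
    cases b with
    | false => simp [binSucc] at h
    | true =>
      simp only [binSucc, Option.map_eq_none_iff] at h
      have := ih h
      rw [binVal, List.length_cons, pow_succ, ← this]
      simp
      ring

theorem binSucc_eq_some {l l' : List Bool} (h : binSucc l = some l') :
    binVal l' = binVal l + 1 ∧ l'.length = l.length := by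
  induction l generalizing l' with
  | nil => simp [binSucc] at h
  | cons b l ih =>
    cases b with
    | false =>
      simp only [binSucc, Option.some.injEq] at h
      subst h
      simp [binVal, Nat.add_comm]
    | true =>
      simp only [binSucc, Option.map_eq_some_iff] at h
      obtain ⟨u, hu, rfl⟩ := h
      obtain ⟨h1, h2⟩ := ih hu
      simp only [binVal, h1, List.length_cons, h2, and_true]
      simp
      ring

/-- Replace the second word by the next one; lower the flag if there is none. -/
def succProg (m : ℕ) : Prog (Reg m) :=
  .seq (.loop (.word true) isTrue (.seq (.setTop (.word true) (.bit false))
    (.move (.word true) (.read true)))) (.seq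
    (.ite (.word true) Option.isSome (.setTop (.word true) (.bit true))
      (.setTop .go (.bit false))) (drain (.read true) (.word true)))

/-- Binary increment with the least significant bit on top: the leading block of `true` becomes
`false` and the next bit becomes `true`. On overflow only the flag matters, so nothing is claimed
about `u` in that case. -/
theorem exec_succProg {s : Store (Reg m)} {l : List Bool} (hw : s (.word true) = l.map Sym.bit)
    (hr : s (.read true) = []) (hg : s .go = [.bit true]) :
    ∃ u, Exec M (succProg m) s (update (update s (.word true) u) .go
      [.bit (binSucc l).isSome]) ∧ ∀ l', binSucc l = some l' → u = l'.map Sym.bit := by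
  have key : ∀ (l : List Bool) (r : ℕ) (s : Store (Reg m)), s (.word true) = l.map Sym.bit →
      s (.read true) = List.replicate r (.bit false) →
      ∃ k t, (l = List.replicate k true ++ t) ∧ (∀ u, t ≠ true :: u) ∧
      Exec M (.loop (.word true) isTrue (.seq (.setTop (.word true) (.bit false))
        (.move (.word true) (.read true)))) s
        (update (update s (.word true) (t.map Sym.bit)) (.read true)
          (List.replicate (r + k) (.bit false))) := by
    intro l
    induction l with
    | nil =>
      intro r s hw hr
      refine ⟨0, [], rfl, by simp, (Exec.loop_nil (by simp [hw, isTrue, symBool])).of_eq ?_⟩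
      funext x
      simp only [update_apply]
      split_ifs <;> simp_all
    | cons b l ih =>
      intro r s hw hr
      cases b with
      | false =>
        refine ⟨0, false :: l, rfl, by simp, (Exec.loop_nil (by simp [hw, isTrue, symBool])).of_eq
          ?_⟩
        funext x
        simp only [update_apply]
        split_ifs <;> simp_all
      | true =>
        obtain ⟨k, t, hk, ht, h⟩ := ih (r + 1)
          (update (update s (.word true) (l.map Sym.bit)) (.read true)
            (List.replicate (r + 1) (.bit false))) (by simp) (by simp)
        refine ⟨k + 1, t, by simp [hk, List.replicate_succ], ht, Exec.loop_cons
          (t := update (update s (.word true) (l.map Sym.bit)) (.read true)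
            (List.replicate (r + 1) (.bit false))) (by simp [hw, isTrue, symBool])
          (Exec.seq (t := update s (.word true) (.bit false :: l.map Sym.bit)) ?_
            ((Exec.move_cons (a := .bit false) (l := l.map Sym.bit) (by simp)
              (by simp)).of_eq ?_)) (h.of_eq ?_)⟩
        · change _ = _
          simp [Store.setTop, hw]
        · funext x
          simp only [update_apply]
          split_ifs <;> simp_all [List.replicate_succ]
        · funext x
          simp only [update_apply]
          split_ifs <;> simp_all [Nat.add_assoc, Nat.add_comm 1]
  have hsucc : ∀ (k : ℕ) (t : List Bool), binSucc (List.replicate k true ++ t) =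
      (binSucc t).map (List.replicate k false ++ ·) := by
    intro k t
    induction k with
    | zero => simp
    | succ k ih =>
      simp only [List.replicate_succ, List.cons_append, binSucc, ih, Option.map_map]
      rfl
  obtain ⟨k, t, rfl, ht, h⟩ := key l 0 s hw hr
  cases t with
  | nil =>
    rw [hsucc]
    refine ⟨List.replicate k (.bit false), Exec.seq h (Exec.seq (.ite_false (by simp)
      (.setTop_one (r := .bit true) _ (by simp [hg])))
      ((exec_drain (by simp) _).of_eq ?_)), by simp [binSucc]⟩
    funext x
    simp only [update_apply]
    split_ifs <;> simp_all [binSucc]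
  | cons b t =>
    obtain rfl : b = false := by
      cases b
      · rfl
      · exact absurd rfl (ht t)
    rw [hsucc]
    refine ⟨List.replicate k (.bit false) ++ .bit true :: t.map Sym.bit, Exec.seq h (Exec.seq
      (.ite_true (by simp) (s' := ?_) ?_) ((exec_drain (by simp) _).of_eq ?_)), ?_⟩
    · exact update (update (update s (.word true) (.bit true :: t.map Sym.bit)) (.read true)
          (List.replicate (0 + k) (.bit false))) .go [.bit true]
    · change _ = _
      simp only [Store.setTop]
      simp only [ne_eq, reduceCtorEq, not_false_eq_true, update_of_ne, update_self, List.map_cons]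
      funext x
      simp only [update_apply]
      split_ifs <;> simp_all
    · funext x
      simp only [update_apply]
      split_ifs <;> simp_all [binSucc]
    · intro l' hl'
      simp only [binSucc, Option.map_some, Option.some.injEq] at hl'
      simp [← hl']

/-- Evaluate a formula for all values of the second word, up to the first one for which it is
false. -/
def forallProg (m : ℕ) (φ : Fm) : Prog (Reg m) :=
  .loop .go isTrue (.seq (evalProg m 0 φ)
    (.ite .res isTrue (succProg m) (.setTop .go (.bit false))))

/-- The model with the input word `w` and the second word `l`. -/
def wordModel (B : ℕ) (h : 0 < B) (w : List Sym) (l : List Bool) : Model where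
  B := B
  pos := h
  word a := if a then l.map Sym.bit else w

theorem Ready.update_word {B : ℕ} {hB : 0 < B} {w : List Sym} {l : List Bool} {s : Store (Reg m)}
    {env : ℕ → ℕ}
    (h : Ready (wordModel B hB w l) 0 env s) (l' : List Bool) (a b : Bool) :
    Ready (wordModel B hB w l') 0 env
      (update (update (update s (.word true) (l'.map Sym.bit)) .go [.bit a]) .res [.bit b]) where
  word c := by
    have := h.word false
    cases c <;> simp_all [wordModel]
  read a := by simp [h.read]
  res := ⟨b, by simp⟩
  a1 := by simp [h.a1]
  b1 := by simp [h.b1, wordModel]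
  a2 := by simp [h.a2]
  b2 := by simp [h.b2, wordModel]
  a3 := by simp [h.a3]
  aux := by simp [h.aux]
  env_le := h.env_le
  var i hi := by omega
  env_zero := h.env_zero
  free l h1 h2 := by simpa [xReg, yReg, wordModel] using h.free l h1 h2

/-- Induction on the number `n` of words that come after `l` in the binary order; `v` is the answer
for `l` and all later words. The remaining stacks need no description, because they are emptied
afterwards. -/
theorem exec_forallProg (φ : Fm) (hφ : φ.depth ≤ m + 1) {B : ℕ} (hB : 0 < B) (w : List Sym)
    (env : ℕ → ℕ) (n : ℕ)
    (v : Bool) (l : List Bool) (s : Store (Reg m)) (hl : binVal l + n + 1 = 2 ^ l.length)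
    (hv : v = true ↔ ∀ l' : List Bool, l'.length = l.length → binVal l ≤ binVal l' →
      φ.Sat (wordModel B hB w l') env)
    (h : Ready (wordModel B hB w l) 0 env s) (hgo : s .go = [.bit true]) :
    ∃ s', s' .res = [.bit v] ∧ Exec M (forallProg m φ) s s' := by
  induction n generalizing l s with
  | zero =>
    have hone : ∀ l' : List Bool, l'.length = l.length → binVal l ≤ binVal l' → l' = l := by
      intro l' h1 h2
      have := binVal_lt l'
      rw [h1] at this
      exact binVal_inj h1 (by omega)
    have hv' : v = true ↔ φ.Sat (wordModel B hB w l) env :=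
      hv.trans ⟨fun h => h l rfl le_rfl, fun h l' h1 h2 => hone l' h1 h2 ▸ h⟩
    have hev := exec_evalProg (M := M) _ φ 0 (by omega) env s h v hv'
    cases v with
    | false =>
      exact ⟨_, by simp, Exec.loop_cons (by rw [hgo]; rfl) (Exec.seq hev (.ite_false
        (by simp [isTrue, symBool]) (.setTop_one (r := .bit true) _ (by simp [hgo]))))
        (Exec.loop_nil (by simp [isTrue, symBool]))⟩
    | true =>
      have hw := h.word true
      obtain ⟨u, hu, -⟩ := exec_succProg (M := M) (s := update s .res [.bit true]) (l := l)
        (by simpa [wordModel] using hw) (by simp [h.read]) (by simp [hgo])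
      have hnone : binSucc l = none := by
        by_contra hne
        obtain ⟨l', hl'⟩ := Option.ne_none_iff_exists'.1 hne
        obtain ⟨h1, h2⟩ := binSucc_eq_some hl'
        have := binVal_lt l'
        rw [h2] at this
        omega
      rw [hnone] at hu
      exact ⟨_, by simp, Exec.loop_cons (by rw [hgo]; rfl) (Exec.seq hev (.ite_true
        (by simp [isTrue, symBool]) hu)) (Exec.loop_nil (by simp [isTrue, symBool]))⟩
  | succ n ih =>
    by_cases hs : φ.Sat (wordModel B hB w l) env
    · have hev := exec_evalProg (M := M) _ φ 0 (by omega) env s h true (by simp [hs])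
      have hw := h.word true
      obtain ⟨u, hu, hu'⟩ := exec_succProg (M := M) (s := update s .res [.bit true]) (l := l)
        (by simpa [wordModel] using hw) (by simp [h.read]) (by simp [hgo])
      obtain ⟨l', hl'⟩ : ∃ l', binSucc l = some l' := by
        apply Option.ne_none_iff_exists'.1
        intro hne
        have := binSucc_eq_none hne
        omega
      obtain ⟨h1, h2⟩ := binSucc_eq_some hl'
      have e : update (update (update s .res [.bit true]) (.word true) u) .go
          [.bit (binSucc l).isSome] = update (update (update s (.word true) (l'.map Sym.bit)) .go
            [.bit true]) .res [.bit true] := by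
        rw [hl', hu' l' hl']
        funext x
        simp only [update_apply]
        split_ifs <;> simp_all
      rw [e] at hu
      have hv2 : v = true ↔ ∀ l₁ : List Bool, l₁.length = l'.length → binVal l' ≤ binVal l₁ →
          φ.Sat (wordModel B hB w l₁) env := by
        rw [hv, h1, h2]
        constructor
        · intro H l₁ e1 e2
          exact H l₁ e1 (by omega)
        · intro H l₁ e1 e2
          rcases eq_or_lt_of_le e2 with e3 | e3
          · rwa [← binVal_inj e1.symm e3]
          · exact H l₁ e1 e3
      obtain ⟨s', hs', hs''⟩ := ih l' _ (by rw [h1, h2]; omega) hv2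
        (h.update_word l' true true) (by simp)
      exact ⟨s', hs', Exec.loop_cons (by rw [hgo]; rfl) (Exec.seq hev (.ite_true
        (by simp [isTrue, symBool]) hu)) hs''⟩
    · have hv' : v = false := by
        rw [Bool.eq_false_iff]
        exact fun h => hs (hv.1 h l rfl le_rfl)
      subst hv'
      have hev := exec_evalProg (M := M) _ φ 0 (by omega) env s h false (by simp [hs])
      exact ⟨_, by simp, Exec.loop_cons (by rw [hgo]; rfl) (Exec.seq hev (.ite_false
        (by simp [isTrue, symBool]) (.setTop_one (r := .bit true) _ (by simp [hgo]))))
        (Exec.loop_nil (by simp [isTrue, symBool]))⟩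

end Enumeration

/-! ### The decision procedure and its space bound -/

section Main

/-- The program that decides whether a formula is true for all values of the second word. -/
noncomputable def decideProg (m : ℕ) (φ : Fm) : Prog (Reg m) :=
  .seq (countProg m) (.seq (expProg m) (.seq (expProg m) (.seq (expProg m) (.seq (fillProg m)
    (.seq (.push .res (.bit true)) (.seq (.push .go (.bit true)) (.seq (forallProg m φ)
      (clearList (Finset.univ.erase Reg.res).toList))))))))

theorem two_pow_add_le (a k : ℕ) : 2 ^ a + k ≤ 2 ^ (a + k) := by
  induction k with
  | zero => rfl
  | succ k ih =>
    have : 0 < 2 ^ (a + k) := by positivity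
    rw [← Nat.add_assoc, ← Nat.add_assoc, pow_succ]
    omega

theorem expTower_add_le (j a k : ℕ) : expTower j a + k ≤ expTower j (a + k) := by
  induction j with
  | zero => rfl
  | succ j ih => exact (two_pow_add_le _ _).trans (Nat.pow_le_pow_right (by norm_num) ih)

theorem expTower_pos (j a : ℕ) : 0 < expTower (j + 1) a := by
  rw [expTower]
  positivity

theorem lt_expTower (j a : ℕ) : a < expTower (j + 1) a := by
  induction j with
  | zero => exact Nat.lt_two_pow_self
  | succ j ih => exact ih.trans Nat.lt_two_pow_self

theorem Exec.size_le {m M : ℕ} {p : Prog (Reg m)} {s s' : Store (Reg m)} (h : Exec M p s s')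
    (hs : s.size ≤ M) : s'.size ≤ M :=
  (exec_reaches (p := p) (res := .res) p [] s s' (Set.subset_insert _ _) hs h).2

/-- Three exponentiations turn the length of the input into the size `B` of the domain. The supplies
and the second word take `B * (m + 6)` symbols; the other `B * 6` leave room for the input, the
intermediate counters and the two flags. -/
theorem exec_decideProg {m M : ℕ} (φ : Fm) (hφ : φ.depth ≤ m + 1) (w : List Sym)
    (hM : expTower 3 w.length * (m + 12) ≤ M) (v : Bool)
    (hv : v = true ↔ ∀ l : List Bool, l.length = expTower 3 w.length →
      φ.Sat (wordModel (expTower 3 w.length) (expTower_pos 2 _) w l) fun _ => 0) :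
    Exec M (decideProg m φ) (update (fun _ => []) (.word false) w)
      (update (fun _ => []) .res [.bit v]) := by
  set n := w.length with hn
  set B := expTower 3 n with hB
  have h0 : Store.size (fun _ => [] : Store (Reg m)) = 0 := by simp [Store.size]
  have hw := Store.size_update_of_eq (s := (fun _ => [] : Store (Reg m))) (k := .word false)
    (a := 0) w rfl
  rw [← hn] at hw
  have ha : ∀ a, Store.size (update (update (fun _ => [] : Store (Reg m)) (.word false) w) .a1
      (tick a)) = n + a := by
    intro a
    have := Store.size_update_of_eq (s := update (fun _ => [] : Store (Reg m)) (.word false) w)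
      (k := .a1) (a := 0) (tick a) (by simp)
    rw [length_tick] at this
    omega
  have hB3 : 3 ≤ m + 12 := by omega
  have hBm : B * 3 ≤ B * (m + 12) := Nat.mul_le_mul_left _ hB3
  have h1 : n < expTower 1 n := lt_expTower 0 n
  have h2 : expTower 1 n < expTower 2 n := Nat.lt_two_pow_self
  have h3 : expTower 2 n < B := Nat.lt_two_pow_self
  have hB4 : 4 ≤ B := by
    have e1 : 1 ≤ expTower 1 n := expTower_pos 0 n
    have e2 : 2 ≤ expTower 2 n := by omega
    exact Nat.pow_le_pow_right (n := 2) (by norm_num) e2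
  have hfill : (fillStore w 0 B : Store (Reg m)).size ≤ n + B * (m + 6) :=
    (exec_fillProg w B le_rfl).size_le (by
      have e : (fillStore w B 0 : Store (Reg m)) =
          update (update (fun _ => []) (.word false) w) .a1 (tick B) := by
        funext k
        rcases k with (_ | _) | _ | _ | _ | _ | _ | _ | _ | _ | _ | _ | _ <;>
          simp [fillStore]
      rw [e, ha]
      have : B ≤ B * (m + 6) := Nat.le_mul_of_pos_right _ (by omega)
      omega)
  have hB6 : B * (m + 12) = B * (m + 6) + B * 6 := by ring
  have hm6 : B * 1 ≤ B * (m + 6) := Nat.mul_le_mul_left _ (by omega)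
  have hready : Ready (m := m) (wordModel B (expTower_pos 2 _) w (List.replicate B false)) 0
      (fun _ => 0) (update (update (fillStore w 0 B) .res [.bit true]) .go [.bit true]) := by
    constructor
    case word => intro a; cases a <;> simp [fillStore, wordModel]
    case res => exact ⟨true, by simp⟩
    case env_le => simp
    case var => simp
    case env_zero => simp
    case free => intro l _ _; simp [fillStore, xReg, yReg, wordModel]
    all_goals simp [fillStore, wordModel]
  -- The enumeration starts with the word that represents 0, which `2 ^ B - 1` further words follow.
  obtain ⟨s', hs', hex⟩ := exec_forallProg (M := M) φ hφ (expTower_pos 2 _) w (fun _ => 0)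
    (2 ^ B - 1) v (List.replicate B false) _ (by
      have : 0 < 2 ^ B := by positivity
      rw [binVal_replicate_false, List.length_replicate]
      omega) (by
      rw [hv]
      simp [binVal_replicate_false, hB]) hready (by simp)
  have hcl : (fun k => if k ∈ (Finset.univ.erase Reg.res).toList then [] else s' k) =
      (update (fun _ => []) .res [.bit v] : Store (Reg m)) := by
    funext k
    by_cases hk : k = .res
    · subst hk
      simp [hs']
    · simp [hk]
  have hexp : ∀ a, n + a + 2 ^ a ≤ M → Exec M (expProg m)
      (update (update (fun _ => []) (.word false) w) .a1 (tick a))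
      (update (update (fun _ => []) (.word false) w) .a1 (tick (2 ^ a))) := by
    intro a h
    refine (exec_expProg (n := a) (by simp) (by simp) (by simp) ?_).of_eq (by simp)
    rw [ha]
    exact h
  refine Exec.seq (exec_countProg (w := w) (by simp) (by simp) (by simp) (by omega))
    (Exec.seq (hexp _ ?_) (Exec.seq (hexp _ ?_) (Exec.seq (hexp _ ?_)
    (Exec.seq ((Eq.subst (motive := fun t => Exec M _ t _) ?_
      (exec_fillProg (m := m) w B (by omega)))) (Exec.seq (exec_push (by omega)) (Exec.seq
      (exec_push ?_) (Exec.seq ?_ ((exec_clearList _ s').of_eq hcl.symm))))))))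
  · change n + n + expTower 1 n ≤ M
    omega
  · change n + expTower 1 n + expTower 2 n ≤ M
    omega
  · change n + expTower 2 n + B ≤ M
    omega
  · funext k
    rcases k with (_ | _) | _ | _ | _ | _ | _ | _ | _ | _ | _ | _ | _ <;>
      simp [fillStore, hB, expTower, hn]
  · rw [size_push]
    omega
  · refine Eq.subst (motive := fun t => Exec M _ t _) ?_ hex
    simp [fillStore]

/-- A first-order sentence with two words, universally quantified over the second word, which is
as long as the domain, defines a language in 3-EXPSPACE. -/
theorem mem_kEXPSPACE_of_formula (φ : Fm) (L : Language Sym)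
    (hL : ∀ w, w ∈ L ↔ ∀ l : List Bool, l.length = expTower 3 w.length →
      φ.Sat (wordModel (expTower 3 w.length) (expTower_pos 2 _) w l) fun _ => 0) :
    L ∈ kEXPSPACE 3 := by
  classical
  -- Enlarging the argument by `c` multiplies the triple exponential by at least `2 ^ c`, which
  -- exceeds the constant factor `c = φ.depth + 12`.
  refine ⟨Polynomial.X + Polynomial.C (φ.depth + 12), ?_⟩
  refine mem_DSPACE_of_exec (decideProg φ.depth φ) (.word false) .res L _ ?_ ?_
  · intro n
    simp only [Polynomial.eval_add, Polynomial.eval_X, Polynomial.eval_C]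
    have : n + (φ.depth + 12) < expTower 3 (n + (φ.depth + 12)) := lt_expTower 2 _
    omega
  · intro w
    refine ⟨decide (w ∈ L), by simp, exec_decideProg φ (by omega) w ?_ _ (by simp [hL])⟩
    simp only [Polynomial.eval_add, Polynomial.eval_X, Polynomial.eval_C]
    calc expTower 3 w.length * (φ.depth + 12)
        ≤ expTower 3 w.length * 2 ^ (φ.depth + 12) :=
          Nat.mul_le_mul_left _ Nat.lt_two_pow_self.le
      _ = 2 ^ (expTower 2 w.length + (φ.depth + 12)) := (pow_add 2 _ _).symm
      _ ≤ expTower 3 (w.length + (φ.depth + 12)) :=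
          Nat.pow_le_pow_right (by norm_num) (expTower_add_le _ _ _)

end Main

end StackProgram

/-! ### Games in which one player knows everything the other one knows -/

namespace HierarchicalGame

/-- In a state `s`, two bits are chosen; the first player sees the first bit and the second
player sees both; they play `σ` and `τ` of what they have seen (oldest first), and
the next state satisfies `Step`. The strategies win from `s` if the play is sure to end, before a
state with `Bad` is reached. -/
inductive Wins {S A₀ A₁ : Type} (Step : S → Bool → Bool → A₀ → A₁ → S → Prop) (Bad : S → Prop) :
    (List Bool → A₀) → (List (Bool × Bool) → A₁) → S → Prop
  | intro {σ : List Bool → A₀} {τ : List (Bool × Bool) → A₁} {s : S} (hbad : ¬ Bad s)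
      (h : ∀ h₀ h₁ s', Step s h₀ h₁ (σ [h₀]) (τ [(h₀, h₁)]) s' →
        Wins Step Bad (fun l => σ (h₀ :: l)) (fun l => τ ((h₀, h₁) :: l)) s') :
      Wins Step Bad σ τ s

variable {S A₀ A₁ : Type} {Step : S → Bool → Bool → A₀ → A₁ → S → Prop} {Bad : S → Prop}

/-- The strategies win in fewer than `n` rounds. -/
def WinsIn (Step : S → Bool → Bool → A₀ → A₁ → S → Prop) (Bad : S → Prop) :
    ℕ → (List Bool → A₀) → (List (Bool × Bool) → A₁) → S → Prop
  | 0, _, _, _ => False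
  | n + 1, σ, τ, s => ¬ Bad s ∧ ∀ h₀ h₁ s', Step s h₀ h₁ (σ [h₀]) (τ [(h₀, h₁)]) s' →
      WinsIn Step Bad n (fun l => σ (h₀ :: l)) (fun l => τ ((h₀, h₁) :: l)) s'

theorem WinsIn.mono {n k : ℕ} (hnk : n ≤ k) {σ : List Bool → A₀} {τ : List (Bool × Bool) → A₁}
    {s : S} (h : WinsIn Step Bad n σ τ s) : WinsIn Step Bad k σ τ s := by
  induction n generalizing k σ τ s with
  | zero => exact h.elim
  | succ n ih =>
    obtain ⟨k, rfl⟩ : ∃ j, k = j + 1 := ⟨k - 1, by omega⟩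
    exact ⟨h.1, fun h₀ h₁ s' hs => ih (by omega) (h.2 h₀ h₁ s' hs)⟩

/-- A move is made only after an observation, so the values of strategies at the empty history are
irrelevant. This allows strategies to be glued with an arbitrary default there. -/
theorem Wins.congr {σ σ' : List Bool → A₀} {τ τ' : List (Bool × Bool) → A₁} {s : S}
    (h : Wins Step Bad σ τ s) (hσ : ∀ l ≠ [], σ' l = σ l) (hτ : ∀ l ≠ [], τ' l = τ l) :
    Wins Step Bad σ' τ' s := by
  induction h generalizing σ' τ' with
  | @intro σ τ s hbad _ ih =>
    refine .intro hbad fun h₀ h₁ s' hs => ?_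
    rw [hσ _ (by simp), hτ _ (by simp)] at hs
    exact ih h₀ h₁ s' hs (fun l _ => hσ _ (by simp)) fun l _ => hτ _ (by simp)

/-- A round has finitely many outcomes, since successor states are below `N`. So the bounds for the
subtrees have a maximum: a well-founded finitely branching tree has finite height. -/
theorem Wins.exists_winsIn {Step : ℕ → Bool → Bool → A₀ → A₁ → ℕ → Prop} {Bad : ℕ → Prop} {N : ℕ}
    (hN : ∀ s h₀ h₁ y₀ y₁ s', Step s h₀ h₁ y₀ y₁ s' → s' < N)
    {σ : List Bool → A₀} {τ : List (Bool × Bool) → A₁} {s : ℕ} (h : Wins Step Bad σ τ s) :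
    ∃ n, WinsIn Step Bad n σ τ s := by
  induction h with
  | @intro σ τ s hbad _ ih =>
    have : ∀ p : Bool × Bool × Fin N, ∃ n, Step s p.1 p.2.1 (σ [p.1]) (τ [(p.1, p.2.1)]) p.2.2 →
        WinsIn Step Bad n (fun l => σ (p.1 :: l)) (fun l => τ ((p.1, p.2.1) :: l)) p.2.2 := by
      intro p
      by_cases hp : Step s p.1 p.2.1 (σ [p.1]) (τ [(p.1, p.2.1)]) p.2.2
      · obtain ⟨n, hn⟩ := ih _ _ _ hp
        exact ⟨n, fun _ => hn⟩
      · exact ⟨0, fun h => (hp h).elim⟩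
    choose f hf using this
    refine ⟨Finset.univ.sup f + 1, hbad, fun h₀ h₁ s' hs => ?_⟩
    exact (hf (h₀, h₁, ⟨s', hN _ _ _ _ _ _ hs⟩) hs).mono
      (Finset.le_sup (f := f) (Finset.mem_univ _))

/-- The set with code `F` of codes of sets of states is winning for trivial reasons, or can
be reduced in one round to a set with a code in `T`. -/
def Reducible (B : ℕ) (Step : ℕ → Bool → Bool → ℕ → ℕ → ℕ → Prop) (Bad : ℕ → Prop) (T : ℕ → Prop)
    (F : ℕ) : Prop :=
  (∀ K < B, F.testBit K = true → ∀ s < B, ¬ K.testBit s = true) ∨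
  ((∀ K < B, F.testBit K = true → ∀ s < B, K.testBit s = true → ¬ Bad s) ∧
    ∀ h₀ : Bool, ∃ y₀ < B, ∃ F' < B, T F' ∧ ∀ K < B, F.testBit K = true →
      ∀ h₁ : Bool, ∃ y₁ < B, ∃ K' < B, F'.testBit K' = true ∧
        ∀ s < B, K.testBit s = true → ∀ s' < B, Step s h₀ h₁ y₀ y₁ s' → K'.testBit s' = true)

theorem exists_testBit (P : ℕ → Prop) (m : ℕ) :
    ∃ k < 2 ^ m, ∀ i, k.testBit i = true ↔ i < m ∧ P i := by
  classical
  refine ⟨Nat.ofBits fun i : Fin m => decide (P i), Nat.ofBits_lt_two_pow _, fun i => ?_⟩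
  by_cases hi : i < m
  · simp [Nat.testBit_ofBits_lt _ _ hi, hi]
  · simp [Nat.testBit_ofBits_ge _ _ (not_lt.1 hi), hi]

theorem lt_of_testBit {k i : ℕ} (h : k.testBit i = true) : i < k :=
  Nat.lt_two_pow_self.trans_le (Nat.ge_two_pow_of_testBit h)

/-- The right-hand side says that the least set closed under `Reducible` contains a suitable family.
Sets of states have codes below `2 ^ N` and families of such sets have codes below `2 ^ 2 ^ N ≤ B`,
so `B` bounds all the objects involved.

For necessity, each `σ` and `n` determine the family of all sets from which some `τ` wins together
with `σ` in fewer than `n` rounds; these families lie in every closed `T`, by induction on `n`. For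
sufficiency, the families for which a uniform `σ` exists, with `τ` depending on the member, form a
closed set, to which the hypothesis is applied. -/
theorem exists_wins_iff {B N : ℕ} {Step : ℕ → Bool → Bool → ℕ → ℕ → ℕ → Prop} {Bad : ℕ → Prop}
    (hN : ∀ s h₀ h₁ y₀ y₁ s', Step s h₀ h₁ y₀ y₁ s' → s' < N) (hB : 2 ^ 2 ^ N ≤ B) {s₀ : ℕ}
    (hs₀ : s₀ < N) :
    (∃ σ τ, (∀ l, σ l < B) ∧ (∀ l, τ l < B) ∧ Wins Step Bad σ τ s₀) ↔
      ∀ T : ℕ → Prop, (∀ x, T x → x < B) → (∀ F < B, Reducible B Step Bad T F → T F) →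
        ∃ F < B, T F ∧ ∃ K < B, F.testBit K = true ∧ K.testBit s₀ = true := by
  have h1 : N < 2 ^ N := Nat.lt_two_pow_self
  have h2 : 2 ^ N < 2 ^ 2 ^ N := Nat.lt_two_pow_self
  constructor
  · rintro ⟨σ, τ, hσ, hτ, hw⟩ T - hT
    -- Taking all sets `K` for which a `τ` exists makes the family depend on `σ` and `n` alone, as
    -- required of what `W_0` knows.
    have canon : ∀ (n : ℕ) (σ : List Bool → ℕ), ∃ F < B, ∀ K, F.testBit K = true ↔ K < 2 ^ N ∧
        ∃ τ, (∀ l, τ l < B) ∧ ∀ s, K.testBit s = true → WinsIn Step Bad n σ τ s := by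
      intro n σ
      obtain ⟨F, hF, hF'⟩ := exists_testBit
        (fun K => ∃ τ, (∀ l, τ l < B) ∧ ∀ s, K.testBit s = true → WinsIn Step Bad n σ τ s) (2 ^ N)
      exact ⟨F, by omega, hF'⟩
    have key : ∀ (n : ℕ) (σ : List Bool → ℕ), (∀ l, σ l < B) → ∃ F < B, T F ∧
        ∀ K, F.testBit K = true ↔ K < 2 ^ N ∧
        ∃ τ, (∀ l, τ l < B) ∧ ∀ s, K.testBit s = true → WinsIn Step Bad n σ τ s := by
      intro n
      induction n with
      | zero =>
        intro σ _
        obtain ⟨F, hF, hF'⟩ := canon 0 σ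
        refine ⟨F, hF, hT F hF (.inl fun K _ hK s _ hs => ?_), hF'⟩
        obtain ⟨-, τ, -, h⟩ := (hF' K).1 hK
        exact h s hs
      | succ n ih =>
        intro σ hσ
        obtain ⟨F, hF, hF'⟩ := canon (n + 1) σ
        refine ⟨F, hF, hT F hF (.inr ⟨fun K _ hK s _ hs => ?_, fun h₀ => ?_⟩), hF'⟩
        · obtain ⟨-, τ, -, h⟩ := (hF' K).1 hK
          exact (h s hs).1
        · obtain ⟨F₁, hF₁, hTF₁, hF₁'⟩ := ih (fun l => σ (h₀ :: l)) fun l => hσ _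
          refine ⟨σ [h₀], hσ _, F₁, hF₁, hTF₁, fun K _ hK h₁ => ?_⟩
          obtain ⟨-, τ, hτ, h⟩ := (hF' K).1 hK
          -- The states that `W_1` considers possible after the round; the rest of `τ` wins from all
          -- of them.
          obtain ⟨K', hK', hK''⟩ := exists_testBit
            (fun s' => ∃ s, K.testBit s = true ∧ Step s h₀ h₁ (σ [h₀]) (τ [(h₀, h₁)]) s') N
          refine ⟨τ [(h₀, h₁)], hτ _, K', by omega, (hF₁' K').2 ⟨hK',
            fun l => τ ((h₀, h₁) :: l), fun l => hτ _, fun s' hs' => ?_⟩, fun s _ hs s' _ hst => ?_⟩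
          · obtain ⟨-, s, hs, hst⟩ := (hK'' s').1 hs'
            exact (h s hs).2 _ _ _ hst
          · exact (hK'' s').2 ⟨hN _ _ _ _ _ _ hst, s, hs, hst⟩
    obtain ⟨n, hn⟩ := hw.exists_winsIn hN
    obtain ⟨F, hF, hTF, hF'⟩ := key n σ hσ
    obtain ⟨K, hK, hK'⟩ := exists_testBit (fun s => s = s₀) N
    refine ⟨F, hF, hTF, K, by omega, (hF' K).2 ⟨hK, τ, hτ, fun s hs => ?_⟩, (hK' s₀).2 ⟨hs₀, rfl⟩⟩
    obtain ⟨-, rfl⟩ := (hK' s).1 hs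
    exact hn
  · intro H
    have hB0 : 0 < B := by omega
    -- The semantically good families, to be shown closed under `Reducible`.
    obtain ⟨T, hT⟩ : ∃ T : ℕ → Prop, ∀ F, T F ↔ F < B ∧ ∃ σ, (∀ l, σ l < B) ∧ ∀ K,
        F.testBit K = true → ∃ τ, (∀ l, τ l < B) ∧ ∀ s, K.testBit s = true →
          Wins Step Bad σ τ s := ⟨_, fun _ => Iff.rfl⟩
    have key : ∀ F < B, Reducible B Step Bad T F → ∃ σ, (∀ l, σ l < B) ∧
        ∀ K, F.testBit K = true → ∃ τ, (∀ l, τ l < B) ∧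
          ∀ s, K.testBit s = true → Wins Step Bad σ τ s := by
      intro F hF hred
      rcases hred with hred | ⟨hbad, hred⟩
      · refine ⟨fun _ => 0, fun _ => hB0, fun K hK => ⟨fun _ => 0, fun _ => hB0, fun s hs => ?_⟩⟩
        have hKF := lt_of_testBit hK
        have hsK := lt_of_testBit hs
        exact (hred K (by omega) hK s (by omega) hs).elim
      · choose y₀ hy₀ F' hF' hT' hred using hred
        simp only [hT] at hT'
        choose hF'' σ' hσ' hw using hT'
        -- The first move followed by the strategy chosen for the family `F' h₀`. It must not depend
        -- on `K` or `h₁`, which only the second player knows.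
        refine ⟨fun l => match l with | [] => 0 | h₀ :: l => if l = [] then y₀ h₀ else σ' h₀ l,
          ?_, fun K hK => ?_⟩
        · intro l
          rcases l with _ | ⟨h₀, l⟩
          · exact hB0
          · dsimp only
            split_ifs
            · exact hy₀ h₀
            · exact hσ' h₀ l
        have hKF := lt_of_testBit hK
        have hred' := fun h₀ => hred h₀ K (by omega) hK
        choose y₁ hy₁ K' hK' hKF' hst using hred'
        have hw' := fun h₀ h₁ => hw h₀ (K' h₀ h₁) (hKF' h₀ h₁)
        choose τ' hτ' hw' using hw'
        refine ⟨fun l => match l with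
          | [] => 0
          | p :: l => if l = [] then y₁ p.1 p.2 else τ' p.1 p.2 l, ?_, fun s hs => ?_⟩
        · intro l
          rcases l with _ | ⟨p, l⟩
          · exact hB0
          · dsimp only
            split_ifs
            · exact hy₁ _ _
            · exact hτ' _ _ l
        have hsK := lt_of_testBit hs
        refine .intro (hbad K (by omega) hK s (by omega) hs) fun h₀ h₁ s' hs' => ?_
        have := hw' h₀ h₁ s' (hst h₀ h₁ s (by omega) hs s' ((hN _ _ _ _ _ _ hs').trans (by omega))
          (by simpa using hs'))
        refine this.congr (fun l hl => ?_) (fun l hl => ?_)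
        · simp [hl]
        · simp [hl]
    obtain ⟨F, -, hTF, K, -, hFK, hK⟩ := H T (fun x hx => ((hT x).1 hx).1)
      (fun F hF hred => (hT F).2 ⟨hF, key F hF hred⟩)
    obtain ⟨-, σ, hσ, h⟩ := (hT F).1 hTF
    obtain ⟨τ, hτ, hw⟩ := h K hFK
    exact ⟨σ, τ, hσ, hτ, hw s₀ hK⟩

end HierarchicalGame

/-! ### The Team Formula Game as a hierarchical game -/

namespace TeamFormula

open HierarchicalGame

/-- The values of `X'`, `Y_0` and `Y_1`, between two rounds. -/
abbrev TFG.Pos (I : TFG) : Type := (Fin I.nX' → Bool) × (∀ i, Fin (I.nY i) → Bool)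

/-- A round in which nobody wins. -/
def TFG.Step (I : TFG) (s : I.Pos) (h₀ h₁ : Bool) (y₀ : Fin (I.nY 0) → Bool)
    (y₁ : Fin (I.nY 1) → Bool) (s' : I.Pos) : Prop :=
  ∃ x, I.evalF x s.1 s.2 = true ∧ I.evalF' x s'.1 = true ∧ x (I.h 0) = h₀ ∧ x (I.h 1) = h₁ ∧
    s'.2 0 = y₀ ∧ s'.2 1 = y₁

/-- Black can win at once. -/
def TFG.Bad (I : TFG) (s : I.Pos) : Prop :=
  ∃ x, I.evalF x s.1 s.2 = true ∧ I.evalG x = true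

/-- The strategy of `W_0` that remains after the rounds `r`, the most recent one first. -/
def residual₀ {A : Type} (σ : List Bool → A) (r : List (Bool × Bool)) : List Bool → A :=
  fun l => σ ((r.map Prod.fst).reverse ++ l)

/-- The strategy of `W_1` that remains after the rounds `r`, the most recent one first. -/
def residual₁ {A : Type} (τ : List (Bool × Bool) → A) (r : List (Bool × Bool)) :
    List (Bool × Bool) → A :=
  fun l => τ (r.reverse ++ l)

theorem residual₀_cons {A : Type} (σ : List Bool → A) (r : List (Bool × Bool)) (p : Bool × Bool) :
    (fun l => residual₀ σ r (p.1 :: l)) = residual₀ σ (p :: r) := by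
  funext l
  simp [residual₀]

theorem residual₁_cons {A : Type} (τ : List (Bool × Bool) → A) (r : List (Bool × Bool))
    (p : Bool × Bool) : (fun l => residual₁ τ r (p :: l)) = residual₁ τ (p :: r) := by
  funext l
  simp [residual₁]

theorem ofFn_eq_nil {n : ℕ} (h : n = 0) (f : Fin n → Bool) : List.ofFn f = [] :=
  List.eq_nil_of_length_eq_zero (by simp [h])

section Bits

variable {P : Policy} (hP : P.IsMidOneWay) (t : ℕ)
include hP

theorem Policy.IsMidOneWay.midBits_zero : P.midBits t 0 = 1 := by
  simp [Policy.midBits, (hP _).1]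

theorem Policy.IsMidOneWay.midBits_one : P.midBits t 1 = 0 := by
  simp [Policy.midBits, (hP _).1]

theorem Policy.IsMidOneWay.finBits (i : Fin 2) : P.finBits t i = 0 := by
  simp [Policy.finBits, (hP _).2]

end Bits

section Soundness

variable {I : TFG} {P : Policy} (S : ∀ i, Strategy I P i)

/-- What `W_0` has observed in the rounds `r`. -/
def obs₀ (r : List (Bool × Bool)) : List RoundObs := r.map fun p => ⟨p.1, [], []⟩

/-- The message of `W_0`. -/
def message (r : List (Bool × Bool)) (h : Bool) : List Bool := List.ofFn ((S 0).midMsg (obs₀ r) h)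

theorem ofFn_midMsg {o : List RoundObs} {r : List (Bool × Bool)} (ho : o = obs₀ r) (h : Bool) :
    List.ofFn ((S 0).midMsg o h) = message S r h := by
  rw [ho, message]

/-- What `W_1` has observed in the rounds `r`. -/
def obs₁ : List (Bool × Bool) → List RoundObs
  | [] => []
  | p :: r => ⟨p.2, message S r p.1, []⟩ :: obs₁ r

/-- The strategy of `W_0` as a function of the values of `h_0`. -/
def strat₀ (l : List Bool) : Fin (I.nY 0) → Bool :=
  match l.reverse with
  | [] => fun _ => false
  | h :: r => (S 0).move (r.map fun h => ⟨h, [], []⟩) h []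

/-- The strategy of `W_1` as a function of the values of `h_0` and `h_1`. -/
def strat₁ (l : List (Bool × Bool)) : Fin (I.nY 1) → Bool :=
  match l.reverse with
  | [] => fun _ => false
  | p :: r => (S 1).move (obs₁ S r) p.2 (message S r p.1)

/-- The configuration `c` is reached in the rounds `r` and its position is `s`. -/
structure Config.Matches (c : Config I) (r : List (Bool × Bool)) (s : I.Pos) : Prop where
  x' : c.x' = s.1
  y : c.y = s.2
  obs₀ : c.obs 0 = obs₀ r
  obs₁ : c.obs 1 = obs₁ S r

/-- As `W_0` receives no bits, its messages are functions of the history of `h_0`. Hence all that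
`W_1` observes is determined by the histories of `h_0` and `h_1`, and the given strategies act as
`strat₀` and `strat₁`. -/
theorem Config.Matches.next (hP : P.IsMidOneWay) {c : Config I} {r : List (Bool × Bool)}
    {s : I.Pos} (h : c.Matches S r s) (x : Fin I.nX → Bool) (s' : I.Pos)
    (h0 : s'.2 0 = residual₀ (strat₀ S) r [x (I.h 0)])
    (h1 : s'.2 1 = residual₁ (strat₁ S) r [(x (I.h 0), x (I.h 1))]) :
    (c.next S x s'.1).Matches S ((x (I.h 0), x (I.h 1)) :: r) s' where
  x' := rfl
  y := by
    funext i
    match i with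
    | 0 =>
      rw [h0]
      simp only [Config.next, residual₀, strat₀, h.obs₀]
      have e : ((r.map Prod.fst).reverse ++ [x (I.h 0)]).reverse = x (I.h 0) :: r.map Prod.fst := by
        simp
      rw [e]
      simp only [List.map_map, sub_zero]
      rw [ofFn_eq_nil (hP.midBits_one _)]
      rfl
    | 1 =>
      rw [h1]
      change (S 1).move (c.obs 1) (x (I.h 1)) (List.ofFn ((S 0).midMsg (c.obs 0) (x (I.h 0)))) = _
      simp only [residual₁, strat₁, h.obs₁, ofFn_midMsg S h.obs₀]
      have e : (r.reverse ++ [(x (I.h 0), x (I.h 1))]).reverse = (x (I.h 0), x (I.h 1)) :: r := by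
        simp
      rw [e]
  obs₀ := by
    simp only [Config.next, sub_zero]
    rw [ofFn_eq_nil (hP.midBits_one _), ofFn_eq_nil (hP.finBits _ _), h.obs₀]
    rfl
  obs₁ := by
    change ⟨x (I.h 1), List.ofFn ((S 0).midMsg (c.obs 0) (x (I.h 0))), List.ofFn _⟩ :: c.obs 1 = _
    rw [ofFn_midMsg S h.obs₀, ofFn_eq_nil (hP.finBits _ _), h.obs₁]
    rfl

/-- Contraposition: in a position that is not won, Black either wins at once or can move to another
one that is not won. Following such moves forever, or up to the win of Black, yields a play that
White does not win. -/
theorem wins_of_whiteForcedWin (hP : P.IsMidOneWay)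
    (hS : ∀ b : ℕ → (Fin I.nX → Bool) × (Fin I.nX' → Bool),
      ∃ t, (play S b t).WhiteWins (b t).1 (b t).2 ∧ ∀ s < t, ¬ (play S b s).BlackWins (b s).1) :
    Wins I.Step I.Bad (strat₀ S) (strat₁ S) (I.initX', I.initY) := by
  by_contra hnot
  set NW : List (Bool × Bool) × I.Pos → Prop := fun q =>
    ¬ Wins I.Step I.Bad (residual₀ (strat₀ S) q.1) (residual₁ (strat₁ S) q.1) q.2 with hNW
  -- Stated for all `q`, with `NW q` as a premise, so that choice gives a total function that can be
  -- iterated.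
  have hstep : ∀ q : List (Bool × Bool) × I.Pos, ∃ (x : Fin I.nX → Bool)
      (q' : List (Bool × Bool) × I.Pos), NW q → I.evalF x q.2.1 q.2.2 = true ∧
        (I.evalG x = true ∨ (NW q' ∧ I.evalF' x q'.2.1 = true ∧
          q'.1 = (x (I.h 0), x (I.h 1)) :: q.1 ∧
          q'.2.2 0 = residual₀ (strat₀ S) q.1 [x (I.h 0)] ∧
          q'.2.2 1 = residual₁ (strat₁ S) q.1 [(x (I.h 0), x (I.h 1))])) := by
    intro q
    by_cases hq : NW q
    · by_contra hcon
      push Not at hcon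
      refine hq (.intro ?_ ?_)
      · rintro ⟨x, hx, hG⟩
        obtain ⟨-, h⟩ := hcon x q
        exact (h hx).1 hG
      · rintro h₀ h₁ s' ⟨x, hx, hF', rfl, rfl, h0, h1⟩
        obtain ⟨-, h⟩ := hcon x ((x (I.h 0), x (I.h 1)) :: q.1, s')
        by_contra hw
        refine (h hx).2 ?_ hF' rfl h0 h1
        simp only [hNW]
        rwa [← residual₀_cons, ← residual₁_cons]
    · exact ⟨I.initX, q, fun h => (hq h).elim⟩
  choose x f hf using hstep
  let q : ℕ → List (Bool × Bool) × I.Pos := fun t => f^[t] ([], (I.initX', I.initY))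
  have hq : ∀ t, q (t + 1) = f (q t) := fun t => Function.iterate_succ_apply' _ _ _
  obtain ⟨t, hw, hb⟩ := hS fun t => (x (q t), (q (t + 1)).2.1)
  set b : ℕ → (Fin I.nX → Bool) × (Fin I.nX' → Bool) := fun t => (x (q t), (q (t + 1)).2.1)
  have key : ∀ u ≤ t, NW (q u) ∧ (play S b u).Matches S (q u).1 (q u).2 := by
    intro u
    induction u with
    | zero => exact fun _ => ⟨hnot, ⟨rfl, rfl, rfl, rfl⟩⟩
    | succ u ih =>
      intro hu
      obtain ⟨h1, h2⟩ := ih (by omega)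
      obtain ⟨hF, hG⟩ := hf (q u) h1
      rcases hG with hG | ⟨h3, h4, h5, h6, h7⟩
      · refine (hb u (by omega) ⟨?_, hG⟩).elim
        rw [h2.x', h2.y]
        exact hF
      · rw [hq]
        refine ⟨h3, ?_⟩
        rw [h5]
        have := h2.next S hP (x (q u)) (f (q u)).2 h6 h7
        rw [← hq] at this ⊢
        exact this
  obtain ⟨h1, h2⟩ := key t le_rfl
  obtain ⟨hF, hG⟩ := hf (q t) h1
  rcases hw with hw | ⟨hw, hw'⟩
  · rw [h2.x', h2.y] at hw
    exact absurd (hF.symm.trans hw) (by simp)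
  · rcases hG with hG | ⟨h3, h4, h5, h6, h7⟩
    · refine hw ⟨?_, hG⟩
      rw [h2.x', h2.y]
      exact hF
    · have : (b t).2 = (f (q t)).2.1 := by rw [← hq]
      rw [this] at hw'
      exact absurd (h4.symm.trans hw') (by simp)

end Soundness

section Completeness

variable {I : TFG} (P : Policy) (σ : List Bool → Fin (I.nY 0) → Bool)
  (τ : List (Bool × Bool) → Fin (I.nY 1) → Bool)

/-- The strategies in which `W_0` tells `W_1` the value of `h_0`. -/
def tellingStrategy : ∀ i, Strategy I P i
  | 0 =>
    { midMsg := fun _ h _ => h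
      move := fun past h _ => σ (h :: past.map RoundObs.h).reverse
      finMsg := fun _ _ _ _ => false }
  | 1 =>
    { midMsg := fun _ _ _ => false
      move := fun past h recv => τ ((recv.headD false, h) ::
        past.map fun o => (o.midRecv.headD false, o.h)).reverse
      finMsg := fun _ _ _ _ => false }

/-- The message of `tellingStrategy` is `h_0` itself, so `W_1` can recover the whole history `r`
from its observations and play `τ`. Induction on `Wins` follows the play for as long as nobody has
won. -/
theorem whiteWins_of_wins (hP : P.IsMidOneWay)
    (b : ℕ → (Fin I.nX → Bool) × (Fin I.nX' → Bool)) {σ' : List Bool → Fin (I.nY 0) → Bool}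
    {τ' : List (Bool × Bool) → Fin (I.nY 1) → Bool} {s : I.Pos}
    (h : Wins I.Step I.Bad σ' τ' s) (r : List (Bool × Bool)) (t : ℕ)
    (hσ : σ' = residual₀ σ r) (hτ : τ' = residual₁ τ r)
    (hx' : (play (tellingStrategy P σ τ) b t).x' = s.1)
    (hy : (play (tellingStrategy P σ τ) b t).y = s.2)
    (h0 : ((play (tellingStrategy P σ τ) b t).obs 0).map RoundObs.h = r.map Prod.fst)
    (h1 : ((play (tellingStrategy P σ τ) b t).obs 1).map
      (fun o => (o.midRecv.headD false, o.h)) = r) :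
    ∃ u ≥ t, (play (tellingStrategy P σ τ) b u).WhiteWins (b u).1 (b u).2 ∧
      ∀ v, t ≤ v → v < u → ¬ (play (tellingStrategy P σ τ) b v).BlackWins (b v).1 := by
  induction h generalizing r t with
  | @intro σ' τ' s hbad _ ih =>
    have hblack : ¬ (play (tellingStrategy P σ τ) b t).BlackWins (b t).1 := by
      rintro ⟨hF, hG⟩
      rw [hx', hy] at hF
      exact hbad ⟨_, hF, hG⟩
    by_cases hF : I.evalF (b t).1 (play (tellingStrategy P σ τ) b t).x'
      (play (tellingStrategy P σ τ) b t).y = false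
    · exact ⟨t, le_rfl, .inl hF, fun v _ _ => by omega⟩
    by_cases hF' : I.evalF' (b t).1 (b t).2 = false
    · exact ⟨t, le_rfl, .inr ⟨hblack, hF'⟩, fun v _ _ => by omega⟩
    rw [Bool.not_eq_false] at hF hF'
    rw [hx', hy] at hF
    have e : play (tellingStrategy P σ τ) b (t + 1) =
      (play (tellingStrategy P σ τ) b t).next (tellingStrategy P σ τ) (b t).1 (b t).2 := rfl
    have emsg : ∀ past h, List.ofFn ((tellingStrategy P σ τ 0).midMsg past h) = [h] := by
      intro past h
      have : (tellingStrategy P σ τ 0).midMsg past h = fun _ => h := rfl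
      rw [this, List.ofFn_const, hP.midBits_zero]
      rfl
    have emsg1 : List.ofFn ((tellingStrategy P σ τ (1 - 1)).midMsg
        ((play (tellingStrategy P σ τ) b t).obs (1 - 1)) ((b t).1 (I.h (1 - 1)))) =
          [(b t).1 (I.h 0)] := emsg _ _
    have emove0 : ∀ past h recv, (tellingStrategy P σ τ 0).move past h recv =
        σ (h :: past.map RoundObs.h).reverse := fun _ _ _ => rfl
    have emove1 : ∀ past h recv, (tellingStrategy P σ τ 1).move past h recv =
        τ ((recv.headD false, h) ::
          past.map fun o => (o.midRecv.headD false, o.h)).reverse := fun _ _ _ => rfl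
    have a0 : (play (tellingStrategy P σ τ) b (t + 1)).y 0 = σ' [(b t).1 (I.h 0)] := by
      simp only [e, Config.next, emove0, h0, hσ, residual₀, List.reverse_cons]
    have a1 : (play (tellingStrategy P σ τ) b (t + 1)).y 1 =
        τ' [((b t).1 (I.h 0), (b t).1 (I.h 1))] := by
      simp only [e, Config.next, emove1, h1, hτ, residual₁, List.reverse_cons, emsg1,
        List.headD_cons]
    have o0 : ((play (tellingStrategy P σ τ) b (t + 1)).obs 0).map RoundObs.h =
        (((b t).1 (I.h 0), (b t).1 (I.h 1)) :: r).map Prod.fst := by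
      simp only [e, Config.next, List.map_cons, h0]
    have o1 : ((play (tellingStrategy P σ τ) b (t + 1)).obs 1).map
        (fun o => (o.midRecv.headD false, o.h)) =
          ((b t).1 (I.h 0), (b t).1 (I.h 1)) :: r := by
      simp only [e, Config.next, List.map_cons, h1, emsg1, List.headD_cons]
    obtain ⟨u, hu, hw, hb⟩ := ih ((b t).1 (I.h 0)) ((b t).1 (I.h 1))
      ((b t).2, (play (tellingStrategy P σ τ) b (t + 1)).y) ⟨(b t).1, hF, hF', rfl, rfl, a0, a1⟩
      (((b t).1 (I.h 0), (b t).1 (I.h 1)) :: r) (t + 1)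
      (by rw [hσ]; exact residual₀_cons σ r ((b t).1 (I.h 0), (b t).1 (I.h 1)))
      (by rw [hτ]; exact residual₁_cons τ r _) rfl rfl o0 o1
    refine ⟨u, by omega, hw, fun v hv hv' => ?_⟩
    rcases eq_or_lt_of_le hv with rfl | hv
    · exact hblack
    · exact hb v hv hv'

/-- The right-hand side is independent of `P`, which makes the decision procedure uniform in the
policy. -/
theorem whiteForcedWin_iff {P : Policy} (hP : P.IsMidOneWay) (I : TFG) :
    WhiteForcedWin I P ↔ ∃ σ τ, Wins I.Step I.Bad σ τ (I.initX', I.initY) := by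
  constructor
  · rintro ⟨S, hS⟩
    exact ⟨_, _, wins_of_whiteForcedWin S hP hS⟩
  · rintro ⟨σ, τ, h⟩
    refine ⟨tellingStrategy P σ τ, fun b => ?_⟩
    obtain ⟨t, -, hw, hb⟩ := whiteWins_of_wins P σ τ hP b h [] 0 rfl rfl rfl rfl rfl rfl
    exact ⟨t, hw, fun s hs => hb s (Nat.zero_le _) hs⟩

end Completeness

end TeamFormula

/-! ### Definable properties -/

namespace StackProgram

open TeamFormula

/-- The property `P` of streams is expressed by a first-order formula. -/
def IsDef (P : Model → (ℕ → ℕ) → Prop) : Prop :=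
  ∃ φ : Fm, ∀ (A : Model) (e : ℕ → ℕ), (∀ i, e i < A.B) → (φ.Sat A e ↔ P A e)

namespace IsDef

variable {P Q : Model → (ℕ → ℕ) → Prop}

theorem congr (h : IsDef P) (hPQ : ∀ A e, (∀ i, e i < A.B) → (P A e ↔ Q A e)) : IsDef Q := by
  obtain ⟨φ, hφ⟩ := h
  exact ⟨φ, fun A e he => (hφ A e he).trans (hPQ A e he)⟩

theorem not (h : IsDef P) : IsDef fun A e => ¬ P A e := by
  obtain ⟨φ, hφ⟩ := h
  exact ⟨.neg φ, fun A e he => not_congr (hφ A e he)⟩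

theorem and (h : IsDef P) (h' : IsDef Q) : IsDef fun A e => P A e ∧ Q A e := by
  obtain ⟨φ, hφ⟩ := h
  obtain ⟨ψ, hψ⟩ := h'
  exact ⟨.conj φ ψ, fun A e he => and_congr (hφ A e he) (hψ A e he)⟩

theorem or (h : IsDef P) (h' : IsDef Q) : IsDef fun A e => P A e ∨ Q A e :=
  (h.not.and h'.not).not.congr fun _ _ _ => by tauto

theorem imp (h : IsDef P) (h' : IsDef Q) : IsDef fun A e => P A e → Q A e :=
  (h.and h'.not).not.congr fun _ _ _ => by tauto

theorem iff (h : IsDef P) (h' : IsDef Q) : IsDef fun A e => P A e ↔ Q A e :=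
  ((h.imp h').and (h'.imp h)).congr fun _ _ _ => by tauto

theorem consEnv_lt {A : Model} {e : ℕ → ℕ} (he : ∀ i, e i < A.B) {x : ℕ} (hx : x < A.B) (i : ℕ) :
    consEnv x e i < A.B := by
  cases i with
  | zero => exact hx
  | succ i => exact he i

theorem ex {R : Model → (ℕ → ℕ) → ℕ → Prop} (h : IsDef fun A e => R A (fun i => e (i + 1)) (e 0)) :
    IsDef fun A e => ∃ x < A.B, R A e x := by
  obtain ⟨φ, hφ⟩ := h
  refine ⟨.ex φ, fun A e he => exists_congr fun x => and_congr_right fun hx => ?_⟩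
  exact hφ A _ (consEnv_lt he hx)

theorem all {R : Model → (ℕ → ℕ) → ℕ → Prop} (h : IsDef fun A e => R A (fun i => e (i + 1)) (e 0)) :
    IsDef fun A e => ∀ x < A.B, R A e x :=
  (ex (R := fun A e x => ¬ R A e x) h.not).not.congr fun A e _ => by
    push Not
    rfl

theorem add (i j k : ℕ) : IsDef fun _ e => e i + e j = e k := ⟨.add i j k, fun _ _ _ => Iff.rfl⟩

theorem bit (i j : ℕ) : IsDef fun _ e => (e i).testBit (e j) = true :=
  ⟨.bit i j, fun _ _ _ => Iff.rfl⟩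

theorem look (a : Bool) (c : Option Sym → Prop) (i : ℕ) : IsDef fun A e => c (A.word a)[e i]? := by
  classical
  exact ⟨.look a (fun o => decide (c o)) i, fun _ _ _ => decide_eq_true_iff⟩

theorem lookEq (a : Bool) (o : Option Sym) (i : ℕ) : IsDef fun A e => (A.word a)[e i]? = o :=
  look a (· = o) i

theorem triv : IsDef fun _ _ => True :=
  (add 0 0 0).or (add 0 0 0).not |>.congr fun _ _ _ => by tauto

theorem const (p : Prop) : IsDef fun _ _ => p := by
  by_cases h : p
  · exact triv.congr fun _ _ _ => by simp [h]
  · exact triv.not.congr fun _ _ _ => by simp [h]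

theorem bitEq (i j : ℕ) (v : Bool) : IsDef fun _ e => (e i).testBit (e j) = v := by
  cases v with
  | true => exact bit i j
  | false => exact (bit i j).not.congr fun _ _ _ => by simp

theorem le (i j : ℕ) : IsDef fun _ e => e i ≤ e j := by
  refine (ex (R := fun _ e z => e i + z = e j) (add (i + 1) 0 (j + 1))).congr fun A e he => ?_
  constructor
  · rintro ⟨z, -, hz⟩
    omega
  · intro h
    have := he j
    exact ⟨e j - e i, by omega, by omega⟩

theorem lt (i j : ℕ) : IsDef fun _ e => e i < e j :=
  (le j i).not.congr fun _ _ _ => not_le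

/-- Expressed through the order: `e j` is larger than `e i` and nothing lies strictly between them.
-/
theorem succ (i j : ℕ) : IsDef fun _ e => e i + 1 = e j := by
  refine ((lt i j).and (all (R := fun _ e z => z < e j → z ≤ e i)
    ((lt 0 (j + 1)).imp (le 0 (i + 1))))).congr fun A e he => ?_
  constructor
  · rintro ⟨h1, h2⟩
    have := he j
    have := h2 (e j - 1) (by omega) (by omega)
    omega
  · intro h
    exact ⟨by omega, fun z _ hz => by omega⟩

theorem exFinite {ι : Type} [Finite ι] {R : ι → Model → (ℕ → ℕ) → Prop} (h : ∀ i, IsDef (R i)) :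
    IsDef fun A e => ∃ i, R i A e := by
  classical
  have := Fintype.ofFinite ι
  have key : ∀ s : Finset ι, IsDef fun A e => ∃ i ∈ s, R i A e := by
    intro s
    induction s using Finset.induction_on with
    | empty => exact (const False).congr fun _ _ _ => by simp
    | insert i s _ ih => exact ((h i).or ih).congr fun _ _ _ => by simp
  exact (key Finset.univ).congr fun _ _ _ => by simp

theorem allFinite {ι : Type} [Finite ι] {R : ι → Model → (ℕ → ℕ) → Prop} (h : ∀ i, IsDef (R i)) :
    IsDef fun A e => ∀ i, R i A e :=
  (exFinite fun i => (h i).not).not.congr fun _ _ _ => by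
    push Not
    rfl

/-- Quantification over finitely many numbers. -/
theorem exStream (k : ℕ) (hP : IsDef P)
    (hk : ∀ A e e', (∀ i < k, e i = e' i) → (P A e ↔ P A e')) :
    IsDef fun A _ => ∃ p : ℕ → ℕ, (∀ i, p i < A.B) ∧ P A p := by
  induction k generalizing P with
  | zero =>
    -- Here `P` does not depend on the stream at all, so the given environment serves as a witness.
    refine hP.congr fun A e he => ⟨fun h => ⟨e, he, h⟩, ?_⟩
    rintro ⟨p, -, h⟩
    exact (hk A p e (by simp)).1 h
  | succ k ih =>
    have hcons : ∀ e : ℕ → ℕ, consEnv (e 0) (fun i => e (i + 1)) = e := by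
      intro e
      funext i
      cases i <;> rfl
    have h1 : IsDef fun A e => ∃ x < A.B, P A (consEnv x e) := by
      refine ex (R := fun A e x => P A (consEnv x e)) ?_
      simpa only [hcons] using hP
    refine (ih h1 fun A e e' he => exists_congr fun x => and_congr_right fun _ => hk A _ _ ?_).congr
      fun A e he => ?_
    · intro i hi
      cases i with
      | zero => rfl
      | succ i => exact he i (by omega)
    · constructor
      · rintro ⟨p, hp, x, hx, h⟩
        exact ⟨consEnv x p, consEnv_lt hp hx, h⟩
      · rintro ⟨p, hp, h⟩
        exact ⟨fun i => p (i + 1), fun i => hp _, p 0, hp 0, by rwa [hcons]⟩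

theorem allStream (k : ℕ) (hP : IsDef P)
    (hk : ∀ A e e', (∀ i < k, e i = e' i) → (P A e ↔ P A e')) :
    IsDef fun A _ => ∀ p : ℕ → ℕ, (∀ i, p i < A.B) → P A p :=
  (exStream k hP.not fun A e e' h => not_congr (hk A e e' h)).not.congr fun _ _ _ => by
    push Not
    rfl

end IsDef

end StackProgram

/-! ### Factors of words -/

namespace TeamFormula

/-- The word `l` stands in `w` from position `a` to position `b`. -/
def SegAt (w : List Sym) : ℕ → ℕ → List Sym → Prop
  | a, b, [] => a = b
  | a, b, x :: l => w[a]? = some x ∧ SegAt w (a + 1) b l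

variable {w : List Sym} {a b b' m j j' : ℕ} {l l' : List Sym}

theorem segAt_append : SegAt w a b (l ++ l') ↔ ∃ m, SegAt w a m l ∧ SegAt w m b l' := by
  induction l generalizing a with
  | nil => simp [SegAt]
  | cons x l ih => simp [SegAt, ih, and_assoc]

theorem SegAt.length_eq (h : SegAt w a b l) : a + l.length = b := by
  induction l generalizing a with
  | nil => exact h
  | cons x l ih =>
    have := ih h.2
    simp only [List.length_cons]
    omega

theorem SegAt.le_length (h : SegAt w a b l) (ha : a ≤ w.length) : b ≤ w.length := by
  induction l generalizing a with
  | nil => exact h ▸ ha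
  | cons x l ih => exact ih h.2 (List.getElem?_eq_some_iff.1 h.1).1

theorem segAt_iff_forall :
    SegAt w a b l ↔ a + l.length = b ∧ ∀ i < l.length, w[a + i]? = l[i]? := by
  induction l generalizing a with
  | nil => simp [SegAt]
  | cons x l ih =>
    rw [SegAt, ih, List.length_cons]
    constructor
    · rintro ⟨h1, h2, h3⟩
      refine ⟨by omega, fun i hi => ?_⟩
      rcases i with _ | i
      · simpa using h1
      · simpa [add_right_comm, add_assoc] using h3 i (by omega)
    · rintro ⟨h1, h2⟩
      refine ⟨by simpa using h2 0 (by omega), by omega, fun i hi => ?_⟩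
      simpa [add_right_comm, add_assoc] using h2 (i + 1) (by omega)

theorem segAt_self : SegAt w 0 w.length w := by
  simp [segAt_iff_forall]

theorem SegAt.eq (h : SegAt w 0 w.length l) : l = w := by
  rw [segAt_iff_forall] at h
  refine List.ext_getElem? fun i => ?_
  by_cases hi : i < l.length
  · simpa using (h.2 i hi).symm
  · rw [List.getElem?_eq_none (by omega), List.getElem?_eq_none (by omega)]

theorem segAt_encodeIndex : SegAt w a b (encodeIndex j) ↔
    a + j + 1 = b ∧ w[a + j]? = some .sep ∧ ∀ i, a ≤ i → i < a + j → w[i]? = some .tick := by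
  rw [segAt_iff_forall]
  simp only [encodeIndex, List.length_append, List.length_replicate, List.length_singleton,
    ← add_assoc]
  refine and_congr_right fun hb => ?_
  constructor
  · intro h
    refine ⟨by simpa using h j (by omega), fun i hi hij => ?_⟩
    have := h (i - a) (by omega)
    rwa [Nat.add_sub_cancel' hi, List.getElem?_append_left (by simp; omega),
      List.getElem?_replicate_of_lt (by omega)] at this
  · rintro ⟨h1, h2⟩ i hi
    rcases (Nat.lt_succ_iff.1 hi).eq_or_lt with rfl | hi
    · simpa using h1
    · rw [List.getElem?_append_left (by simp; omega), List.getElem?_replicate_of_lt (by omega)]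
      exact h2 _ (by omega) (by omega)

theorem segAt_encodeBits {n : ℕ} {v : Fin n → Bool} : SegAt w a b (encodeBits v) ↔
    a + n + 1 = b ∧ w[a + n]? = some .sep ∧ ∀ i : Fin n, w[a + i]? = some (.bit (v i)) := by
  rw [segAt_iff_forall]
  simp only [encodeBits, List.length_append, List.length_map, List.length_ofFn,
    List.length_singleton, ← add_assoc]
  refine and_congr_right fun hb => ?_
  constructor
  · intro h
    refine ⟨by simpa using h n (by omega), fun i => ?_⟩
    have := h i (by omega)
    rwa [List.getElem?_append_left (by simp), List.getElem?_map, List.getElem?_ofFn,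
      dif_pos i.2] at this
  · rintro ⟨h1, h2⟩ i hi
    rcases (Nat.lt_succ_iff.1 hi).eq_or_lt with rfl | hi
    · simpa using h1
    · rw [List.getElem?_append_left (by simpa using hi), List.getElem?_map, List.getElem?_ofFn,
        dif_pos hi]
      exact h2 ⟨i, hi⟩

theorem segAt_encodeIndex_inj (h : SegAt w a b (encodeIndex j))
    (h' : SegAt w a b' (encodeIndex j')) : j = j' ∧ b = b' := by
  rw [segAt_encodeIndex] at h h'
  rcases lt_trichotomy j j' with hj | rfl | hj
  · have := h'.2.2 (a + j) (by omega) (by omega)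
    simp [h.2.1] at this
  · exact ⟨rfl, by omega⟩
  · have := h.2.2 (a + j') (by omega) (by omega)
    simp [h'.2.1] at this

/-! ### Unique readability -/

/-- No word for a variable is a prefix of another one, and they do not start like the other
formulas. -/
structure IsVarCode {V : Type} (e : V → List Sym) : Prop where
  head : ∀ x, ∃ s l, e x = s :: l ∧ (∀ c, s ≠ .bit c) ∧ s ≠ .neg ∧ s ≠ .conj ∧ s ≠ .disj
  inj : ∀ {w a b b' x x'}, SegAt w a b (e x) → SegAt w a b' (e x') → x = x' ∧ b = b'

/-- Unique readability of prefix notation: the first symbol determines the outermost constructor,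
and the end of the first subformula, unique by induction, is the start of the second. -/
theorem BFormula.encode_inj {V : Type} {e : V → List Sym} (he : IsVarCode e) {f g : BFormula V}
    (hf : SegAt w a b (f.encode e)) (hg : SegAt w a b' (g.encode e)) : f = g ∧ b = b' := by
  have hvar : ∀ {x a b}, SegAt w a b (e x) → ∃ s, w[a]? = some s ∧
      (∀ c, s ≠ .bit c) ∧ s ≠ .neg ∧ s ≠ .conj ∧ s ≠ .disj := by
    intro x a b h
    obtain ⟨s, l, hs, hs'⟩ := he.head x
    rw [hs] at h
    exact ⟨s, h.1, hs'⟩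
  induction f generalizing a b b' g with
  | const c =>
    cases g with
    | var y =>
      obtain ⟨s, h, h'⟩ := hvar hg
      simp_all [encode, SegAt]
    | _ => simp_all [encode, SegAt]
  | var x =>
    cases g with
    | var y => simpa using he.inj hf hg
    | _ =>
      obtain ⟨s, h, h'⟩ := hvar hf
      simp_all [encode, SegAt]
  | neg f ih =>
    cases g with
    | var y =>
      obtain ⟨s, h, h'⟩ := hvar hg
      simp_all [encode, SegAt]
    | neg g => simpa using ih hf.2 hg.2
    | _ => simp_all [encode, SegAt]
  | conj f f' ih ih' =>
    cases g with
    | var y =>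
      obtain ⟨s, h, h'⟩ := hvar hg
      simp_all [encode, SegAt]
    | conj g g' =>
      obtain ⟨m, hf, hf'⟩ := segAt_append.1 hf.2
      obtain ⟨m', hg, hg'⟩ := segAt_append.1 hg.2
      obtain ⟨rfl, rfl⟩ := ih hf hg
      simpa using ih' hf' hg'
    | _ => simp_all [encode, SegAt]
  | disj f f' ih ih' =>
    cases g with
    | var y =>
      obtain ⟨s, h, h'⟩ := hvar hg
      simp_all [encode, SegAt]
    | disj g g' =>
      obtain ⟨m, hf, hf'⟩ := segAt_append.1 hf.2
      obtain ⟨m', hg, hg'⟩ := segAt_append.1 hg.2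
      obtain ⟨rfl, rfl⟩ := ih hf hg
      simpa using ih' hf' hg'
    | _ => simp_all [encode, SegAt]

theorem BFormula.lt_of_segAt {V : Type} {e : V → List Sym} (he : IsVarCode e) {f : BFormula V}
    (h : SegAt w a b (f.encode e)) : a < b := by
  have : (f.encode e).length ≠ 0 := by
    cases f with
    | var x =>
      obtain ⟨s, l, hs, -⟩ := he.head x
      simp [encode, hs]
    | _ => simp [encode]
  have := h.length_eq
  omega

theorem isVarCode_encodeX {n : ℕ} : IsVarCode (encodeX (n := n)) where
  head x := ⟨_, _, rfl, by simp⟩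
  inj h h' := by
    obtain ⟨h1, h2⟩ := segAt_encodeIndex_inj h.2 h'.2
    exact ⟨Fin.ext h1, h2⟩

theorem isVarCode_encodeXX' {n n' : ℕ} : IsVarCode (encodeXX' (n := n) (n' := n')) where
  head x := by
    rcases x with x | x
    · exact ⟨_, _, rfl, by simp⟩
    · exact ⟨_, _, rfl, by simp⟩
  inj := by
    rintro w a b b' (x | x) (y | y) h h'
    · simpa using isVarCode_encodeX.inj h h'
    · have := h.1.symm.trans h'.1
      simp at this
    · have := h.1.symm.trans h'.1
      simp at this
    · obtain ⟨h1, h2⟩ := segAt_encodeIndex_inj h.2 h'.2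
      exact ⟨by rw [Fin.ext h1], h2⟩

theorem isVarCode_encodeXX'Y {n n' : ℕ} {m : Fin 2 → ℕ} :
    IsVarCode (encodeXX'Y (n := n) (n' := n') (m := m)) where
  head x := by
    rcases x with x | ⟨i, x⟩
    · exact isVarCode_encodeXX'.head x
    · refine ⟨_, _, rfl, ?_⟩
      split_ifs <;> simp
  inj := by
    have hne : ∀ {w a b b'} {x : Fin n ⊕ Fin n'} {y : Σ i : Fin 2, Fin (m i)},
        SegAt w a b (encodeXX' x) → SegAt w a b' (encodeXX'Y (n := n) (n' := n') (.inr y)) →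
          False := by
      rintro w a b b' (x | x) ⟨i, y⟩ h h' <;>
      · have := h.1.symm.trans h'.1
        split_ifs at this <;> simp at this
    rintro w a b b' (x | ⟨i, x⟩) (y | ⟨i', y⟩) h h'
    · simpa using isVarCode_encodeXX'.inj h h'
    · exact (hne h h').elim
    · exact (hne h' h).elim
    · obtain ⟨h1, h2⟩ := segAt_encodeIndex_inj h.2 h'.2
      have : i = i' := by
        have := h.1.symm.trans h'.1
        revert this
        fin_cases i <;> fin_cases i' <;> simp
      subst this
      exact ⟨by rw [Fin.ext h1], h2⟩

end TeamFormula

/-! ### Definable notions of syntax -/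

namespace TeamFormula

open StackProgram HierarchicalGame

/-- The unary number `j` is written from `a` to `b`. -/
def IsIndex (B : ℕ) (w : List Sym) (a j b : ℕ) : Prop :=
  ∃ m < B, a + j = m ∧ m + 1 = b ∧ w[m]? = some .sep ∧
    ∀ i < B, a ≤ i → i < m → w[i]? = some .tick

/-- A list of bits is written from `a` to `b`; the last bit is at the position before `m`. -/
def IsBits (B : ℕ) (w : List Sym) (a m b : ℕ) : Prop :=
  a ≤ m ∧ m + 1 = b ∧ w[m]? = some .sep ∧
    ∀ i < B, a ≤ i → i < m → ∃ c, w[i]? = some (.bit c)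

/-- The symbols that start a variable. -/
def kindSym : Fin 4 → Sym := ![.varX, .varX', .varY0, .varY1]

/-- A variable of kind at most `n` is written from `a` to `b`, and its initial value is written
at the position `x`. The initial values of the variables of kind `k` are written from `p (2 * k)` to
`p (2 * k + 1)`. -/
def IsVar (B : ℕ) (w : List Sym) (p : ℕ → ℕ) (n a b x : ℕ) : Prop :=
  ∃ k : Fin 4, k ≤ n ∧ w[a]? = some (kindSym k) ∧ ∃ m < B, a + 1 = m ∧ ∃ j < B,
    IsIndex B w m j b ∧ p (2 * k) + j = x ∧ x < p (2 * k + 1)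

/-- The number `u` is the code of the factor from `a` to `b`. -/
def IsFactor (B u a b : ℕ) : Prop :=
  ∀ i < B, (u.testBit i = true ↔ a ≤ i ∧ i < b)

/-- The factor from `a` to `b` is in the relation that `r₀` codes if `c` is false, and `r₁`
if `c` is true. -/
def Rel (B r₀ r₁ : ℕ) (c : Bool) (a b : ℕ) : Prop :=
  ∃ u < B, IsFactor B u a b ∧ (bif c then r₁ else r₀).testBit u = true

/-- The relation `Q` obeys the rules for the values of formulas under the assignment `z`. -/
def IsClosed (B : ℕ) (w : List Sym) (p : ℕ → ℕ) (n z : ℕ) (Q : Bool → ℕ → ℕ → Prop) : Prop :=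
  (∀ a < B, ∀ b < B, a + 1 = b → ∀ c : Bool, w[a]? = some (.bit c) → Q c a b) ∧
  (∀ a < B, ∀ b < B, ∀ x < B, IsVar B w p n a b x → ∀ c : Bool, z.testBit x = c → Q c a b) ∧
  (∀ a < B, ∀ m < B, ∀ b < B, a + 1 = m → w[a]? = some .neg → ∀ c : Bool,
    Q c m b → Q (!c) a b) ∧
  (∀ a < B, ∀ m < B, ∀ k < B, ∀ b < B, a + 1 = m → ∀ c d : Bool, Q c m k → Q d k b →
    (w[a]? = some .conj → Q (c && d) a b) ∧ (w[a]? = some .disj → Q (c || d) a b))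

/-- A formula with the value `c` under the assignment `z` is written from `a` to `b`. -/
def Val (B : ℕ) (w : List Sym) (p : ℕ → ℕ) (n : ℕ) (c : Bool) (z a b : ℕ) : Prop :=
  ∀ r₀ < B, ∀ r₁ < B, IsClosed B w p n z (Rel B r₀ r₁) → Rel B r₀ r₁ c a b

theorem isDef_isIndex (a j b : ℕ) :
    IsDef fun A e => IsIndex A.B (A.word false) (e a) (e j) (e b) :=
  .ex (.and (.add _ _ _) (.and (.succ _ _) (.and (.lookEq _ _ _)
    (.all (.imp (.le _ _) (.imp (.lt _ _) (.lookEq _ _ _)))))))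

theorem isDef_isBits (a m b : ℕ) :
    IsDef fun A e => IsBits A.B (A.word false) (e a) (e m) (e b) :=
  .and (.le _ _) (.and (.succ _ _) (.and (.lookEq _ _ _)
    (.all (.imp (.le _ _) (.imp (.lt _ _) (.exFinite fun _ => .lookEq _ _ _))))))

/-- The map `ρ` tells under which indices the positions `p` are found. Each quantifier in front of a
use of the formula shifts all indices by one, which accounts for `ρ i + 1`, `ρ i + 3` and the like
in later proofs. -/
theorem isDef_isVar (ρ : ℕ → ℕ) (n a b x : ℕ) :
    IsDef fun A e => IsVar A.B (A.word false) (fun i => e (ρ i)) n (e a) (e b) (e x) :=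
  .exFinite fun _ => .and (.const _) (.and (.lookEq _ _ _) (.ex (.and (.succ _ _)
    (.ex (.and (isDef_isIndex _ _ _) (.and (.add _ _ _) (.lt _ _)))))))

theorem isDef_isFactor (u a b : ℕ) : IsDef fun A e => IsFactor A.B (e u) (e a) (e b) :=
  .all (.iff (.bit _ _) (.and (.le _ _) (.lt _ _)))

theorem isDef_rel (r₀ r₁ : ℕ) (c : Bool) (a b : ℕ) :
    IsDef fun A e => Rel A.B (e r₀) (e r₁) c (e a) (e b) := by
  cases c with
  | _ => exact .ex (.and (isDef_isFactor _ _ _) (.bit _ _))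

theorem isDef_isClosed (ρ : ℕ → ℕ) (n z r₀ r₁ : ℕ) : IsDef fun A e =>
    IsClosed A.B (A.word false) (fun i => e (ρ i)) n (e z) (Rel A.B (e r₀) (e r₁)) :=
  .and (.all (.all (.imp (.succ _ _) (.allFinite fun _ => .imp (.lookEq _ _ _)
    (isDef_rel _ _ _ _ _))))) <|
  .and (.all (.all (.all (.imp (isDef_isVar (fun i => ρ i + 3) _ _ _ _) (.allFinite fun _ =>
    .imp (.bitEq _ _ _) (isDef_rel _ _ _ _ _)))))) <|
  .and (.all (.all (.all (.imp (.succ _ _) (.imp (.lookEq _ _ _) (.allFinite fun _ =>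
    .imp (isDef_rel _ _ _ _ _) (isDef_rel _ _ _ _ _)))))))
  (.all (.all (.all (.all (.imp (.succ _ _) (.allFinite fun _ => .allFinite fun _ =>
    .imp (isDef_rel _ _ _ _ _) (.imp (isDef_rel _ _ _ _ _) (.and
      (.imp (.lookEq _ _ _) (isDef_rel _ _ _ _ _))
      (.imp (.lookEq _ _ _) (isDef_rel _ _ _ _ _))))))))))

theorem isDef_val (ρ : ℕ → ℕ) (n : ℕ) (c : Bool) (z a b : ℕ) : IsDef fun A e =>
    Val A.B (A.word false) (fun i => e (ρ i)) n c (e z) (e a) (e b) :=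
  .all (.all (.imp (isDef_isClosed (fun i => ρ i + 2) _ _ _ _) (isDef_rel _ _ _ _ _)))

/-- A formula in variables of kind at most `n` is written from `a` to `b`. -/
def IsFormula (B : ℕ) (w : List Sym) (p : ℕ → ℕ) (n a b : ℕ) : Prop :=
  ∃ z < B, ∃ c, Val B w p n c z a b

/-- The word `w` encodes an instance whose parts are at the positions `p`: the initial values from
`p (2 * k)` to `p (2 * k + 1)` for `k < 4`, the index `p 9` from `p 8`, the index `p 11` from
`p 10`, and the formulas from `p 12`, `p 13` and `p 14`. -/
def IsLayout (B : ℕ) (w : List Sym) (p : ℕ → ℕ) : Prop :=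
  -- This says `p 0 = 0` by means of addition alone.
  p 0 + p 0 = p 0 ∧ IsBits B w (p 0) (p 1) (p 2) ∧ IsBits B w (p 2) (p 3) (p 4) ∧
  IsBits B w (p 4) (p 5) (p 6) ∧ IsBits B w (p 6) (p 7) (p 8) ∧
  IsIndex B w (p 8) (p 9) (p 10) ∧ p 9 < p 1 ∧ IsIndex B w (p 10) (p 11) (p 12) ∧ p 11 < p 1 ∧
  IsFormula B w p 3 (p 12) (p 13) ∧ IsFormula B w p 1 (p 13) (p 14) ∧
  IsFormula B w p 0 (p 14) (p 15) ∧ w[p 15]? = none ∧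
  -- The condition `F_imp_not_F'`, which belongs to being an instance.
  ∀ z < B, ¬ (Val B w p 3 true z (p 12) (p 13) ∧ Val B w p 1 true z (p 13) (p 14))

/-! ### Definable notions of the game -/

/-- The assignments `z` and `s` agree on the variables of kind `k`. -/
def Agree (B : ℕ) (p : ℕ → ℕ) (k z s : ℕ) : Prop :=
  ∀ i < B, p (2 * k) ≤ i → i < p (2 * k + 1) → (z.testBit i = true ↔ s.testBit i = true)

/-- A round in which nobody wins, in terms of assignments as numbers. -/
def NumStep (B : ℕ) (w : List Sym) (p : ℕ → ℕ) (s : ℕ) (h₀ h₁ : Bool) (y₀ y₁ s' : ℕ) : Prop :=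
  -- Without bits from `p 7` on, `s'` is below `2 ^ p 7`; this bounds the number of states.
  s' < B ∧ (∀ i < B, s'.testBit i = true → i < p 7) ∧
  -- The number `s'` also records the values of `X` set in this round. In step (1) the formula `F`
  -- sees these together with the old values of the other variables, a mixture that `z` represents.
  (∃ z < B, Agree B p 0 z s' ∧ (Agree B p 1 z s ∧ Agree B p 2 z s ∧ Agree B p 3 z s) ∧
    Val B w p 3 true z (p 12) (p 13)) ∧
  Val B w p 1 true s' (p 13) (p 14) ∧ s'.testBit (p 9) = h₀ ∧ s'.testBit (p 11) = h₁ ∧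
  Agree B p 2 s' y₀ ∧ Agree B p 3 s' y₁

/-- Black can win at once. -/
def NumBad (B : ℕ) (w : List Sym) (p : ℕ → ℕ) (s : ℕ) : Prop :=
  ∃ z < B, (Agree B p 1 z s ∧ Agree B p 2 z s ∧ Agree B p 3 z s) ∧
    Val B w p 3 true z (p 12) (p 13) ∧ Val B w p 0 true z (p 14) (p 15)

/-- The assignment `s` is the initial one. -/
def IsInitial (B : ℕ) (w : List Sym) (p : ℕ → ℕ) (s : ℕ) : Prop :=
  ∀ i < B, (s.testBit i = true ↔ i < p 7 ∧ w[i]? = some (.bit true))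

/-- If `T` is closed then it contains a set of sets one of which contains the initial
assignment. -/
def IsWon (B : ℕ) (w : List Sym) (p : ℕ → ℕ) (T : ℕ → Prop) : Prop :=
  (∀ F < B, Reducible B (NumStep B w p) (NumBad B w p) T F → T F) →
    ∃ F < B, T F ∧ ∃ K < B, F.testBit K = true ∧ ∃ s < B, K.testBit s = true ∧ IsInitial B w p s

theorem isDef_isFormula (ρ : ℕ → ℕ) (n a b : ℕ) : IsDef fun A e =>
    IsFormula A.B (A.word false) (fun i => e (ρ i)) n (e a) (e b) :=
  .ex (.exFinite fun _ => isDef_val (fun i => ρ i + 1) _ _ _ _ _)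

theorem isDef_isLayout (ρ : ℕ → ℕ) : IsDef fun A e =>
    IsLayout A.B (A.word false) (fun i => e (ρ i)) :=
  .and (.add _ _ _) <| .and (isDef_isBits _ _ _) <| .and (isDef_isBits _ _ _) <|
  .and (isDef_isBits _ _ _) <| .and (isDef_isBits _ _ _) <| .and (isDef_isIndex _ _ _) <|
  .and (.lt _ _) <| .and (isDef_isIndex _ _ _) <| .and (.lt _ _) <|
  .and (isDef_isFormula ρ _ _ _) <| .and (isDef_isFormula ρ _ _ _) <|
  .and (isDef_isFormula ρ _ _ _) <| .and (.lookEq _ _ _) <|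
  .all (.not (.and (isDef_val (fun i => ρ i + 1) _ _ _ _ _)
    (isDef_val (fun i => ρ i + 1) _ _ _ _ _)))

theorem isDef_agree (ρ : ℕ → ℕ) (k z s : ℕ) : IsDef fun A e =>
    Agree A.B (fun i => e (ρ i)) k (e z) (e s) :=
  .all (.imp (.le _ _) (.imp (.lt _ _) (.iff (.bit _ _) (.bit _ _))))

theorem isDef_numStep (ρ : ℕ → ℕ) (s : ℕ) (h₀ h₁ : Bool) (y₀ y₁ s' : ℕ) : IsDef fun A e =>
    NumStep A.B (A.word false) (fun i => e (ρ i)) (e s) h₀ h₁ (e y₀) (e y₁) (e s') :=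
  -- The bound `s' < B` comes for free, as all values in the environment are below `B`.
  .and (IsDef.triv.congr fun _ _ he => ⟨fun _ => he s', fun _ => trivial⟩) <|
  .and (.all (.imp (.bit _ _) (.lt _ _))) <|
  .and (.ex (.and (isDef_agree (fun i => ρ i + 1) _ _ _)
    (.and (.and (isDef_agree (fun i => ρ i + 1) _ _ _) (.and (isDef_agree (fun i => ρ i + 1) _ _ _)
      (isDef_agree (fun i => ρ i + 1) _ _ _))) (isDef_val (fun i => ρ i + 1) _ _ _ _ _)))) <|
  .and (isDef_val ρ _ _ _ _ _) <| .and (.bitEq _ _ _) <| .and (.bitEq _ _ _) <|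
  .and (isDef_agree ρ _ _ _) (isDef_agree ρ _ _ _)

theorem isDef_numBad (ρ : ℕ → ℕ) (s : ℕ) : IsDef fun A e =>
    NumBad A.B (A.word false) (fun i => e (ρ i)) (e s) :=
  .ex (.and (.and (isDef_agree (fun i => ρ i + 1) _ _ _) (.and
    (isDef_agree (fun i => ρ i + 1) _ _ _) (isDef_agree (fun i => ρ i + 1) _ _ _)))
    (.and (isDef_val (fun i => ρ i + 1) _ _ _ _ _) (isDef_val (fun i => ρ i + 1) _ _ _ _ _)))

theorem isDef_isInitial (ρ : ℕ → ℕ) (s : ℕ) : IsDef fun A e =>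
    IsInitial A.B (A.word false) (fun i => e (ρ i)) (e s) :=
  .all (.iff (.bit _ _) (.and (.lt _ _) (.lookEq _ _ _)))

/-- The set that the second word of a model represents. -/
def Marked (A : Model) (x : ℕ) : Prop := (A.word true)[x]? = some (.bit true)

theorem isDef_reducible (ρ : ℕ → ℕ) (F : ℕ) : IsDef fun A e =>
    Reducible A.B (NumStep A.B (A.word false) (fun i => e (ρ i)))
      (NumBad A.B (A.word false) (fun i => e (ρ i))) (Marked A) (e F) :=
  .or (.all (.imp (.bit _ _) (.all (.not (.bit _ _))))) <|
  .and (.all (.imp (.bit _ _) (.all (.imp (.bit _ _)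
    (.not (isDef_numBad (fun i => ρ i + 2) _)))))) <|
  .allFinite fun _ => .ex (.ex (.and (.lookEq _ _ _) (.all (.imp (.bit _ _) (.allFinite fun _ =>
    .ex (.ex (.and (.bit _ _) (.all (.imp (.bit _ _) (.all (.imp
      (isDef_numStep (fun i => ρ i + 7) _ _ _ _ _ _) (.bit _ _))))))))))))

theorem isDef_isWon (ρ : ℕ → ℕ) : IsDef fun A e =>
    IsWon A.B (A.word false) (fun i => e (ρ i)) (Marked A) :=
  .imp (.all (.imp (isDef_reducible (fun i => ρ i + 1) _) (.lookEq _ _ _)))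
    (.ex (.and (.lookEq _ _ _) (.ex (.and (.bit _ _) (.ex (.and (.bit _ _)
      (isDef_isInitial (fun i => ρ i + 3) _)))))))

/-- The word is an instance, and however it is read, White has a forced win if the set of
marked numbers is closed. -/
def IsWonInstance (A : Model) : Prop :=
  -- The existence of a layout does not involve the marked set, and `IsWon` is demanded for every
  -- layout. So no layout has to be chosen in dependence on the marked set, over which the universal
  -- quantifier stands outside.
  (∃ p : ℕ → ℕ, (∀ i, p i < A.B) ∧ IsLayout A.B (A.word false) fun i => p (min i 15)) ∧
  ∀ p : ℕ → ℕ, (∀ i, p i < A.B) → IsLayout A.B (A.word false) (fun i => p (min i 15)) →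
    IsWon A.B (A.word false) (fun i => p (min i 15)) (Marked A)

theorem isDef_isWonInstance : IsDef fun A _ => IsWonInstance A := by
  have key : ∀ e e' : ℕ → ℕ, (∀ i < 16, e i = e' i) →
      (fun i => e (min i 15)) = fun i => e' (min i 15) :=
    fun e e' h => funext fun i => h _ (by omega)
  refine .and (.exStream 16 (isDef_isLayout _) fun A e e' h => ?_)
    (.allStream 16 (.imp (isDef_isLayout _) (isDef_isWon _)) fun A e e' h => ?_)
  · rw [key e e' h]
  · rw [key e e' h]

end TeamFormula

/-! ### The meaning of the definable notions -/

namespace TeamFormula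

open StackProgram HierarchicalGame

variable {B : ℕ} {w : List Sym} {p : ℕ → ℕ} {a b m j x n : ℕ}

theorem lt_length_of_getElem? {s : Sym} (h : w[a]? = some s) : a < w.length :=
  (List.getElem?_eq_some_iff.1 h).1

theorem SegAt.le_length_of_lt {l : List Sym} (h : SegAt w a b l) (hab : a < b) : b ≤ w.length := by
  cases l with
  | nil => exact absurd h hab.ne
  | cons s l => exact h.2.le_length (lt_length_of_getElem? h.1)

theorem isIndex_iff (hB : w.length < B) : IsIndex B w a j b ↔ SegAt w a b (encodeIndex j) := by
  rw [segAt_encodeIndex]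
  constructor
  · rintro ⟨m, hm, rfl, rfl, h, h'⟩
    exact ⟨rfl, h, fun i hi hij => h' i (by omega) hi hij⟩
  · rintro ⟨rfl, h, h'⟩
    have := lt_length_of_getElem? h
    exact ⟨_, by omega, rfl, rfl, h, fun i _ hi hij => h' i hi hij⟩

theorem isBits_of_segAt {v : Fin n → Bool} (h : SegAt w a b (encodeBits v)) (hm : a + n = m) :
    IsBits B w a m b := by
  rw [segAt_encodeBits] at h
  subst hm
  refine ⟨by omega, h.1, h.2.1, fun i _ hi hij => ⟨v ⟨i - a, by omega⟩, ?_⟩⟩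
  rw [← h.2.2]
  simp [Nat.add_sub_cancel' hi]

/-- Whether the symbol is the bit `true`. -/
def isTrueBit : Option Sym → Bool
  | some (.bit c) => c
  | _ => false

theorem IsBits.segAt (h : IsBits B w a m b) (hB : w.length < B) :
    SegAt w a b (encodeBits fun j : Fin (m - a) => isTrueBit w[a + j]?) := by
  obtain ⟨h1, h2, h3, h4⟩ := h
  have := lt_length_of_getElem? h3
  rw [segAt_encodeBits, Nat.add_sub_cancel' h1]
  refine ⟨h2, h3, fun i => ?_⟩
  obtain ⟨c, hc⟩ := h4 (a + i) (by omega) (by omega) (by omega)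
  rw [hc, isTrueBit]

theorem IsBits.unique {m' b' : ℕ} (h : IsBits B w a m b) (h' : IsBits B w a m' b')
    (hB : w.length < B) : m = m' ∧ b = b' := by
  obtain ⟨h1, h2, h3, h4⟩ := h
  obtain ⟨h1', h2', h3', h4'⟩ := h'
  have := lt_length_of_getElem? h3
  have := lt_length_of_getElem? h3'
  rcases lt_trichotomy m m' with hm | rfl | hm
  · obtain ⟨c, hc⟩ := h4' m (by omega) h1 hm
    simp [h3] at hc
  · exact ⟨rfl, by omega⟩
  · obtain ⟨c, hc⟩ := h4 m' (by omega) h1' hm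
    simp [h3'] at hc

/-! ### Variables and formulas -/

/-- The intervals in `p` have the lengths `n`, `n'` and `m i`, in this order. -/
structure Dims (p : ℕ → ℕ) (n n' : ℕ) (m : Fin 2 → ℕ) : Prop where
  zero : p 0 = 0
  x : p 0 + n = p 1
  x' : p 2 + n' = p 3
  y : ∀ i : Fin 2, p (4 + 2 * i) + m i = p (5 + 2 * i)
  lt₁ : p 1 < p 2
  lt₃ : p 3 < p 4
  lt₅ : p 5 < p 6

/-- The positions that belong to the variables. -/
def position {n n' : ℕ} {m : Fin 2 → ℕ} (p : ℕ → ℕ) :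
    (Fin n ⊕ Fin n') ⊕ (Σ i : Fin 2, Fin (m i)) → ℕ :=
  Sum.elim (Sum.elim (fun j => p 0 + j) (fun j => p 2 + j)) (fun v => p (4 + 2 * v.1) + v.2)

section Variables

variable {n' : ℕ} {d : Fin 2 → ℕ}

theorem Dims.position_lt (hp : Dims p n n' d) (v : (Fin n ⊕ Fin n') ⊕ (Σ i : Fin 2, Fin (d i))) :
    position p v < p 7 := by
  obtain ⟨-, h0, h1, h2, h3, h4, h5⟩ := hp
  have h6 : p 4 + d 0 = p 5 := h2 0
  have h7 : p 6 + d 1 = p 7 := h2 1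
  rcases v with (j | j) | ⟨i, j⟩
  · simp only [position, Sum.elim_inl]
    omega
  · simp only [position, Sum.elim_inl, Sum.elim_inr]
    omega
  · have hj := j.2
    fin_cases i
    · change p 4 + (j : ℕ) < p 7
      change (j : ℕ) < d 0 at hj
      omega
    · change p 6 + (j : ℕ) < p 7
      change (j : ℕ) < d 1 at hj
      omega

theorem Dims.position_injective (hp : Dims p n n' d) :
    Function.Injective (position p : (Fin n ⊕ Fin n') ⊕ (Σ i : Fin 2, Fin (d i)) → ℕ) := by
  obtain ⟨-, h0, h1, h2, h3, h4, h5⟩ := hp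
  have h6 : p 4 + d 0 = p 5 := h2 0
  have h7 : p 6 + d 1 = p 7 := h2 1
  have key : ∀ v : (Fin n ⊕ Fin n') ⊕ (Σ i : Fin 2, Fin (d i)),
      (∃ j : Fin n, v = .inl (.inl j) ∧ position p v = p 0 + j) ∨
      (∃ j : Fin n', v = .inl (.inr j) ∧ position p v = p 2 + j) ∨
      (∃ j : Fin (d 0), v = .inr ⟨0, j⟩ ∧ position p v = p 4 + j) ∨
      (∃ j : Fin (d 1), v = .inr ⟨1, j⟩ ∧ position p v = p 6 + j) := by
    rintro ((j | j) | ⟨i, j⟩)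
    · exact .inl ⟨j, rfl, rfl⟩
    · exact .inr (.inl ⟨j, rfl, rfl⟩)
    · fin_cases i
      · exact .inr (.inr (.inl ⟨j, rfl, rfl⟩))
      · exact .inr (.inr (.inr ⟨j, rfl, rfl⟩))
  intro v v' h
  rcases key v with ⟨j, rfl, hj⟩ | ⟨j, rfl, hj⟩ | ⟨j, rfl, hj⟩ | ⟨j, rfl, hj⟩ <;>
  rcases key v' with ⟨j', rfl, hj'⟩ | ⟨j', rfl, hj'⟩ | ⟨j', rfl, hj'⟩ | ⟨j', rfl, hj'⟩ <;>
  rw [hj, hj'] at h <;>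
  first
    | (exfalso; omega)
    | (obtain rfl : j = j' := Fin.ext (by omega)
       rfl)

theorem Dims.exists_assignment (hp : Dims p n n' d)
    (u : (Fin n ⊕ Fin n') ⊕ (Σ i : Fin 2, Fin (d i)) → Bool) :
    ∃ z < 2 ^ p 7, ∀ v, z.testBit (position p v) = u v := by
  obtain ⟨z, hz, h⟩ := exists_testBit (fun i => ∃ v, position p v = i ∧ u v = true) (p 7)
  refine ⟨z, hz, fun v => ?_⟩
  rw [Bool.eq_iff_iff, h]
  constructor
  · rintro ⟨-, v', hv, hu⟩
    rwa [← hp.position_injective hv]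
  · exact fun hu => ⟨hp.position_lt v, v, rfl, hu⟩

theorem exists_isIndex_iff (hB : w.length < B) (s : Sym) (c : ℕ) :
    (w[a]? = some s ∧ ∃ m < B, a + 1 = m ∧ ∃ j < B, IsIndex B w m j b ∧ c + j = x ∧ x < c + n) ↔
      ∃ j : Fin n, x = c + j ∧ SegAt w a b (s :: encodeIndex j) := by
  constructor
  · rintro ⟨hs, _, -, rfl, j, -, hj, rfl, hx⟩
    exact ⟨⟨j, by omega⟩, rfl, hs, (isIndex_iff hB).1 hj⟩
  · rintro ⟨j, rfl, hs, hj⟩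
    have h1 := lt_length_of_getElem? hs
    have h2 := hj.le_length (by omega)
    have h3 := (segAt_encodeIndex.1 hj).1
    exact ⟨hs, _, by omega, rfl, j, by omega, (isIndex_iff hB).2 hj, rfl, by omega⟩

theorem Dims.isVar_zero (hp : Dims p n n' d) (hB : w.length < B) : IsVar B w p 0 a b x ↔
    ∃ v : Fin n, x = position (n' := n') (m := d) p (.inl (.inl v)) ∧ SegAt w a b (encodeX v) := by
  have h0 := exists_isIndex_iff (n := n) (a := a) (b := b) (x := x) hB .varX (p 0)
  rw [hp.x] at h0
  rw [IsVar, Fin.exists_fin_succ]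
  simp only [Fin.val_succ, Nat.le_zero, Nat.succ_ne_zero, false_and, exists_false, or_false]
  simpa [position, encodeX, kindSym] using h0

theorem Dims.isVar_one (hp : Dims p n n' d) (hB : w.length < B) : IsVar B w p 1 a b x ↔
    ∃ v : Fin n ⊕ Fin n', x = position (m := d) p (.inl v) ∧ SegAt w a b (encodeXX' v) := by
  have h0 := exists_isIndex_iff (n := n) (a := a) (b := b) (x := x) hB .varX (p 0)
  have h1 := exists_isIndex_iff (n := n') (a := a) (b := b) (x := x) hB .varX' (p 2)
  rw [hp.x] at h0
  rw [hp.x'] at h1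
  rw [IsVar, Sum.exists]
  refine Iff.trans ?_ (or_congr h0 h1)
  simp [Fin.exists_fin_succ, kindSym]

theorem Dims.isVar_three (hp : Dims p n n' d) (hB : w.length < B) : IsVar B w p 3 a b x ↔
    ∃ v : (Fin n ⊕ Fin n') ⊕ (Σ i : Fin 2, Fin (d i)), x = position p v ∧
      SegAt w a b (encodeXX'Y v) := by
  have h0 := exists_isIndex_iff (n := n) (a := a) (b := b) (x := x) hB .varX (p 0)
  have h1 := exists_isIndex_iff (n := n') (a := a) (b := b) (x := x) hB .varX' (p 2)
  have h2 := exists_isIndex_iff (n := d 0) (a := a) (b := b) (x := x) hB .varY0 (p 4)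
  have h3 := exists_isIndex_iff (n := d 1) (a := a) (b := b) (x := x) hB .varY1 (p 6)
  rw [hp.x] at h0
  rw [hp.x'] at h1
  rw [show p 4 + d 0 = p 5 from hp.y 0] at h2
  rw [show p 6 + d 1 = p 7 from hp.y 1] at h3
  rw [IsVar, Sum.exists, Sum.exists, Sigma.exists, Fin.exists_fin_two]
  refine Iff.trans ?_ (or_congr (or_congr h0 h1) (or_congr h2 h3))
  simp [Fin.exists_fin_succ, kindSym, or_assoc]

end Variables

/-- Empty factors all have the same code, hence `a < b`. The ends must be below `B`, where the
digits of `u` are prescribed. -/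
theorem isFactor_unique {u a' b' : ℕ} (h : IsFactor B u a b) (h' : IsFactor B u a' b')
    (hab : a < b) (hb : b < B) (hb' : b' < B) : a = a' ∧ b = b' := by
  have key : ∀ i < B, (a ≤ i ∧ i < b ↔ a' ≤ i ∧ i < b') := fun i hi => (h i hi).symm.trans (h' i hi)
  have h1 := key a (by omega)
  have h2 := key (b - 1) (by omega)
  have h3 := key a' (by omega)
  have h4 := key (b' - 1) (by omega)
  have h5 := key b hb
  have h6 := key b' hb'
  omega

theorem exists_isFactor (B : ℕ) (a b : ℕ) : ∃ u < 2 ^ b, IsFactor B u a b := by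
  obtain ⟨u, hu, h⟩ := exists_testBit (fun i => a ≤ i) b
  exact ⟨u, hu, fun i _ => (h i).trans and_comm⟩

/-- The relation that holds between `c` and the ends of a formula with the value `c`. -/
def HasValue {V : Type} (w : List Sym) (e : V → List Sym) (u : V → Bool) (c : Bool) (a b : ℕ) :
    Prop :=
  ∃ f : BFormula V, SegAt w a b (f.encode e) ∧ f.eval u = c

/-- A nonempty factor of the input has a code below `2 ^ 2 ^ w.length`, in fact one at most `2 ^
w.length` minus one, so a relation on factors is coded by a number below `2 ^ 2 ^ w.length ≤ B`.
Quantifying over `r₀` and `r₁` therefore reaches the true value relation, which is closed under the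
rules; conversely every closed relation contains it, by induction on the formula. -/
theorem val_iff {V : Type} {e : V → List Sym} {q : V → ℕ} (he : IsVarCode e)
    (hB : 2 ^ 2 ^ w.length ≤ B) (hq : ∀ v, q v < B)
    (hV : ∀ a b x, IsVar B w p n a b x ↔ ∃ v, x = q v ∧ SegAt w a b (e v))
    {c : Bool} {z : ℕ} (hb : b < B) :
    Val B w p n c z a b ↔ HasValue w e (fun v => z.testBit (q v)) c a b := by
  have hlt : w.length < 2 ^ w.length := Nat.lt_two_pow_self
  have hlt' : 2 ^ w.length < 2 ^ 2 ^ w.length := Nat.lt_two_pow_self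
  have hbound : ∀ {f : BFormula V} {a b : ℕ}, SegAt w a b (f.encode e) → a < b ∧ b ≤ w.length :=
    fun h => ⟨BFormula.lt_of_segAt he h, h.le_length_of_lt (BFormula.lt_of_segAt he h)⟩
  constructor
  · intro h
    -- The code of the true value relation, for each truth value `c`.
    have hr := fun c => exists_testBit (fun u => ∃ a b, IsFactor B u a b ∧
      HasValue w e (fun v => z.testBit (q v)) c a b) (2 ^ w.length)
    choose r hr hr' using hr
    have h1 : ∀ {c a b}, b < B → Rel B (r false) (r true) c a b →
        HasValue w e (fun v => z.testBit (q v)) c a b := by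
      rintro c a b hb ⟨u, hu, hu', hbit⟩
      rw [show (bif c then r true else r false) = r c by cases c <;> rfl, hr'] at hbit
      obtain ⟨-, a', b', hf, f, hseg, hval⟩ := hbit
      obtain ⟨h1, h2⟩ := hbound hseg
      obtain ⟨rfl, rfl⟩ := isFactor_unique hf hu' h1 (by omega) hb
      exact ⟨f, hseg, hval⟩
    have h2 : ∀ {c a b}, HasValue w e (fun v => z.testBit (q v)) c a b →
        Rel B (r false) (r true) c a b := by
      rintro c a b hv
      obtain ⟨f, hseg, hval⟩ := id hv
      obtain ⟨u, hu, hf⟩ := exists_isFactor B a b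
      have := Nat.pow_le_pow_right (n := 2) (by norm_num) (hbound hseg).2
      refine ⟨u, by omega, hf, ?_⟩
      rw [show (bif c then r true else r false) = r c by cases c <;> rfl, hr']
      exact ⟨by omega, a, b, hf, hv⟩
    refine h1 hb (h _ ((hr false).trans_le hB) _ ((hr true).trans_le hB) ⟨?_, ?_, ?_, ?_⟩)
    · intro a _ b _ hab c hc
      exact h2 ⟨.const c, ⟨hc, hab⟩, rfl⟩
    · intro a _ b _ x _ hx c hc
      obtain ⟨v, rfl, hv⟩ := (hV _ _ _).1 hx
      exact h2 ⟨.var v, hv, hc⟩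
    · rintro a _ _ hm b hb rfl ha c hc
      obtain ⟨f, hf, rfl⟩ := h1 hb hc
      exact h2 ⟨.neg f, ⟨ha, hf⟩, rfl⟩
    · rintro a _ _ _ k hk b hb rfl c d hc hd
      obtain ⟨f, hf, rfl⟩ := h1 hk hc
      obtain ⟨g, hg, rfl⟩ := h1 hb hd
      exact ⟨fun ha => h2 ⟨.conj f g, ⟨ha, segAt_append.2 ⟨k, hf, hg⟩⟩, rfl⟩,
        fun ha => h2 ⟨.disj f g, ⟨ha, segAt_append.2 ⟨k, hf, hg⟩⟩, rfl⟩⟩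
  · rintro ⟨f, hf, rfl⟩ r₀ - r₁ - ⟨hbit, hvar, hneg, hbin⟩
    clear hb
    induction f generalizing a b with
    | const c =>
      obtain ⟨h1, h2⟩ := hbound hf
      exact hbit a (by omega) b (by omega) hf.2 c hf.1
    | var v =>
      obtain ⟨h1, h2⟩ := hbound hf
      exact hvar a (by omega) b (by omega) _ (hq v) ((hV _ _ _).2 ⟨v, rfl, hf⟩) _ rfl
    | neg f ih =>
      obtain ⟨h1, h2⟩ := hbound hf
      exact hneg a (by omega) (a + 1) (by omega) b (by omega) rfl hf.1 _ (ih hf.2)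
    | conj f g ihf ihg =>
      obtain ⟨k, hf', hg⟩ := segAt_append.1 hf.2
      obtain ⟨h1, h2⟩ := hbound hf
      obtain ⟨h3, h4⟩ := hbound hf'
      exact (hbin a (by omega) (a + 1) (by omega) k (by omega) b (by omega) rfl _ _ (ihf hf')
        (ihg hg)).1 hf.1
    | disj f g ihf ihg =>
      obtain ⟨k, hf', hg⟩ := segAt_append.1 hf.2
      obtain ⟨h1, h2⟩ := hbound hf
      obtain ⟨h3, h4⟩ := hbound hf'
      exact (hbin a (by omega) (a + 1) (by omega) k (by omega) b (by omega) rfl _ _ (ihf hf')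
        (ihg hg)).2 hf.1

theorem HasValue.unique {V : Type} {e : V → List Sym} (he : IsVarCode e) {u u' : V → Bool}
    {c c' : Bool} {b' : ℕ} (h : HasValue w e u c a b) (h' : HasValue w e u' c' a b') : b = b' := by
  obtain ⟨f, hf, -⟩ := h
  obtain ⟨g, hg, -⟩ := h'
  exact (BFormula.encode_inj he hf hg).2

theorem hasValue_iff {V : Type} {e : V → List Sym} (he : IsVarCode e) {f : BFormula V}
    (hf : SegAt w a b (f.encode e)) {u : V → Bool} {c : Bool} :
    HasValue w e u c a b ↔ f.eval u = c := by
  constructor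
  · rintro ⟨g, hg, hc⟩
    rwa [(BFormula.encode_inj he hf hg).1]
  · exact fun hc => ⟨f, hf, hc⟩

end TeamFormula

/-! ### Instances and layouts -/

namespace TeamFormula

open StackProgram HierarchicalGame

/-- The instance `I` is encoded by `w`, and `p` lists the positions of its parts. -/
structure Fits (w : List Sym) (p : ℕ → ℕ) (I : TFG) : Prop extends Dims p I.nX I.nX' I.nY where
  initX : SegAt w (p 0) (p 2) (encodeBits I.initX)
  initX' : SegAt w (p 2) (p 4) (encodeBits I.initX')
  initY₀ : SegAt w (p 4) (p 6) (encodeBits (I.initY 0))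
  initY₁ : SegAt w (p 6) (p 8) (encodeBits (I.initY 1))
  index₀ : SegAt w (p 8) (p 10) (encodeIndex (I.h 0))
  index₁ : SegAt w (p 10) (p 12) (encodeIndex (I.h 1))
  h₀ : p 9 = I.h 0
  h₁ : p 11 = I.h 1
  F : SegAt w (p 12) (p 13) (I.F.encode encodeXX'Y)
  F' : SegAt w (p 13) (p 14) (I.F'.encode encodeXX')
  G : SegAt w (p 14) (p 15) (I.G.encode encodeX)
  last : p 15 = w.length

variable {B : ℕ} {w : List Sym} {p : ℕ → ℕ} {I : TFG}

theorem Fits.encode_eq (h : Fits w p I) : I.encode = w := by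
  refine SegAt.eq ?_
  rw [← h.last, ← h.zero]
  simp only [TFG.encode, segAt_append]
  exact ⟨_, ⟨_, ⟨_, ⟨_, ⟨_, ⟨_, ⟨_, ⟨_, h.initX, h.initX'⟩, h.initY₀⟩, h.initY₁⟩, h.index₀⟩,
    h.index₁⟩, h.F⟩, h.F'⟩, h.G⟩

theorem exists_fits (I : TFG) : ∃ p : ℕ → ℕ, (∀ i, p i ≤ I.encode.length) ∧
    (∀ i, p (min i 15) = p i) ∧ Fits I.encode p I := by
  have h := segAt_self (w := I.encode)
  obtain ⟨w, hw⟩ : ∃ w, w = I.encode := ⟨_, rfl⟩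
  rw [← hw] at h ⊢
  have h' : SegAt w 0 w.length I.encode := hw ▸ h
  simp only [TFG.encode, segAt_append] at h'
  obtain ⟨q₈, ⟨q₇, ⟨q₆, ⟨q₅, ⟨q₄, ⟨q₃, ⟨q₂, ⟨q₁, h1, h2⟩, h3⟩, h4⟩, h5⟩, h6⟩, h7⟩, h8⟩, h9⟩ := h'
  have k1 := (segAt_encodeBits.1 h1).1
  have k2 := (segAt_encodeBits.1 h2).1
  have k3 := (segAt_encodeBits.1 h3).1
  have k4 := (segAt_encodeBits.1 h4).1
  have k5 := h5.length_eq
  have k6 := h6.length_eq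
  have k7 := h7.length_eq
  have k8 := h8.length_eq
  have k9 := h9.length_eq
  have l0 := (I.h 0).2
  have l1 := (I.h 1).2
  -- The default `w.length` supplies `p 15`, the end of the word, and makes `p` constant from there
  -- on.
  obtain ⟨p, hp⟩ : ∃ p : ℕ → ℕ, ∀ i, p i = [0, I.nX, q₁, q₁ + I.nX', q₂, q₂ + I.nY 0, q₃,
    q₃ + I.nY 1, q₄, (I.h 0 : ℕ), q₅, (I.h 1 : ℕ), q₆, q₇, q₈].getD i w.length := ⟨_, fun _ => rfl⟩
  have e0 : p 0 = 0 := hp 0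
  have e1 : p 1 = I.nX := hp 1
  have e2 : p 2 = q₁ := hp 2
  have e3 : p 3 = q₁ + I.nX' := hp 3
  have e4 : p 4 = q₂ := hp 4
  have e5 : p 5 = q₂ + I.nY 0 := hp 5
  have e6 : p 6 = q₃ := hp 6
  have e7 : p 7 = q₃ + I.nY 1 := hp 7
  have e8 : p 8 = q₄ := hp 8
  have e9 : p 9 = I.h 0 := hp 9
  have e10 : p 10 = q₅ := hp 10
  have e11 : p 11 = I.h 1 := hp 11
  have e12 : p 12 = q₆ := hp 12
  have e13 : p 13 = q₇ := hp 13
  have e14 : p 14 = q₈ := hp 14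
  have e15 : p 15 = w.length := hp 15
  refine ⟨p, fun i => ?_, fun i => ?_, ⟨e0, by omega, by omega, Fin.forall_fin_two.2 ⟨?_, ?_⟩,
    by omega, by omega, by omega⟩, by rwa [e0, e2], by rwa [e2, e4], by rwa [e4, e6],
    by rwa [e6, e8], by rwa [e8, e10], by rwa [e10, e12], e9, e11, by rwa [e12, e13],
    by rwa [e13, e14], by rwa [e14, e15], e15⟩
  · by_cases hi : i < 15
    · interval_cases i <;> omega
    · rw [hp, List.getD_eq_default _ _ (by simpa using hi)]
  · by_cases hi : i ≤ 15
    · rw [min_eq_left hi]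
    · rw [hp, hp, List.getD_eq_default _ _ (by simp; omega),
        List.getD_eq_default _ _ (by simp; omega)]
  · change p 4 + _ = p 5
    omega
  · change p 6 + _ = p 7
    omega

theorem Fits.le_length (h : Fits w p I) {i : ℕ} (hi : i < 16) : p i ≤ w.length := by
  have k1 := (segAt_encodeBits.1 h.initX).1
  have k2 := (segAt_encodeBits.1 h.initX').1
  have k3 := (segAt_encodeBits.1 h.initY₀).1
  have k4 := (segAt_encodeBits.1 h.initY₁).1
  have k5 := h.index₀.length_eq
  have k6 := h.index₁.length_eq
  have k7 := h.F.length_eq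
  have k8 := h.F'.length_eq
  have k9 := h.G.length_eq
  have l0 := (I.h 0).2
  have l1 := (I.h 1).2
  have m0 := h.x
  have m1 := h.x'
  have m2 : p 4 + I.nY 0 = p 5 := h.y 0
  have m3 : p 6 + I.nY 1 = p 7 := h.y 1
  have m4 := h.h₀
  have m5 := h.h₁
  have m6 := h.last
  interval_cases i <;> omega

section Dims

variable {n n' : ℕ} {d : Fin 2 → ℕ} (hp : Dims p n n' d) (hB : 2 ^ 2 ^ w.length ≤ B)
  (hpB : ∀ i, p i < B) {c : Bool} {z a b : ℕ} (hb : b < B)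
include hp hB hpB hb

theorem Dims.val_zero : Val B w p 0 c z a b ↔ HasValue w encodeX
    (fun v : Fin n => z.testBit (position (n' := n') (m := d) p (.inl (.inl v)))) c a b := by
  have h1 : w.length < 2 ^ w.length := Nat.lt_two_pow_self
  have h2 : 2 ^ w.length < 2 ^ 2 ^ w.length := Nat.lt_two_pow_self
  exact val_iff isVarCode_encodeX hB (fun v => (hp.position_lt _).trans (hpB 7))
    (fun a b x => hp.isVar_zero (by omega)) hb

theorem Dims.val_one : Val B w p 1 c z a b ↔ HasValue w encodeXX'
    (fun v : Fin n ⊕ Fin n' => z.testBit (position (m := d) p (.inl v))) c a b := by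
  have h1 : w.length < 2 ^ w.length := Nat.lt_two_pow_self
  have h2 : 2 ^ w.length < 2 ^ 2 ^ w.length := Nat.lt_two_pow_self
  exact val_iff isVarCode_encodeXX' hB (fun v => (hp.position_lt _).trans (hpB 7))
    (fun a b x => hp.isVar_one (by omega)) hb

theorem Dims.val_three : Val B w p 3 c z a b ↔ HasValue w encodeXX'Y
    (fun v : (Fin n ⊕ Fin n') ⊕ (Σ i : Fin 2, Fin (d i)) => z.testBit (position p v)) c a b := by
  have h1 : w.length < 2 ^ w.length := Nat.lt_two_pow_self
  have h2 : 2 ^ w.length < 2 ^ 2 ^ w.length := Nat.lt_two_pow_self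
  exact val_iff isVarCode_encodeXX'Y hB (fun v => (hp.position_lt _).trans (hpB 7))
    (fun a b x => hp.isVar_three (by omega)) hb

end Dims

/-- The values of the variables in `X` under the assignment `z`. -/
def xOf (I : TFG) (p : ℕ → ℕ) (z : ℕ) : Fin I.nX → Bool := fun j => z.testBit (p 0 + j)

/-- The values of the variables in `Y_i` under the assignment `z`. -/
def yOf (I : TFG) (p : ℕ → ℕ) (i : Fin 2) (z : ℕ) : Fin (I.nY i) → Bool :=
  fun j => z.testBit (p (4 + 2 * i) + j)

/-- The values of the variables in `X'`, `Y_0` and `Y_1` under the assignment `z`. -/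
def posOf (I : TFG) (p : ℕ → ℕ) (z : ℕ) : I.Pos :=
  (fun j => z.testBit (p 2 + j), fun i => yOf I p i z)

section Fits

variable (h : Fits w p I) (hB : 2 ^ 2 ^ w.length ≤ B) (hpB : ∀ i, p i < B) {z : ℕ}
include h hB hpB

theorem Fits.val_F :
    Val B w p 3 true z (p 12) (p 13) ↔
      I.evalF (xOf I p z) (posOf I p z).1 (posOf I p z).2 = true := by
  rw [h.val_three hB hpB (hpB _), hasValue_iff isVarCode_encodeXX'Y h.F, TFG.evalF]
  congr! 2
  funext v
  rcases v with (v | v) | ⟨i, v⟩ <;> rfl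

theorem Fits.val_F' :
    Val B w p 1 true z (p 13) (p 14) ↔ I.evalF' (xOf I p z) (posOf I p z).1 = true := by
  rw [h.val_one hB hpB (hpB _), hasValue_iff isVarCode_encodeXX' h.F', TFG.evalF']
  congr! 2
  funext v
  rcases v with v | v <;> rfl

theorem Fits.val_G : Val B w p 0 true z (p 14) (p 15) ↔ I.evalG (xOf I p z) = true := by
  rw [h.val_zero hB hpB (hpB _), hasValue_iff isVarCode_encodeX h.G, TFG.evalG]
  rfl

theorem Fits.isLayout : IsLayout B w p := by
  have h1 : w.length < 2 ^ w.length := Nat.lt_two_pow_self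
  have h2 : 2 ^ w.length < 2 ^ 2 ^ w.length := Nat.lt_two_pow_self
  have l0 := (I.h 0).2
  have l1 := (I.h 1).2
  have m0 := h.x
  have m4 := h.h₀
  have m5 := h.h₁
  refine ⟨by rw [h.zero], isBits_of_segAt h.initX h.x, isBits_of_segAt h.initX' h.x',
    isBits_of_segAt h.initY₀ (h.y 0), isBits_of_segAt h.initY₁ (h.y 1), ?_, by omega, ?_, by omega,
    ⟨0, by omega, _, (h.val_three hB hpB (hpB _)).2 ⟨_, h.F, rfl⟩⟩,
    ⟨0, by omega, _, (h.val_one hB hpB (hpB _)).2 ⟨_, h.F', rfl⟩⟩,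
    ⟨0, by omega, _, (h.val_zero hB hpB (hpB _)).2 ⟨_, h.G, rfl⟩⟩, ?_, fun z _ hz => ?_⟩
  · rw [isIndex_iff (by omega), h.h₀]
    exact h.index₀
  · rw [isIndex_iff (by omega), h.h₁]
    exact h.index₁
  · rw [h.last]
    simp
  · rw [h.val_F hB hpB, h.val_F' hB hpB] at hz
    have := I.F_imp_not_F' _ _ _ hz.1
    rw [TFG.evalF'] at hz
    simp [hz.2] at this

end Fits

theorem IsLayout.exists_fits (h : IsLayout B w p) (hB : 2 ^ 2 ^ w.length ≤ B)
    (hpB : ∀ i, p i < B) : ∃ I, Fits w p I := by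
  obtain ⟨g0, g1, g2, g3, g4, g5, g6, g7, g8, ⟨_, -, _, gF⟩, ⟨_, -, _, gF'⟩, ⟨_, -, _, gG⟩, glast,
    gimp⟩ := h
  have h1 : w.length < 2 ^ w.length := Nat.lt_two_pow_self
  have h2 : 2 ^ w.length < 2 ^ 2 ^ w.length := Nat.lt_two_pow_self
  have s1 := g1.segAt (by omega)
  have s2 := g2.segAt (by omega)
  have s3 := g3.segAt (by omega)
  have s4 := g4.segAt (by omega)
  have d1 := g1.1
  have d2 := g2.1
  have d3 := g3.1
  have d4 := g4.1
  have e1 := g1.2.1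
  have e2 := g2.2.1
  have e3 := g3.2.1
  have hp : Dims p (p 1 - p 0) (p 3 - p 2) (fun i => p (5 + 2 * i) - p (4 + 2 * i)) :=
    ⟨by omega, by omega, by omega, Fin.forall_fin_two.2
      ⟨show p 4 + (p 5 - p 4) = p 5 by omega, show p 6 + (p 7 - p 6) = p 7 by omega⟩,
      by omega, by omega, by omega⟩
  obtain ⟨F, sF, -⟩ := (hp.val_three hB hpB (hpB _)).1 gF
  obtain ⟨F', sF', -⟩ := (hp.val_one hB hpB (hpB _)).1 gF'
  obtain ⟨G, sG, -⟩ := (hp.val_zero hB hpB (hpB _)).1 gG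
  refine ⟨{ nX := p 1 - p 0, nX' := p 3 - p 2, nY := fun i => p (5 + 2 * i) - p (4 + 2 * i),
            initX := _, initX' := _, initY := fun i j => isTrueBit w[p (4 + 2 * i) + j]?,
            h := ![⟨p 9, by omega⟩, ⟨p 11, by omega⟩],
            F := F, F' := F', G := G, F_imp_not_F' := fun x x' y hF => ?_ },
    ⟨hp, s1, s2, s3, s4, (isIndex_iff (by omega)).1 g5, (isIndex_iff (by omega)).1 g7, rfl, rfl,
      sF, sF', sG, ?_⟩⟩
  -- Every assignment has a code below `2 ^ p 7 ≤ B`, so the last clause of `IsLayout` covers all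
  -- assignments.
  · obtain ⟨z, hz, hz'⟩ := hp.exists_assignment (Sum.elim (Sum.elim x x') fun v => y v.1 v.2)
    have hz₁ : (fun v => z.testBit (position (m := fun i => p (5 + 2 * i) - p (4 + 2 * i)) p
        (.inl v))) = Sum.elim x x' := funext fun v => hz' (.inl v)
    have hlt := lt_length_of_getElem? g4.2.2.1
    have := Nat.pow_le_pow_right (n := 2) (by norm_num) hlt.le
    by_contra hF'
    refine gimp z (by omega) ⟨(hp.val_three hB hpB (hpB _)).2 ⟨F, sF, ?_⟩,
      (hp.val_one hB hpB (hpB _)).2 ⟨F', sF', ?_⟩⟩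
    · exact (congrArg F.eval (funext hz')).trans hF
    · rw [hz₁]
      simpa using hF'
  · have := sG.le_length_of_lt (BFormula.lt_of_segAt isVarCode_encodeX sG)
    have := List.getElem?_eq_none_iff.1 glast
    omega

/-- The parts of an encoding follow one another and each is uniquely readable, so the start of a
part determines its end, and the positions agree one after the other. -/
theorem IsLayout.eq_of_fits {q : ℕ → ℕ} (h : IsLayout B w p) (hq : Fits w q I)
    (hB : 2 ^ 2 ^ w.length ≤ B) (hpB : ∀ i, p i < B) (hqB : ∀ i, q i < B) {i : ℕ} (hi : i < 16) :
    p i = q i := by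
  obtain ⟨g0, g1, g2, g3, g4, g5, g6, g7, g8, ⟨_, -, _, gF⟩, ⟨_, -, _, gF'⟩, ⟨_, -, _, gG⟩, -⟩ := h
  have h1 : w.length < 2 ^ w.length := Nat.lt_two_pow_self
  have h2 : 2 ^ w.length < 2 ^ 2 ^ w.length := Nat.lt_two_pow_self
  have hwB : w.length < B := by omega
  obtain ⟨k0, k1, k2, k3, k4, k5, -, k7, -⟩ := hq.isLayout hB hqB
  have e0 : p 0 = q 0 := by omega
  rw [e0] at g1
  obtain ⟨e1, e2⟩ := g1.unique k1 hwB
  rw [e2] at g2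
  obtain ⟨e3, e4⟩ := g2.unique k2 hwB
  rw [e4] at g3
  obtain ⟨e5, e6⟩ := g3.unique k3 hwB
  rw [e6] at g4
  obtain ⟨e7, e8⟩ := g4.unique k4 hwB
  rw [isIndex_iff hwB] at g5 g7 k5 k7
  rw [e8] at g5
  obtain ⟨e9, e10⟩ := segAt_encodeIndex_inj g5 k5
  rw [e10] at g7
  obtain ⟨e11, e12⟩ := segAt_encodeIndex_inj g7 k7
  have hp : Dims p I.nX I.nX' I.nY := by
    obtain ⟨d1, d2, d3, d4, d5, d6, d7⟩ := hq.toDims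
    rw [Fin.forall_fin_two] at d4
    refine ⟨by omega, by omega, by omega, Fin.forall_fin_two.2 ⟨?_, ?_⟩, by omega, by omega,
      by omega⟩
    · have : q 4 + I.nY 0 = q 5 := d4.1
      change p 4 + _ = p 5
      omega
    · have : q 6 + I.nY 1 = q 7 := d4.2
      change p 6 + _ = p 7
      omega
  rw [hp.val_three hB hpB (hpB _), e12] at gF
  have e13 : p 13 = q 13 := gF.unique (u' := fun _ => true) isVarCode_encodeXX'Y ⟨_, hq.F, rfl⟩
  rw [hp.val_one hB hpB (hpB _), e13] at gF'
  have e14 : p 14 = q 14 := gF'.unique (u' := fun _ => true) isVarCode_encodeXX' ⟨_, hq.F', rfl⟩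
  rw [hp.val_zero hB hpB (hpB _), e14] at gG
  have e15 : p 15 = q 15 := gG.unique (u' := fun _ => true) isVarCode_encodeX ⟨_, hq.G, rfl⟩
  interval_cases i <;> assumption

end TeamFormula

/-! ### The game on numbers -/

namespace HierarchicalGame

variable {S S' A₀ A₁ A₀' A₁' : Type} {Step : S → Bool → Bool → A₀ → A₁ → S → Prop} {Bad : S → Prop}
  {Step' : S' → Bool → Bool → A₀' → A₁' → S' → Prop} {Bad' : S' → Prop}
  {f : S' → S} {f₀ : A₀' → A₀} {f₁ : A₁' → A₁} {σ : List Bool → A₀'}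
  {τ : List (Bool × Bool) → A₁'}

/-- The map `f` sends steps to steps and bad states to bad states, so every play of the primed game
projects to one that is won. -/
theorem Wins.comap
    (hstep : ∀ s h₀ h₁ y₀ y₁ s', Step' s h₀ h₁ y₀ y₁ s' → Step (f s) h₀ h₁ (f₀ y₀) (f₁ y₁) (f s'))
    (hbad : ∀ s, Bad' s → Bad (f s)) {s : S'}
    (h : Wins Step Bad (fun l => f₀ (σ l)) (fun l => f₁ (τ l)) (f s)) : Wins Step' Bad' σ τ s := by
  obtain ⟨t, ht⟩ : ∃ t, t = f s := ⟨_, rfl⟩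
  obtain ⟨σ', hσ⟩ : ∃ σ', σ' = fun l => f₀ (σ l) := ⟨_, rfl⟩
  obtain ⟨τ', hτ⟩ : ∃ τ', τ' = fun l => f₁ (τ l) := ⟨_, rfl⟩
  rw [← ht, ← hσ, ← hτ] at h
  induction h generalizing σ τ s with
  | intro hb _ ih =>
    subst ht hσ hτ
    exact .intro (fun hs => hb (hbad s hs)) fun h₀ h₁ s' hs =>
      ih h₀ h₁ (f s') (hstep _ _ _ _ _ _ hs) rfl rfl rfl

/-- The converse transfer needs lifting: every step that starts in the image of a state comes from a
step of that state. -/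
theorem Wins.map
    (hstep : ∀ s h₀ h₁ y₀ y₁ t, Step (f s) h₀ h₁ (f₀ y₀) (f₁ y₁) t →
      ∃ s', f s' = t ∧ Step' s h₀ h₁ y₀ y₁ s')
    (hbad : ∀ s, Bad (f s) → Bad' s) {s : S'} (h : Wins Step' Bad' σ τ s) :
    Wins Step Bad (fun l => f₀ (σ l)) (fun l => f₁ (τ l)) (f s) := by
  induction h with
  | intro hb _ ih =>
    refine .intro (fun hs => hb (hbad _ hs)) fun h₀ h₁ t ht => ?_
    obtain ⟨s', rfl, hs'⟩ := hstep _ _ _ _ _ _ ht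
    exact ih _ _ _ hs'

end HierarchicalGame

namespace TeamFormula

open StackProgram HierarchicalGame SpaceComplexity

variable {B : ℕ} {w : List Sym} {p : ℕ → ℕ} {I : TFG} {z s : ℕ}

theorem agree_iff {k n : ℕ} (hk : p (2 * k) + n = p (2 * k + 1)) (hB : p (2 * k + 1) < B) :
    Agree B p k z s ↔
      (fun j : Fin n => z.testBit (p (2 * k) + j)) = fun j : Fin n =>
        s.testBit (p (2 * k) + j) := by
  rw [funext_iff]
  constructor
  · intro h j
    exact Bool.eq_iff_iff.2 (h _ (by omega) (by omega) (by omega))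
  · intro h i _ hi hi'
    have := h ⟨i - p (2 * k), by omega⟩
    simp only [Nat.add_sub_cancel' hi] at this
    rw [this]

section Fits

variable (h : Fits w p I) (hB : 2 ^ 2 ^ w.length ≤ B) (hpB : ∀ i, p i < B)
include h hpB

theorem Fits.agree_zero : Agree B p 0 z s ↔ xOf I p z = xOf I p s :=
  agree_iff h.x (hpB _)

theorem Fits.agree_two : Agree B p 2 z s ↔ yOf I p 0 z = yOf I p 0 s :=
  agree_iff (h.y 0) (hpB _)

theorem Fits.agree_three : Agree B p 3 z s ↔ yOf I p 1 z = yOf I p 1 s :=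
  agree_iff (h.y 1) (hpB _)

theorem Fits.agree_pos :
    (Agree B p 1 z s ∧ Agree B p 2 z s ∧ Agree B p 3 z s) ↔ posOf I p z = posOf I p s := by
  rw [h.agree_two hpB, h.agree_three hpB, posOf, posOf, Prod.mk.injEq,
    agree_iff (k := 1) h.x' (hpB _), funext_iff (f := fun i => yOf I p i z), Fin.forall_fin_two]

include hB

theorem Fits.step_of_numStep {h₀ h₁ : Bool} {y₀ y₁ s' : ℕ} (hs : NumStep B w p s h₀ h₁ y₀ y₁ s') :
    I.Step (posOf I p s) h₀ h₁ (yOf I p 0 y₀) (yOf I p 1 y₁) (posOf I p s') := by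
  obtain ⟨-, -, ⟨z, -, hx, hz, hF⟩, hF', hh₀, hh₁, hy₀, hy₁⟩ := hs
  rw [h.agree_pos hpB] at hz
  rw [h.agree_zero hpB] at hx
  rw [h.val_F hB hpB, hz, hx] at hF
  rw [h.val_F' hB hpB] at hF'
  refine ⟨xOf I p s', hF, hF', ?_, ?_, (h.agree_two hpB).1 hy₀, (h.agree_three hpB).1 hy₁⟩
  · rw [← hh₀, xOf, h.h₀, h.zero, zero_add]
  · rw [← hh₁, xOf, h.h₁, h.zero, zero_add]

theorem Fits.exists_assignment (x : Fin I.nX → Bool) (t : I.Pos) :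
    ∃ z < B, z < 2 ^ p 7 ∧ xOf I p z = x ∧ posOf I p z = t := by
  have h1 : w.length < 2 ^ w.length := Nat.lt_two_pow_self
  have h2 : 2 ^ w.length < 2 ^ 2 ^ w.length := Nat.lt_two_pow_self
  have := Nat.pow_le_pow_right (n := 2) (by norm_num) (h.le_length (i := 7) (by norm_num))
  obtain ⟨z, hz, hv⟩ := h.toDims.exists_assignment (Sum.elim (Sum.elim x t.1) fun v => t.2 v.1 v.2)
  refine ⟨z, by omega, hz, funext fun j => hv (.inl (.inl j)), Prod.ext ?_ ?_⟩
  · exact funext fun j => hv (.inl (.inr j))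
  · exact funext fun i => funext fun j => hv (.inr ⟨i, j⟩)

theorem Fits.exists_numStep {h₀ h₁ : Bool} {y₀ y₁ : ℕ} {t : I.Pos}
    (ht : I.Step (posOf I p s) h₀ h₁ (yOf I p 0 y₀) (yOf I p 1 y₁) t) :
    ∃ s', posOf I p s' = t ∧ NumStep B w p s h₀ h₁ y₀ y₁ s' := by
  obtain ⟨x, hF, hF', rfl, rfl, hy₀, hy₁⟩ := ht
  obtain ⟨s', hs', hs'', rfl, rfl⟩ := h.exists_assignment hB hpB x t
  obtain ⟨z, hz, -, hzx, hzs⟩ := h.exists_assignment hB hpB (xOf I p s') (posOf I p s)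
  refine ⟨s', rfl, hs', fun i _ hi => ?_, ⟨z, hz, (h.agree_zero hpB).2 hzx,
    (h.agree_pos hpB).2 hzs, (h.val_F hB hpB).2 (by rwa [hzx, hzs])⟩, (h.val_F' hB hpB).2 hF',
    ?_, ?_, (h.agree_two hpB).2 hy₀, (h.agree_three hpB).2 hy₁⟩
  · exact (Nat.pow_lt_pow_iff_right (by norm_num)).1
      ((Nat.ge_two_pow_of_testBit hi).trans_lt hs'')
  · rw [xOf, h.h₀, h.zero, zero_add]
  · rw [xOf, h.h₁, h.zero, zero_add]

theorem Fits.numBad_iff : NumBad B w p s ↔ I.Bad (posOf I p s) := by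
  constructor
  · rintro ⟨z, -, hz, hF, hG⟩
    rw [h.agree_pos hpB] at hz
    rw [h.val_F hB hpB, hz] at hF
    exact ⟨_, hF, (h.val_G hB hpB).1 hG⟩
  · rintro ⟨x, hF, hG⟩
    obtain ⟨z, hz, -, rfl, hzs⟩ := h.exists_assignment hB hpB x (posOf I p s)
    exact ⟨z, hz, (h.agree_pos hpB).2 hzs, (h.val_F hB hpB).2 (by rwa [hzs]),
      (h.val_G hB hpB).2 hG⟩

/-- Assignments coded by numbers carry superfluous information, such as the values of `X`, which
`posOf` and `yOf` forget. Steps project and lift along these maps, so strategies can be transferred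
in both directions. -/
theorem Fits.exists_wins_iff (s : ℕ) :
    (∃ σ τ, Wins I.Step I.Bad σ τ (posOf I p s)) ↔ ∃ σ τ, (∀ l, σ l < B) ∧ (∀ l, τ l < B) ∧
      Wins (NumStep B w p) (NumBad B w p) σ τ s := by
  constructor
  · rintro ⟨σ, τ, hw⟩
    -- A code below `B` for each move, which turns strategies of the original game into strategies
    -- on numbers.
    have key : ∀ (i : Fin 2) (y : Fin (I.nY i) → Bool), ∃ z < B, yOf I p i z = y := by
      intro i y
      obtain ⟨z, hz, -, -, hzt⟩ := h.exists_assignment hB hpB (fun _ => true)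
        (fun _ => true, Function.update (fun _ _ => true) i y)
      refine ⟨z, hz, ?_⟩
      have := congrFun (congrArg Prod.snd hzt) i
      simpa [posOf] using this
    choose g hg hg' using key
    refine ⟨fun l => g 0 (σ l), fun l => g 1 (τ l), fun _ => hg _ _, fun _ => hg _ _, ?_⟩
    refine Wins.comap (f := posOf I p) (f₀ := yOf I p 0) (f₁ := yOf I p 1)
      (fun _ _ _ _ _ _ hs => h.step_of_numStep hB hpB hs)
      (fun _ hs => (h.numBad_iff hB hpB).1 hs) ?_
    simpa only [hg'] using hw
  · rintro ⟨σ, τ, -, -, hw⟩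
    exact ⟨_, _, hw.map (f := posOf I p) (f₀ := yOf I p 0) (f₁ := yOf I p 1)
      (fun _ _ _ _ _ _ ht => h.exists_numStep hB hpB ht)
      (fun _ hs => (h.numBad_iff hB hpB).2 hs)⟩

end Fits

theorem Fits.exists_isInitial (h : Fits w p I) (hB : w.length < B) :
    ∃ s < 2 ^ p 7, posOf I p s = (I.initX', I.initY) ∧
      ∀ s' < B, IsInitial B w p s' ↔ s' = s := by
  obtain ⟨s, hs, hbit⟩ := exists_testBit (fun i => w[i]? = some (.bit true)) (p 7)
  have hp7 := h.le_length (i := 7) (by norm_num)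
  have hval : ∀ {c o n : ℕ} {v : Fin n → Bool}, SegAt w c o (encodeBits v) → c + n ≤ p 7 →
      ∀ j : Fin n, s.testBit (c + j) = v j := by
    intro c o n v hv hn j
    rw [Bool.eq_iff_iff, hbit, (segAt_encodeBits.1 hv).2.2]
    simp
    omega
  have k0 : p 2 + I.nX' = p 3 := h.x'
  have k1 : p 4 + I.nY 0 = p 5 := h.y 0
  have k2 : p 6 + I.nY 1 = p 7 := h.y 1
  have k3 := h.lt₃
  have k4 := h.lt₅
  refine ⟨s, hs, Prod.ext (funext fun j => hval h.initX' (by omega) j) (funext ?_),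
    fun s' hs' => ?_⟩
  · rw [Fin.forall_fin_two]
    exact ⟨funext fun j => hval h.initY₀ (by omega) j, funext fun j => hval h.initY₁ (by omega) j⟩
  · constructor
    · intro hi
      refine Nat.eq_of_testBit_eq fun i => ?_
      rw [Bool.eq_iff_iff, hbit]
      by_cases hiB : i < B
      · exact hi i hiB
      · constructor
        · intro hb
          have := lt_of_testBit hb
          omega
        · rintro ⟨hlt, -⟩
          omega
    · rintro rfl i -
      exact hbit i

/-- This is where the height of the exponential comes from: there are `2 ^ p 7 ≤ 2 ^ w.length`
states, and the two nested powersets add two exponentials. -/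
theorem Fits.exists_wins_iff_isWon (h : Fits w p I) (hB : 2 ^ 2 ^ 2 ^ w.length ≤ B)
    (hpB : ∀ i, p i < B) : (∃ σ τ, Wins I.Step I.Bad σ τ (I.initX', I.initY)) ↔
      ∀ T : ℕ → Prop, (∀ x, T x → x < B) → IsWon B w p T := by
  have h0 : w.length < 2 ^ w.length := Nat.lt_two_pow_self
  have h1 : 2 ^ w.length < 2 ^ 2 ^ w.length := Nat.lt_two_pow_self
  have h2 : 2 ^ 2 ^ w.length < 2 ^ 2 ^ 2 ^ w.length := Nat.lt_two_pow_self
  obtain ⟨s, hs, hpos, hinit⟩ := h.exists_isInitial (B := B) (by omega)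
  have hp7 := Nat.pow_le_pow_right (n := 2) (by norm_num) (h.le_length (i := 7) (by norm_num))
  have hN : 2 ^ 2 ^ 2 ^ p 7 ≤ B := (Nat.pow_le_pow_right (by norm_num)
    (Nat.pow_le_pow_right (by norm_num) hp7)).trans hB
  have hstep : ∀ s h₀ h₁ y₀ y₁ s', NumStep B w p s h₀ h₁ y₀ y₁ s' → s' < 2 ^ p 7 := by
    rintro s h₀ h₁ y₀ y₁ s' ⟨hs', hbit, -⟩
    refine Nat.lt_pow_two_of_testBit _ fun i hi => ?_
    by_contra hb
    rw [Bool.not_eq_false] at hb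
    have := hbit i ((lt_of_testBit hb).trans hs') hb
    omega
  rw [← hpos, h.exists_wins_iff (by omega) hpB, HierarchicalGame.exists_wins_iff hstep hN hs]
  refine forall_congr' fun T => imp_congr_right fun _ => imp_congr_right fun _ => ?_
  refine exists_congr fun F => and_congr_right fun _ => and_congr_right fun _ =>
    exists_congr fun K => and_congr_right fun _ => and_congr_right fun _ => ?_
  constructor
  · exact fun hK => ⟨s, by omega, hK, (hinit s (by omega)).2 rfl⟩
  · rintro ⟨s', hs', hK, hi⟩
    rwa [← (hinit s' hs').1 hi]

/-- A subset of the domain is a word of `B` bits; in this way the quantifier over `T` becomes the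
one over the second word. -/
theorem forall_list_marked_iff {P : (ℕ → Prop) → Prop} (hB : 0 < B) :
    (∀ T : ℕ → Prop, (∀ x, T x → x < B) → P T) ↔
      ∀ l : List Bool, l.length = B → P (Marked (wordModel B hB w l)) := by
  have hm : ∀ (l : List Bool) x, Marked (wordModel B hB w l) x ↔ l[x]? = some true := by
    intro l x
    simp [Marked, wordModel]
  constructor
  · intro h l hl
    refine h _ fun x hx => ?_
    rw [hm] at hx
    have := (List.getElem?_eq_some_iff.1 hx).1
    omega
  · classical
    intro h T hT
    have := h (List.ofFn fun x : Fin B => decide (T x)) (by simp)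
    convert this using 1
    funext x
    rw [hm, List.getElem?_ofFn]
    by_cases hx : x < B
    · simp [hx]
    · simpa [hx] using fun hx' => hx (hT x hx')

/-- The encodings of the instances in which the hierarchical game is won. -/
def wonInstances : Language Sym :=
  {w | ∃ I : TFG, I.encode = w ∧ ∃ σ τ, Wins I.Step I.Bad σ τ (I.initX', I.initY)}

theorem wonInstances_mem_kEXPSPACE : wonInstances ∈ kEXPSPACE 3 := by
  obtain ⟨φ, hφ⟩ := isDef_isWonInstance
  refine mem_kEXPSPACE_of_formula φ _ fun w => ?_
  have hsat : ∀ l : List Bool,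
      φ.Sat (wordModel (expTower 3 w.length) (expTower_pos 2 _) w l) (fun _ => 0) ↔
        IsWonInstance (wordModel (expTower 3 w.length) (expTower_pos 2 _) w l) :=
    fun l => hφ _ _ fun _ => expTower_pos 2 _
  simp only [hsat]
  obtain ⟨B, hBdef⟩ : ∃ B, B = expTower 3 w.length := ⟨_, rfl⟩
  have hB : 2 ^ 2 ^ 2 ^ w.length ≤ B := hBdef.ge
  have h0 : w.length < 2 ^ w.length := Nat.lt_two_pow_self
  have h1 : 2 ^ w.length < 2 ^ 2 ^ w.length := Nat.lt_two_pow_self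
  have h2 : 2 ^ 2 ^ w.length < 2 ^ 2 ^ 2 ^ w.length := Nat.lt_two_pow_self
  have hpos : 0 < B := by omega
  have hB' : 2 ^ 2 ^ w.length ≤ B := by omega
  suffices w ∈ wonInstances ↔ ∀ l : List Bool, l.length = B →
      IsWonInstance (wordModel B hpos w l) by
    subst hBdef
    exact this
  constructor
  · rintro ⟨I, rfl, hwin⟩ l hl
    obtain ⟨q, hq, hq', hfit⟩ := exists_fits I
    have hqB : ∀ i, q i < B := fun i => (hq i).trans_lt (by omega)
    have hq'' : (fun i => q (min i 15)) = q := funext hq'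
    refine ⟨⟨q, hqB, ?_⟩, fun p hpB hp => ?_⟩
    · rw [hq'']
      exact hfit.isLayout hB' hqB
    -- Uniqueness of the layout: a win in terms of `q` is a win in terms of every layout.
    · have : (fun i => p (min i 15)) = q := by
        funext i
        rw [← hq' i]
        simpa using hp.eq_of_fits (i := min i 15) hfit hB' (fun i => hpB _) hqB (by omega)
      rw [this]
      exact (forall_list_marked_iff hpos).1 ((hfit.exists_wins_iff_isWon hB hqB).1 hwin) l hl
  · intro h
    -- The layout does not depend on the second word, so any word of length `B` may be used to
    -- obtain it.
    obtain ⟨⟨p, hpB, hp⟩, -⟩ := h (List.replicate B true) (by simp)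
    obtain ⟨I, hI⟩ := hp.exists_fits hB' fun i => hpB _
    refine ⟨I, hI.encode_eq, ?_⟩
    rw [hI.exists_wins_iff_isWon hB (fun i => hpB _)]
    exact (forall_list_marked_iff hpos).2 fun l hl => (h l hl).2 p hpB hp

end TeamFormula

/-- A single language in 3-EXPSPACE is the problem TFGC under every policy with one bit mid-round
in every round from `W_0` to `W_1` and no other communication. -/
theorem mainTheorem6 :
    ∃ L ∈ SpaceComplexity.kEXPSPACE (α := TeamFormula.Sym) 3,
      ∀ P : TeamFormula.Policy, P.IsMidOneWay → TeamFormula.TFGC P = L := by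
  refine ⟨TeamFormula.wonInstances, TeamFormula.wonInstances_mem_kEXPSPACE, fun P hP => ?_⟩
  ext w
  exact exists_congr fun I => and_congr_right fun _ => TeamFormula.whiteForcedWin_iff hP I
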